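/- **Setting.** Let $A_1,\dots,A_B\in\mathbb R^{d\times d}$ be i.i.d. with square-integrable entries. Their mean $\Sigma=\mathbb E[A_i]$ is symmetric positive semidefinite with largest eigenvalue $\lambda_1>0$. For $u\in\mathbb R^d$ put $H_u=\lambda_1^{-2}\,\mathbb E[(A_i-\Sigma)uu^\top(A_i-\Sigma)^\top]$. For parameters $K,a>0$ assume the tail condition $$\max_{\|u\|=\|v\|=1}\ \mathbb E\Big[\exp\Big(\Big(\tfrac{|u^\top(A_i^\top-\Sigma)v|^2}{K^2\lambda_1^2\|H_u\|_2}\Big)^{1/(2a)}\Big)\Big]\le 2 ,$$ where $\|\cdot\|_2$ is the spectral norm and $0/0=0$. **Algorithm (Private Top Eigenvalue Estimation).** The input is $g_1,\dots,g_B\in\mathbb R^d$, with parameters $\varepsilon,\delta,\zeta$ and a constant $C_1>0$. 1. Put $k=\lceil C_1\log(1/(\delta\zeta))/\varepsilon\rceil$, $b=\lfloor B/(2k)\rfloor$ and $\tilde g_i=g_{2i}-g_{2i-1}$. For $j=1,\dots,k$ let $G_j\in\mathbb R^{d\times b}$ have as columns the $j$-th run of $b$ consecutive differences $\tilde g_i$.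 Let $\lambda_1^{(j)}$ be the largest eigenvalue of $\frac1{2b}G_jG_j^\top$ (read as the zero matrix if $b=0$). 2. Partition $[0,\infty)$ into the bins $\{0\}$ and $[2^{m/4},2^{(m+1)/4})$, $m\in\mathbb Z$. To the fraction of the points $\lambda_1^{(1)},\dots,\lambda_1^{(k)}$ in each occupied bin add independent Laplace noise of scale $2/(\varepsilon k)$. Replace the result by $0$ if it is below $\frac{2\log(2/\delta)}{\varepsilon k}+\frac1k$. Bins that are not occupied get the value $0$. 3. If all values are $0$, return $\perp$. Otherwise return the left endpoint $\hat\Lambda$ of a bin with the largest value. A randomized algorithm $q$ on datasets of size $B$ is $(\varepsilon,\delta)$-DP if $\mathbb P(q(S)\in E)\le e^{\varepsilon}\,\mathbb P(q(S')\in E)+\delta$ for every set $E$ of outputs and all datasets $S,S'$ that differ in at most one entry. **Theorem.** 1. *(Privacy)* For all $B,d$, all $C_1,\varepsilon>0$ and all $\delta,\zeta\in(0,1)$ the algorithm is $(\varepsilon,\delta)$-DP. 2. *(Utility)* There is a universal constant $C_0>0$ such that for every $C_1\ge C_0$ and every $a>0$ there is a constant $C=C(C_1,a)>0$ with the following property.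 Let $d\ge 1$, let $A_1,\dots,A_B$ be as above with tail parameters $K,a$, let $u\in\mathbb R^d$ be fixed and let $g_i=A_iu$. Let $\varepsilon\in(0,1]$, $\delta,\zeta\in(0,1)$ with $\delta\zeta\le\frac12$, and $B\ge2$ with $$B\ \ge\ C\,\frac{K^2\,d\,\log^{1+2a}\!\big(Bd\log(1/(\delta\zeta))/\varepsilon\big)\,\log(1/(\zeta\delta))}{\varepsilon}.$$ Then with probability at least $1-\zeta$ over the data and the noise, the algorithm outputs $\hat\Lambda\neq\perp$ with $$\hat\Lambda\in\Big[\tfrac1{\sqrt2}\lambda_1^2\|H_u\|_2,\ \sqrt2\,\lambda_1^2\|H_u\|_2\Big].$$ -/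

import Mathlib

open MeasureTheory
open scoped Matrix

noncomputable section

namespace PrivateTopEigenvalue

/-! ### Matrices and the data model -/

/-- Matrices carry the product (Borel) sigma-algebra of their entries. -/
instance instMeasurableSpaceMatrix {d : ℕ} : MeasurableSpace (Matrix (Fin d) (Fin d) ℝ) :=
  inferInstanceAs (MeasurableSpace (Fin d → Fin d → ℝ))

/-- The largest eigenvalue of a real symmetric matrix (the supremum of its real spectrum). -/
def topEigenvalue {d : ℕ} (M : Matrix (Fin d) (Fin d) ℝ) : ℝ :=
  sSup (spectrum ℝ M)

/-- The spectral norm `‖M‖₂`, the operator norm for the Euclidean norm. -/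
def spectralNorm {d : ℕ} (M : Matrix (Fin d) (Fin d) ℝ) : ℝ :=
  ‖Matrix.toEuclideanCLM (n := Fin d) (𝕜 := ℝ) M‖

/-- The matrix `H_u = λ₁⁻² E[(A - Σ) u uᵀ (A - Σ)ᵀ]` for `A` of law `D` and mean `S`, where `λ₁` is
the largest eigenvalue of `S`; the expectation is taken entry by entry. -/
def gradientCov {d : ℕ} (D : Measure (Matrix (Fin d) (Fin d) ℝ)) (S : Matrix (Fin d) (Fin d) ℝ)
    (u : Fin d → ℝ) : Matrix (Fin d) (Fin d) ℝ :=
  Matrix.of fun i j =>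
    (1 / topEigenvalue S ^ 2) *
      ∫ M, ((M - S) * Matrix.vecMulVec u u * (M - S)ᵀ) i j ∂D

/-- `S` is the mean of the law `D`, it is symmetric positive semidefinite with a positive largest
eigenvalue, and the entries of `A ∼ D` are square-integrable (so that all `H_u` exist). -/
structure HasPSDMean {d : ℕ} (D : Measure (Matrix (Fin d) (Fin d) ℝ))
    (S : Matrix (Fin d) (Fin d) ℝ) : Prop where
  memLp : ∀ i j, MemLp (fun M : Matrix (Fin d) (Fin d) ℝ => M i j) 2 D
  mean : ∀ i j, ∫ M, M i j ∂D = S i j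
  posSemidef : S.PosSemidef
  top_pos : 0 < topEigenvalue S

/-- The tail condition with parameters `K, a`: for all unit vectors `u, v`,
`E exp((|uᵀ(Aᵀ - Σ)v|² / (K² λ₁² ‖H_u‖₂))^(1/(2a))) ≤ 2`. -/
def HasTail {d : ℕ} (D : Measure (Matrix (Fin d) (Fin d) ℝ)) (S : Matrix (Fin d) (Fin d) ℝ)
    (K a : ℝ) : Prop :=
  ∀ u v : Fin d → ℝ, u ⬝ᵥ u = 1 → v ⬝ᵥ v = 1 →
    ∫⁻ M, ENNReal.ofReal (Real.exp
      ((|u ⬝ᵥ ((Mᵀ - S) *ᵥ v)| ^ 2 /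
        (K ^ 2 * topEigenvalue S ^ 2 * spectralNorm (gradientCov D S u))) ^ (1 / (2 * a)))) ∂D ≤ 2

/-! ### Laplace noise -/

/-- The standard Laplace distribution, with density `exp (-|x|) / 2`. -/
def stdLaplace : Measure ℝ :=
  volume.withDensity fun x => ENNReal.ofReal (Real.exp (-|x|) / 2)

instance : IsProbabilityMeasure stdLaplace := by
  have h1 : ∫ x : ℝ, Real.exp (-|x|) / 2 = 1 := by
    have h := integral_comp_abs (f := fun x => Real.exp (-x))
    rw [integral_div, h, integral_exp_neg_Ioi_zero]
    norm_num
  have hi : Integrable fun x : ℝ => Real.exp (-|x|) / 2 := by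
    by_contra hn
    rw [integral_undef hn] at h1
    exact zero_ne_one h1
  constructor
  rw [stdLaplace, withDensity_apply _ MeasurableSet.univ, Measure.restrict_univ,
    ← ofReal_integral_eq_lintegral_ofReal hi (Filter.Eventually.of_forall fun x => by positivity),
    h1, ENNReal.ofReal_one]

/-! ### The stability-based histogram -/

/-- The empirical frequency of the bin `s` among the points `x`. -/
def frequency {k : ℕ} (x : Fin k → ℝ) (s : Set ℝ) : ℝ :=
  (Nat.card {j : Fin k // x j ∈ s} : ℝ) / k

/-- The stability-based histogram of `k` points over the bins `bin β`: noise `Lap(2/(ε k))` is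
added to the frequency of each occupied bin, and what falls below the threshold
`2 log(2/δ)/(ε k) + 1/k` is set to zero; bins that are not occupied get the value zero. The
variables `η β` are the standard Laplace variables before scaling. -/
def stabilityHistogram {ι : Type*} {k : ℕ} (bin : ι → Set ℝ) (ε δ : ℝ) (x : Fin k → ℝ)
    (η : ι → ℝ) (β : ι) : ℝ :=
  open Classical in
  if frequency x (bin β) = 0 then 0
  else if frequency x (bin β) + 2 / (ε * k) * η β < 2 * Real.log (2 / δ) / (ε * k) + 1 / k then 0
  else frequency x (bin β) + 2 / (ε * k) * η β

/-- The bins: `none` stands for `[0,0]` and `some m` for `[2^(m/4), 2^((m+1)/4))`. -/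
def geomBin : Option ℤ → Set ℝ
  | none => {0}
  | some m => Set.Ico ((2 : ℝ) ^ ((m : ℝ) / 4)) ((2 : ℝ) ^ (((m : ℝ) + 1) / 4))

/-- The left endpoint of a bin. -/
def leftEnd : Option ℤ → ℝ
  | none => 0
  | some m => (2 : ℝ) ^ ((m : ℝ) / 4)

/-- The law of the internal randomness: independent standard Laplace variables, one per bin. -/
def noiseLaw : Measure (Option ℤ → ℝ) :=
  Measure.infinitePi fun _ => stdLaplace

/-- `β` is a non-empty bin of the histogram `h` with the largest value. -/
def IsTopBin {ι : Type*} (h : ι → ℝ) (β : ι) : Prop :=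
  0 < h β ∧ ∀ β', h β' ≤ h β

/-! ### The algorithm -/

/-- The number of blocks, `k = C₁ log(1/(δζ))/ε` rounded up. -/
def numBlocks (C₁ ε δ ζ : ℝ) : ℕ :=
  ⌈C₁ * Real.log (1 / (δ * ζ)) / ε⌉₊

/-- The size of a block, `b = ⌊B/(2k)⌋`. -/
def blockSize (B k : ℕ) : ℕ :=
  B / (2 * k)

theorem pair_index_lt {B k : ℕ} (j : Fin k) (i : Fin (blockSize B k)) :
    2 * (j.val * blockSize B k + i.val) + 1 < B := by
  have h1 : blockSize B k * (2 * k) ≤ B := Nat.div_mul_le_self _ _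
  have h2 : (j.val + 1) * blockSize B k ≤ k * blockSize B k := Nat.mul_le_mul_right _ j.isLt
  have h3 := i.isLt
  nlinarith

/-- The `d × b` matrix `G_j` of the `j`-th block; its columns are the differences
`g̃_m = g_{2m} - g_{2m-1}` of consecutive samples, `b` consecutive values of `m` for each block
(the samples are indexed from `0` here). -/
def blockMatrix {B d : ℕ} (k : ℕ) (g : Fin B → Fin d → ℝ) (j : Fin k) :
    Matrix (Fin d) (Fin (blockSize B k)) ℝ :=
  Matrix.of fun l i =>
    g ⟨2 * (j.val * blockSize B k + i.val) + 1, pair_index_lt j i⟩ l -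
      g ⟨2 * (j.val * blockSize B k + i.val), (Nat.lt_succ_self _).trans (pair_index_lt j i)⟩ l

/-- The largest eigenvalue of `(1/(2b)) G_j G_jᵀ`, the empirical covariance of the `2b` samples
that enter block `j`. -/
def blockEigenvalue {B d : ℕ} (k : ℕ) (g : Fin B → Fin d → ℝ) (j : Fin k) : ℝ :=
  topEigenvalue ((1 / (2 * (blockSize B k : ℝ))) • (blockMatrix k g j * (blockMatrix k g j)ᵀ))

/-- Private top eigenvalue estimation on the dataset `g` with internal noise `η`: the left endpoint
of a fullest bin of the private histogram of the block eigenvalues, or `none` (`⊥`) if all bins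
are empty. (Two bins tie with probability zero.) -/
def privateTopEigenvalue {B d : ℕ} (C₁ ε δ ζ : ℝ) (g : Fin B → Fin d → ℝ) (η : Option ℤ → ℝ) :
    Option ℝ :=
  open Classical in
  if h : ∃ β, IsTopBin (stabilityHistogram geomBin ε δ
      (blockEigenvalue (numBlocks C₁ ε δ ζ) g) η) β
  then some (leftEnd h.choose) else none

/-! ### Differential privacy -/

/-- Two datasets of the same size are neighbors if they differ in at most one entry. -/
def Neighboring {α : Type*} {B : ℕ} (s s' : Fin B → α) : Prop :=
  ∃ i, ∀ j, j ≠ i → s j = s' j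

/-- `(ε, δ)`-differential privacy of the randomized query `s ↦ q s η`, with `η` of law `P`. -/
def IsDP {α Ω O : Type*} [MeasurableSpace Ω] {B : ℕ} (P : Measure Ω) (q : (Fin B → α) → Ω → O)
    (ε δ : ℝ) : Prop :=
  ∀ s s', Neighboring s s' → ∀ E : Set O,
    P {η | q s η ∈ E} ≤ ENNReal.ofReal (Real.exp ε) * P {η | q s' η ∈ E} + ENNReal.ofReal δ

end PrivateTopEigenvalue

end

noncomputable section

namespace PrivateTopEigenvalue

section

/-! ### Laplace noise: tails and shifts -/

/-! Privacy. The blocks use disjoint sets of samples, so changing one sample changes at most one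
block eigenvalue, that is, it moves one point of a histogram from one bin to another. At most two
frequencies change, each by `1/k`. If a changed bin is occupied before and after, a translation of
its Laplace variable by at most `ε/2` absorbs the change at the cost of a factor `exp (ε/2)`
(`noisyThreshold_shift`). If it passes between empty and a single point, the threshold hides the
difference unless the noise exceeds `log (2/δ)`, which costs an additive `δ/2`
(`noisyThreshold_hide`). Two such steps give `(ε, δ)` (`noisyThreshold_move`).

Utility. Let `Λ = λ₁² ‖H_u‖₂`, the norm of the covariance matrix of `A u`. Differences of
consecutive samples are centered with twice that covariance, so a block eigenvalue is the top
eigenvalue of an empirical covariance with target `Λ`. It lies in `(7/8 Λ, 9/8 Λ)` with high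
probability (`measure_topEigenvalue_gram_bad_le`). To see this, vectors are truncated at squared
norm `R`. The lower tail is a scalar Chernoff bound in the top direction (`measure_sum_le_le`),
where truncation loses little of the variance (`integral_truncate_ge`). The upper tail follows from
Markov's inequality for the trace of a high power and the moment bound `E tr (∑ xᵢxᵢᵀ)^q ≤ d (nL +
qR)^q` (`lintegral_trace_gram_pow_le`). That bound takes the place of a matrix Chernoff inequality;
it is proved by leaving one sample out and expanding a rank-one perturbation (`rankOne_moment_le`).

The interval `(7/8 Λ, 9/8 Λ)` meets at most three bins, all with left endpoint within a factor `√2`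
of `Λ`. The blocks are independent, so fewer than `log (1/(δζ))` of them fail, up to probability
`ζ/2` (`utility_of_pos`). This is a tiny fraction of `k`, so one of the three bins is clearly the
fullest, and noise on the few occupied bins does not change that
(`topBinEndpoint_stabilityHistogram`, `noiseLaw_occupied_le`). If `Λ = 0`, then `A u` is almost
surely constant, all block eigenvalues are `0`, and the bin `{0}` wins. -/

theorem stdLaplace_le_abs (s : ℝ) (hs : 0 ≤ s) :
    stdLaplace {y | s ≤ |y|} ≤ ENNReal.ofReal (Real.exp (-s)) := by
  have hIci : ∫⁻ x in Set.Ioi s, ENNReal.ofReal (Real.exp (-x) / 2) =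
      ENNReal.ofReal (Real.exp (-s) / 2) := by
    rw [← ofReal_integral_eq_lintegral_ofReal]
    · rw [integral_div, integral_exp_neg_Ioi]
    · exact (integrableOn_exp_neg_Ioi s).div_const 2
    · exact Filter.Eventually.of_forall fun x => by positivity
  have h1 : stdLaplace (Set.Ici s) ≤ ENNReal.ofReal (Real.exp (-s) / 2) := by
    rw [stdLaplace, withDensity_apply _ measurableSet_Ici, setLIntegral_congr Ioi_ae_eq_Ici.symm,
      ← hIci]
    refine (setLIntegral_congr_fun measurableSet_Ioi fun x hx => ?_).le
    rw [abs_of_nonneg (hs.trans (le_of_lt hx))]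
  have h2 : stdLaplace (Set.Iic (-s)) ≤ ENNReal.ofReal (Real.exp (-s) / 2) := by
    rw [stdLaplace, withDensity_apply _ measurableSet_Iic, ← hIci,
      setLIntegral_congr Iio_ae_eq_Iic.symm]
    have := (Measure.measurePreserving_neg (volume : Measure ℝ)).setLIntegral_comp_preimage
      (s := Set.Iio (-s)) (f := fun x => ENNReal.ofReal (Real.exp (-|x|) / 2)) measurableSet_Iio
      (by fun_prop)
    rw [← this]
    have hp : (Neg.neg ⁻¹' Set.Iio (-s) : Set ℝ) = Set.Ioi s := by ext x; simp
    rw [hp]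
    refine (setLIntegral_congr_fun measurableSet_Ioi fun x hx => ?_).le
    rw [abs_neg, abs_of_nonneg (hs.trans (le_of_lt hx))]
  have hsub : {y : ℝ | s ≤ |y|} ⊆ Set.Ici s ∪ Set.Iic (-s) := by
    intro y hy
    rcases le_abs.1 (show s ≤ |y| from hy) with h | h
    · exact Or.inl h
    · exact Or.inr (by simp only [Set.mem_Iic]; linarith)
  calc stdLaplace {y | s ≤ |y|} ≤ stdLaplace (Set.Ici s ∪ Set.Iic (-s)) := measure_mono hsub
    _ ≤ stdLaplace (Set.Ici s) + stdLaplace (Set.Iic (-s)) := measure_union_le _ _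
    _ ≤ _ := add_le_add h1 h2
    _ = _ := by rw [← ENNReal.ofReal_add (by positivity) (by positivity), add_halves]

/-- By the triangle inequality, translating the density `exp (-|x|) / 2` by `c` changes it by a
factor of at most `exp |c|`. -/
theorem stdLaplace_shift (c : ℝ) {T : Set ℝ} (hT : MeasurableSet T) :
    stdLaplace {y | y + c ∈ T} ≤ ENNReal.ofReal (Real.exp |c|) * stdLaplace T := by
  have hT' : MeasurableSet {y | y + c ∈ T} := (measurable_add_const c) hT
  rw [stdLaplace, withDensity_apply _ hT', withDensity_apply _ hT,
    ← lintegral_const_mul _ (by fun_prop)]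
  have := (measurePreserving_add_right (volume : Measure ℝ) c).setLIntegral_comp_preimage
      (s := T) (f := fun x => ENNReal.ofReal (Real.exp |c|) *
        ENNReal.ofReal (Real.exp (-|x|) / 2)) hT (by fun_prop)
  rw [← this]
  refine lintegral_mono fun x => ?_
  rw [← ENNReal.ofReal_mul (Real.exp_pos _).le]
  refine ENNReal.ofReal_le_ofReal ?_
  rw [← mul_div_assoc, ← Real.exp_add]
  gcongr
  have := abs_add_le x c
  linarith

theorem measurable_update_pair (β : Option ℤ) :
    Measurable fun p : (Option ℤ → ℝ) × ℝ => Function.update p.1 β p.2 := by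
  refine measurable_pi_iff.2 fun i => ?_
  by_cases h : i = β
  · subst h; simpa using measurable_snd
  · simp only [Function.update_of_ne h]
    exact (measurable_pi_apply i).comp measurable_fst

/-- Resampling one coordinate does not change a product law. This splits off the coordinate `β` from
the infinite product, so that a one-dimensional estimate can be applied under Fubini. -/
theorem map_update_noiseLaw (β : Option ℤ) :
    (noiseLaw.prod stdLaplace).map (fun p => Function.update p.1 β p.2) = noiseLaw := by
  refine Measure.eq_infinitePi _ fun s t ht => ?_
  have hm := measurable_update_pair β
  rw [Measure.map_apply hm (MeasurableSet.pi s.countable_toSet fun i _ => ht i)]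
  by_cases hβ : β ∈ s
  · have : (fun p : (Option ℤ → ℝ) × ℝ => Function.update p.1 β p.2) ⁻¹' (Set.pi s t) =
        (Set.pi (s.erase β : Finset _) t) ×ˢ t β := by
      ext ⟨η, y⟩
      simp only [Set.mem_preimage, Set.mem_pi, Finset.mem_coe, Set.mem_prod, Finset.mem_erase]
      constructor
      · intro h
        refine ⟨fun i hi => ?_, by simpa using h β hβ⟩
        simpa [Function.update_of_ne hi.1] using h i hi.2
      · rintro ⟨h1, h2⟩ i hi
        by_cases h : i = β
        · subst h; simpa using h2
        · simpa [Function.update_of_ne h] using h1 i ⟨h, hi⟩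
    rw [this, Measure.prod_prod, noiseLaw, Measure.infinitePi_pi _ fun i _ => ht i, mul_comm]
    exact Finset.mul_prod_erase s (fun i => stdLaplace (t i)) hβ
  · have : (fun p : (Option ℤ → ℝ) × ℝ => Function.update p.1 β p.2) ⁻¹' (Set.pi s t) =
        (Set.pi s t) ×ˢ Set.univ := by
      ext ⟨η, y⟩
      simp only [Set.mem_preimage, Set.mem_pi, Finset.mem_coe, Set.mem_prod, Set.mem_univ, and_true]
      refine forall₂_congr fun i hi => ?_
      rw [Function.update_of_ne (fun h : i = β => hβ (by rwa [← h]))]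
    rw [this, Measure.prod_prod, noiseLaw, Measure.infinitePi_pi _ fun i _ => ht i, measure_univ,
      mul_one]

instance : IsProbabilityMeasure noiseLaw := by unfold noiseLaw; infer_instance

/-- Shifting one coordinate of the noise by `c` changes probabilities by a factor `exp |c|`. -/
theorem noiseLaw_shift (β : Option ℤ) (c : ℝ) (T : Set (Option ℤ → ℝ)) :
    noiseLaw {η | Function.update η β (η β + c) ∈ T} ≤
      ENNReal.ofReal (Real.exp |c|) * noiseLaw T := by
  -- Privacy is claimed for arbitrary output sets, so `T` may fail to be measurable; its measurable
  -- hull has the same outer measure.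
  wlog hT : MeasurableSet T generalizing T
  · refine le_trans (measure_mono fun η hη => ?_)
      ((this (toMeasurable noiseLaw T) (measurableSet_toMeasurable _ _)).trans
        (by rw [measure_toMeasurable]))
    exact subset_toMeasurable _ _ hη
  have hm := measurable_update_pair β
  have hs : Measurable fun η : Option ℤ → ℝ => Function.update η β (η β + c) :=
    hm.comp (measurable_id.prodMk ((measurable_pi_apply β).add measurable_const) :
      Measurable fun η : Option ℤ → ℝ => (η, η β + c))
  have hS : MeasurableSet {η : Option ℤ → ℝ | Function.update η β (η β + c) ∈ T} := hs hT
  conv_lhs => rw [← map_update_noiseLaw β]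
  conv_rhs => rw [← map_update_noiseLaw β]
  rw [Measure.map_apply hm hS, Measure.map_apply hm hT, Measure.prod_apply (hm hS),
    Measure.prod_apply (hm hT), ← lintegral_const_mul _ (measurable_measure_prodMk_left (hm hT))]
  refine lintegral_mono fun η => ?_
  have hη : MeasurableSet {y | Function.update η β y ∈ T} :=
    (hm.comp (measurable_const.prodMk measurable_id)) hT
  refine le_trans (le_of_eq ?_) (stdLaplace_shift c hη)
  congr 1
  ext y
  simp

theorem noiseLaw_le_abs (β : Option ℤ) (s : ℝ) (hs : 0 ≤ s) :
    noiseLaw {η | s ≤ |η β|} ≤ ENNReal.ofReal (Real.exp (-s)) := by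
  have h : MeasurableSet {y : ℝ | s ≤ |y|} := measurableSet_le measurable_const measurable_id.abs
  exact ((measurePreserving_eval_infinitePi (fun _ : Option ℤ => stdLaplace) β).measure_preimage
    h.nullMeasurableSet).trans_le (stdLaplace_le_abs s hs)

end

section

/-! ### The bins -/

theorem geomBin_some_iff (m : ℤ) (y : ℝ) :
    y ∈ geomBin (some m) ↔ 0 < y ∧ (m : ℝ) ≤ 4 * Real.logb 2 y ∧ 4 * Real.logb 2 y < m + 1 := by
  simp only [geomBin, Set.mem_Ico]
  constructor
  · rintro ⟨h1, h2⟩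
    have hy : 0 < y := lt_of_lt_of_le (by positivity) h1
    refine ⟨hy, ?_, ?_⟩
    · have := (Real.le_logb_iff_rpow_le (b := 2) one_lt_two hy).2 h1
      linarith
    · have := (Real.logb_lt_iff_lt_rpow (b := 2) one_lt_two hy).2 h2
      linarith
  · rintro ⟨hy, h1, h2⟩
    constructor
    · exact (Real.le_logb_iff_rpow_le (b := 2) one_lt_two hy).1 (by linarith)
    · exact (Real.logb_lt_iff_lt_rpow (b := 2) one_lt_two hy).1 (by linarith)

theorem exists_mem_geomBin {y : ℝ} (hy : 0 ≤ y) : ∃ β, y ∈ geomBin β := by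
  rcases hy.eq_or_lt with rfl | hy
  · exact ⟨none, rfl⟩
  · exact ⟨some ⌊4 * Real.logb 2 y⌋, (geomBin_some_iff _ _).2
      ⟨hy, Int.floor_le _, Int.lt_floor_add_one _⟩⟩

theorem geomBin_unique {y : ℝ} {β β' : Option ℤ} (h : y ∈ geomBin β) (h' : y ∈ geomBin β') :
    β = β' := by
  have key : ∀ m : ℤ, y ∈ geomBin (some m) → y ≠ 0 := fun m hm =>
    ((geomBin_some_iff m y).1 hm).1.ne'
  rcases β with _ | m <;> rcases β' with _ | m'
  · rfl
  · exact absurd h (key m' h')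
  · exact absurd h' (key m h)
  · obtain ⟨-, h1, h2⟩ := (geomBin_some_iff m y).1 h
    obtain ⟨-, h3, h4⟩ := (geomBin_some_iff m' y).1 h'
    rw [← Int.floor_eq_iff.2 ⟨h1, h2⟩, ← Int.floor_eq_iff.2 ⟨h3, h4⟩]

/-! ### Privacy of the stability-based histogram -/

/-- The stability-based histogram as a function of the bin frequencies. -/
def noisyThreshold (k : ℕ) (ε δ : ℝ) (p : Option ℤ → ℝ) (η : Option ℤ → ℝ) (β : Option ℤ) : ℝ :=
  open Classical in
  if p β = 0 then 0
  else if p β + 2 / (ε * k) * η β < 2 * Real.log (2 / δ) / (ε * k) + 1 / k then 0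
  else p β + 2 / (ε * k) * η β

theorem stabilityHistogram_eq_noisyThreshold {k : ℕ} (ε δ : ℝ) (x : Fin k → ℝ)
    (η : Option ℤ → ℝ) :
    stabilityHistogram geomBin ε δ x η =
      noisyThreshold k ε δ (fun β => frequency x (geomBin β)) η := rfl

variable {k : ℕ} {ε δ : ℝ}

/-- When the bin `β` is occupied in both histograms, the change of its frequency is compensated
exactly by a translation of its noise. -/
theorem noisyThreshold_shift (hk : 0 < k) (hε : 0 < ε) {p p' : Option ℤ → ℝ} (β : Option ℤ)
    (hne : ∀ β', β' ≠ β → p β' = p' β') (hp : p β ≠ 0) (hp' : p' β ≠ 0)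
    (hd : |p β - p' β| ≤ 1 / k) (H : Set (Option ℤ → ℝ)) :
    noiseLaw {η | noisyThreshold k ε δ p η ∈ H} ≤
      ENNReal.ofReal (Real.exp (ε / 2)) * noiseLaw {η | noisyThreshold k ε δ p' η ∈ H} := by
  have hk' : (0 : ℝ) < k := by exact_mod_cast hk
  -- Measured in units of the noise scale `2/(εk)`, a change of at most `1/k` becomes a translation
  -- of at most `ε/2`.
  set c := (p β - p' β) * (ε * k / 2) with hc
  have hcabs : |c| ≤ ε / 2 := by
    rw [hc, abs_mul, abs_of_pos (by positivity : 0 < ε * k / 2)]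
    calc |p β - p' β| * (ε * k / 2) ≤ 1 / k * (ε * k / 2) := by gcongr
      _ = ε / 2 := by field_simp
  have heq : ∀ η, noisyThreshold k ε δ p η =
      noisyThreshold k ε δ p' (Function.update η β (η β + c)) := by
    intro η
    ext β'
    by_cases h : β' = β
    · subst h
      have : p' β' + 2 / (ε * k) * (η β' + c) = p β' + 2 / (ε * k) * η β' := by
        rw [hc]; field_simp; ring
      simp only [noisyThreshold, hp, hp', if_false, Function.update_self, this]
    · simp only [noisyThreshold, Function.update_of_ne h, hne β' h]
  calc noiseLaw {η | noisyThreshold k ε δ p η ∈ H}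
      = noiseLaw {η | Function.update η β (η β + c) ∈ {η | noisyThreshold k ε δ p' η ∈ H}} := by
        congr 1; ext η; exact iff_of_eq (congrArg (· ∈ H) (heq η))
    _ ≤ _ := noiseLaw_shift β c _
    _ ≤ _ := by gcongr

/-- An empty bin always shows `0`, and a bin with one point also does as long as its noise stays
below `log (2/δ)`: the term `1/k` of the threshold cancels the point, the other term cancels the
noise. The two outputs coincide off an event of probability `δ/2`. -/
theorem noisyThreshold_hide (hk : 0 < k) (hε : 0 < ε) (hδ : 0 < δ) (hδ1 : δ ≤ 1)
    {p p' : Option ℤ → ℝ} (β : Option ℤ)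
    (hne : ∀ β', β' ≠ β → p β' = p' β') (hp : p β = 0 ∧ p' β = 1 / k ∨ p β = 1 / k ∧ p' β = 0)
    (H : Set (Option ℤ → ℝ)) :
    noiseLaw {η | noisyThreshold k ε δ p η ∈ H} ≤
      noiseLaw {η | noisyThreshold k ε δ p' η ∈ H} + ENNReal.ofReal (δ / 2) := by
  have hk' : (0 : ℝ) < k := by exact_mod_cast hk
  have hlog : 0 ≤ Real.log (2 / δ) := Real.log_nonneg (by rw [le_div_iff₀ hδ]; linarith)
  have hzero : ∀ (q : Option ℤ → ℝ) (η : Option ℤ → ℝ), |η β| < Real.log (2 / δ) →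
      (q β = 0 ∨ q β = 1 / k) → noisyThreshold k ε δ q η β = 0 := by
    intro q η hη hq
    rcases hq with hq | hq
    · simp [noisyThreshold, hq]
    · simp only [noisyThreshold, hq]
      rw [if_neg (by positivity), if_pos]
      have : 2 / (ε * k) * η β < 2 / (ε * k) * Real.log (2 / δ) :=
        mul_lt_mul_of_pos_left ((le_abs_self _).trans_lt hη) (by positivity)
      have h2 : 2 * Real.log (2 / δ) / (ε * k) = 2 / (ε * k) * Real.log (2 / δ) := by ring
      rw [h2]; linarith
  have hsub : {η | noisyThreshold k ε δ p η ∈ H} ⊆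
      {η | noisyThreshold k ε δ p' η ∈ H} ∪ {η | Real.log (2 / δ) ≤ |η β|} := by
    intro η hη
    by_cases h : Real.log (2 / δ) ≤ |η β|
    · exact Or.inr h
    · left
      have : noisyThreshold k ε δ p η = noisyThreshold k ε δ p' η := by
        ext β'
        by_cases hb : β' = β
        · subst hb
          rw [hzero p η (not_le.1 h) (by tauto), hzero p' η (not_le.1 h) (by tauto)]
        · simp only [noisyThreshold, hne β' hb]
      exact (congrArg (· ∈ H) this).mp hη
  refine (measure_mono hsub).trans ((measure_union_le _ _).trans ?_)
  gcongr
  refine (noiseLaw_le_abs β _ hlog).trans (ENNReal.ofReal_le_ofReal ?_)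
  rw [Real.exp_neg, Real.exp_log (by positivity), inv_div]

/-- Moving one point from the bin `β₀` to the bin `β₁`. -/
theorem noisyThreshold_move (hk : 0 < k) (hε : 0 < ε) (hδ : 0 < δ) (hδ1 : δ ≤ 1)
    (n : Option ℤ → ℕ) (β₀ β₁ : Option ℤ) (H : Set (Option ℤ → ℝ)) :
    noiseLaw {η | noisyThreshold k ε δ (fun β => ((n β + if β = β₀ then 1 else 0 : ℕ) : ℝ) / k) η
        ∈ H} ≤
      ENNReal.ofReal (Real.exp ε) * noiseLaw {η | noisyThreshold k ε δ
        (fun β => ((n β + if β = β₁ then 1 else 0 : ℕ) : ℝ) / k) η ∈ H} + ENNReal.ofReal δ := by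
  have hk' : (0 : ℝ) < k := by exact_mod_cast hk
  set P : (Option ℤ → ℕ) → ENNReal := fun q =>
    noiseLaw {η | noisyThreshold k ε δ (fun β => (q β : ℝ) / k) η ∈ H} with hP
  set e := ENNReal.ofReal (Real.exp (ε / 2)) with he
  set D := ENNReal.ofReal (δ / 2) with hD
  have he1 : 1 ≤ e := by
    rw [he, ← ENNReal.ofReal_one]
    exact ENNReal.ofReal_le_ofReal (Real.one_le_exp (by positivity))
  have hee : ENNReal.ofReal (Real.exp ε) = e * e := by
    rw [he, ← ENNReal.ofReal_mul (Real.exp_pos _).le, ← Real.exp_add, add_halves]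
  have hDD : ENNReal.ofReal δ = D + D := by
    rw [hD, ← ENNReal.ofReal_add (by positivity) (by positivity), add_halves]
  have shift : ∀ (q q' : Option ℤ → ℕ) (β : Option ℤ), (∀ β', β' ≠ β → q β' = q' β') →
      q β ≠ 0 → q' β ≠ 0 → (q β = q' β + 1 ∨ q' β = q β + 1) → P q ≤ e * P q' := by
    intro q q' β hne h0 h0' h1
    refine noisyThreshold_shift hk hε β (fun β' h => by rw [hne β' h]) ?_ ?_ ?_ H
    · simp [h0, hk.ne']
    · simp [h0', hk.ne']
    · rcases h1 with h | h
      · rw [h, ← sub_div]; push_cast; rw [add_sub_cancel_left, abs_of_pos (by positivity)]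
      · rw [h, ← sub_div]; push_cast; rw [sub_add_cancel_left, neg_div, abs_neg,
          abs_of_pos (by positivity)]
  have hide : ∀ (q q' : Option ℤ → ℕ) (β : Option ℤ), (∀ β', β' ≠ β → q β' = q' β') →
      (q β = 0 ∧ q' β = 1 ∨ q β = 1 ∧ q' β = 0) → P q ≤ P q' + D := by
    intro q q' β hne h
    refine noisyThreshold_hide hk hε hδ hδ1 β (fun β' h => by rw [hne β' h]) ?_ H
    rcases h with ⟨h, h'⟩ | ⟨h, h'⟩
    · left; simp [h, h']
    · right; simp [h, h']
  rw [hee, hDD]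
  change P (fun β => n β + if β = β₀ then 1 else 0) ≤
    e * e * P (fun β => n β + if β = β₁ then 1 else 0) + (D + D)
  set q₀ : Option ℤ → ℕ := fun β => n β + if β = β₀ then 1 else 0 with hq₀
  set q₁ : Option ℤ → ℕ := fun β => n β + if β = β₁ then 1 else 0 with hq₁
  have hmono : e * P q₁ ≤ e * e * P q₁ := by
    rw [mul_assoc]; exact le_mul_of_one_le_left' he1
  have hmono1 : P q₁ ≤ e * P q₁ := le_mul_of_one_le_left' he1
  by_cases hββ : β₀ = β₁
  · subst hββ
    exact (hmono1.trans hmono).trans le_self_add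
  by_cases hn0 : n β₀ = 0
  · have h1 : P q₀ ≤ P n + D := hide q₀ n β₀ (fun β h => by simp [hq₀, h]) (by simp [hq₀, hn0])
    by_cases hn1 : n β₁ = 0
    · have h2 : P n ≤ P q₁ + D := hide n q₁ β₁ (fun β h => by simp [hq₁, h]) (by simp [hq₁, hn1])
      calc P q₀ ≤ P q₁ + D + D := h1.trans (by gcongr)
        _ = P q₁ + (D + D) := add_assoc _ _ _
        _ ≤ _ := by gcongr; exact hmono1.trans hmono
    · have h2 : P n ≤ e * P q₁ :=
        shift n q₁ β₁ (fun β h => by simp [hq₁, h]) hn1 (by simp [hq₁]) (by simp [hq₁])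
      calc P q₀ ≤ e * P q₁ + D := h1.trans (by gcongr)
        _ ≤ _ := by gcongr; exact le_self_add
  -- The passage is through the histogram with the point in both bins, not in neither. An additive
  -- loss then comes before the multiplicative one and is not inflated by `exp (ε/2)`.
  · set q : Option ℤ → ℕ := fun β => q₀ β + if β = β₁ then 1 else 0 with hq
    have hβ1 : β₁ ≠ β₀ := fun h => hββ h.symm
    have h2 : P q ≤ e * P q₁ :=
      shift q q₁ β₀ (fun β h => by simp [hq, hq₀, hq₁, h]) (by simp [hq, hq₀])
        (by simp [hq₁, hn0]) (by simp [hq, hq₀, hq₁, hββ])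
    by_cases hn1 : n β₁ = 0
    · have h1 : P q₀ ≤ P q + D :=
        hide q₀ q β₁ (fun β h => by simp [hq, h]) (by simp [hq, hq₀, hn1, hβ1])
      calc P q₀ ≤ e * P q₁ + D := h1.trans (by gcongr)
        _ ≤ _ := by gcongr; exact le_self_add
    · have h1 : P q₀ ≤ e * P q :=
        shift q₀ q β₁ (fun β h => by simp [hq, h]) (by simp [hq₀, hn1]) (by simp [hq])
          (by simp [hq])
      calc P q₀ ≤ e * (e * P q₁) := h1.trans (by gcongr)
        _ = e * e * P q₁ := (mul_assoc _ _ _).symm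
        _ ≤ _ := le_self_add

theorem card_mem_eq_add (x : Fin k → ℝ) (j : Fin k) (β₀ : Option ℤ) (h : x j ∈ geomBin β₀)
    (β : Option ℤ) :
    Nat.card {i : Fin k // x i ∈ geomBin β} =
      Nat.card {i : Fin k // i ≠ j ∧ x i ∈ geomBin β} + if β = β₀ then 1 else 0 := by
  classical
  rw [Nat.card_eq_fintype_card, Nat.card_eq_fintype_card, Fintype.card_subtype,
    Fintype.card_subtype]
  have hfil : (Finset.univ.filter fun i => i ≠ j ∧ x i ∈ geomBin β) =
      (Finset.univ.filter fun i => x i ∈ geomBin β).erase j := by ext i; simp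
  rw [hfil]
  split_ifs with hb
  · subst hb
    rw [Finset.card_erase_add_one (by simpa using h)]
  · rw [Finset.erase_eq_of_notMem, add_zero]
    simp only [Finset.mem_filter, Finset.mem_univ, true_and]
    exact fun h' => hb (geomBin_unique h' h)

/-- Without the point `j` the two samples have the same counts; restoring it adds one to the bin of
`x j` or of `x' j`. Nonnegativity ensures that these bins exist. -/
theorem stabilityHistogram_neighbor (hk : 0 < k) (hε : 0 < ε) (hδ : 0 < δ) (hδ1 : δ ≤ 1)
    (x x' : Fin k → ℝ) (hx : ∀ i, 0 ≤ x i) (hx' : ∀ i, 0 ≤ x' i) (j : Fin k)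
    (hxx : ∀ i, i ≠ j → x i = x' i) (H : Set (Option ℤ → ℝ)) :
    noiseLaw {η | stabilityHistogram geomBin ε δ x η ∈ H} ≤
      ENNReal.ofReal (Real.exp ε) * noiseLaw {η | stabilityHistogram geomBin ε δ x' η ∈ H} +
        ENNReal.ofReal δ := by
  obtain ⟨β₀, h₀⟩ := exists_mem_geomBin (hx j)
  obtain ⟨β₁, h₁⟩ := exists_mem_geomBin (hx' j)
  have hn : ∀ β, Nat.card {i : Fin k // i ≠ j ∧ x' i ∈ geomBin β} =
      Nat.card {i : Fin k // i ≠ j ∧ x i ∈ geomBin β} := by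
    intro β
    refine Nat.card_congr (Equiv.subtypeEquivRight fun i => ?_)
    exact and_congr_right fun hi => by rw [hxx i hi]
  have := noisyThreshold_move hk hε hδ hδ1
    (fun β => Nat.card {i : Fin k // i ≠ j ∧ x i ∈ geomBin β}) β₀ β₁ H
  simp only [stabilityHistogram_eq_noisyThreshold, frequency, card_mem_eq_add x j β₀ h₀,
    card_mem_eq_add x' j β₁ h₁, hn]
  exact this

/-! ### Privacy of the algorithm: one sample affects one block -/

theorem topEigenvalue_nonneg {d : ℕ} {M : Matrix (Fin d) (Fin d) ℝ} (hM : M.PosSemidef) :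
    0 ≤ topEigenvalue M := by
  refine Real.sSup_nonneg fun y hy => ?_
  rw [hM.isHermitian.spectrum_real_eq_range_eigenvalues] at hy
  obtain ⟨i, rfl⟩ := hy
  exact hM.eigenvalues_nonneg i

theorem posSemidef_blockMatrix {B d : ℕ} (k : ℕ) (g : Fin B → Fin d → ℝ) (j : Fin k) :
    ((1 / (2 * (blockSize B k : ℝ))) • (blockMatrix k g j * (blockMatrix k g j)ᵀ)).PosSemidef := by
  refine Matrix.PosSemidef.smul ?_ (by positivity)
  have := Matrix.posSemidef_self_mul_conjTranspose (blockMatrix k g j)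
  rwa [Matrix.conjTranspose_eq_transpose_of_trivial] at this

theorem numBlocks_pos {C₁ ζ : ℝ} (hC : 0 < C₁) (hε : 0 < ε) (hδ : δ ∈ Set.Ioo (0 : ℝ) 1)
    (hζ : ζ ∈ Set.Ioo (0 : ℝ) 1) : 0 < numBlocks C₁ ε δ ζ := by
  refine Nat.ceil_pos.2 (div_pos (mul_pos hC (Real.log_pos ?_)) hε)
  rw [lt_div_iff₀ (mul_pos hδ.1 hζ.1)]
  nlinarith [hδ.1, hδ.2, hζ.1, hζ.2]

/-- Sample `t` can only enter the block with index `t / (2b)`. If `b = 0`, blocks have no columns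
and nothing changes. -/
theorem exists_blockEigenvalue_eq_of_ne {B d : ℕ} (hk : 0 < k) (s s' : Fin B → Fin d → ℝ)
    (h : Neighboring s s') :
    ∃ j : Fin k, ∀ i, i ≠ j → blockEigenvalue k s i = blockEigenvalue k s' i := by
  obtain ⟨t, ht⟩ := h
  have key : ∀ i : Fin k, t.val / (2 * blockSize B k) ≠ i.val →
      blockEigenvalue k s i = blockEigenvalue k s' i := by
    intro i hi
    have : blockMatrix k s i = blockMatrix k s' i := by
      ext l m
      have hm := m.isLt
      have hdiv : ∀ c, c < 2 → (2 * (i.val * blockSize B k + m.val) + c) / (2 * blockSize B k)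
          = i.val := by
        intro c hc
        rw [Nat.div_eq_iff (by omega)]
        constructor
        · nlinarith
        · have : i.val * (2 * blockSize B k) = 2 * (i.val * blockSize B k) := by ring
          omega
      simp only [blockMatrix, Matrix.of_apply]
      rw [ht, ht]
      · rintro rfl
        exact hi (hdiv 0 (by norm_num))
      · rintro rfl
        exact hi (hdiv 1 (by norm_num))
    simp only [blockEigenvalue, this]
  by_cases hlt : t.val / (2 * blockSize B k) < k
  · exact ⟨⟨_, hlt⟩, fun i hi => key i fun h => hi (Fin.ext h.symm)⟩
  -- The sample is among those left over after the last block, so any index serves.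
  · exact ⟨⟨0, hk⟩, fun i _ => key i fun h => hlt (by rw [h]; exact i.isLt)⟩

/-- The output of the algorithm as a function of the private histogram. -/
def topBinEndpoint (h : Option ℤ → ℝ) : Option ℝ :=
  open Classical in
  if hβ : ∃ β, IsTopBin h β then some (leftEnd hβ.choose) else none

theorem isDP_privateTopEigenvalue (B d : ℕ) (C₁ ε δ ζ : ℝ) (hC : 0 < C₁) (hε : 0 < ε)
    (hδ : δ ∈ Set.Ioo (0 : ℝ) 1) (hζ : ζ ∈ Set.Ioo (0 : ℝ) 1) :
    IsDP noiseLaw (privateTopEigenvalue (B := B) (d := d) C₁ ε δ ζ) ε δ := by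
  intro s s' hs E
  have hk := numBlocks_pos hC hε hδ hζ
  obtain ⟨j, hj⟩ := exists_blockEigenvalue_eq_of_ne hk s s' hs
  exact stabilityHistogram_neighbor hk hε hδ.1 hδ.2.le _ _
    (fun i => topEigenvalue_nonneg (posSemidef_blockMatrix _ s i))
    (fun i => topEigenvalue_nonneg (posSemidef_blockMatrix _ s' i)) j hj (topBinEndpoint ⁻¹' E)

end

section

/-! ### Powers of positive semidefinite matrices -/

variable {d : ℕ}

/-- The spectral theorem in the form used below: quadratic forms of the powers of `S` are moments of
one discrete measure with atoms `l i` and weights `(w i ⬝ᵥ x)²`, which turns matrix inequalities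
into scalar ones. -/
theorem exists_spectral_moments {S : Matrix (Fin d) (Fin d) ℝ} (hS : S.PosSemidef) :
    ∃ (w : Fin d → Fin d → ℝ) (l : Fin d → ℝ), (∀ i, 0 ≤ l i) ∧ (∀ i, w i ⬝ᵥ w i = 1) ∧
      (∀ (n : ℕ) (x : Fin d → ℝ), x ⬝ᵥ (S ^ n *ᵥ x) = ∑ i, l i ^ n * (w i ⬝ᵥ x) ^ 2) ∧
      (∀ n : ℕ, (S ^ n).trace = ∑ i, l i ^ n) ∧ spectrum ℝ S = Set.range l ∧
      ∀ i, S *ᵥ w i = l i • w i := by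
  have hH := hS.isHermitian
  set U : Matrix (Fin d) (Fin d) ℝ := (hH.eigenvectorUnitary : Matrix (Fin d) (Fin d) ℝ) with hU
  have hUU : Uᵀ * U = 1 := by
    have := Unitary.coe_star_mul_self hH.eigenvectorUnitary
    simpa [Matrix.star_eq_conjTranspose, Matrix.conjTranspose_eq_transpose_of_trivial] using this
  have hpow : ∀ n : ℕ, S ^ n = U * Matrix.diagonal (fun i => hH.eigenvalues i ^ n) * Uᵀ := by
    intro n
    have h := hH.spectral_theorem
    conv_lhs => rw [h]
    rw [← map_pow, Unitary.conjStarAlgAut_apply, Matrix.diagonal_pow,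
      Matrix.star_eq_conjTranspose, Matrix.conjTranspose_eq_transpose_of_trivial]
    rfl
  refine ⟨fun i => Uᵀ i, hH.eigenvalues, hS.eigenvalues_nonneg, ?_, ?_, ?_,
    hH.spectrum_real_eq_range_eigenvalues, ?_⟩
  · intro i
    have := congrFun (congrFun hUU i) i
    simpa [Matrix.mul_apply, dotProduct] using this
  · intro n x
    rw [hpow, ← Matrix.mulVec_mulVec, ← Matrix.mulVec_mulVec, Matrix.dotProduct_mulVec,
      ← Matrix.mulVec_transpose]
    simp only [dotProduct, Matrix.mulVec_diagonal]
    refine Finset.sum_congr rfl fun i _ => ?_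
    simp only [Matrix.mulVec, dotProduct]
    ring
  · intro n
    rw [hpow, Matrix.trace_mul_comm, ← mul_assoc, hUU, one_mul, Matrix.trace_diagonal]
  · intro i
    exact hH.mulVec_eigenvectorBasis i

theorem moment_nonneg {S : Matrix (Fin d) (Fin d) ℝ} (hS : S.PosSemidef) (n : ℕ)
    (x : Fin d → ℝ) : 0 ≤ x ⬝ᵥ (S ^ n *ᵥ x) := by
  obtain ⟨w, l, hl, -, hm, -⟩ := exists_spectral_moments hS
  rw [hm]
  exact Finset.sum_nonneg fun i _ => mul_nonneg (pow_nonneg (hl i) n) (sq_nonneg _)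

/-- Chebyshev's inequality for the moments of the spectral measure of a vector. -/
theorem moment_mul_moment_le {S : Matrix (Fin d) (Fin d) ℝ} (hS : S.PosSemidef) (m n : ℕ)
    (x : Fin d → ℝ) :
    (x ⬝ᵥ (S ^ m *ᵥ x)) * (x ⬝ᵥ (S ^ n *ᵥ x)) ≤ (x ⬝ᵥ x) * (x ⬝ᵥ (S ^ (m + n) *ᵥ x)) := by
  obtain ⟨w, l, hl, -, hm, -⟩ := exists_spectral_moments hS
  have h0 : x ⬝ᵥ x = ∑ i, (w i ⬝ᵥ x) ^ 2 := by simpa using hm 0 x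
  set c : Fin d → ℝ := fun i => (w i ⬝ᵥ x) ^ 2 with hc
  have hc0 : ∀ i, 0 ≤ c i := fun i => sq_nonneg _
  rw [hm, hm, hm, h0]
  -- Powers are monotone on `[0, ∞)`, so the two differences have the same sign. The double sum is
  -- twice the defect in the inequality.
  have key : 0 ≤ ∑ i, ∑ j, c i * c j * ((l i ^ m - l j ^ m) * (l i ^ n - l j ^ n)) := by
    refine Finset.sum_nonneg fun i _ => Finset.sum_nonneg fun j _ =>
      mul_nonneg (mul_nonneg (hc0 i) (hc0 j)) ?_
    rcases le_total (l i) (l j) with h | h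
    · exact mul_nonneg_of_nonpos_of_nonpos (sub_nonpos.2 (pow_le_pow_left₀ (hl i) h m))
        (sub_nonpos.2 (pow_le_pow_left₀ (hl i) h n))
    · exact mul_nonneg (sub_nonneg.2 (pow_le_pow_left₀ (hl j) h m))
        (sub_nonneg.2 (pow_le_pow_left₀ (hl j) h n))
  have expand : ∑ i, ∑ j, c i * c j * ((l i ^ m - l j ^ m) * (l i ^ n - l j ^ n)) =
      2 * ((∑ i, c i) * (∑ i, l i ^ (m + n) * c i)) -
        2 * ((∑ i, l i ^ m * c i) * (∑ i, l i ^ n * c i)) := by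
    have e1 : (∑ i, c i) * (∑ i, l i ^ (m + n) * c i) =
        ∑ i, ∑ j, c i * (l j ^ (m + n) * c j) := Finset.sum_mul_sum _ _ _ _
    have e1' : (∑ i, c i) * (∑ i, l i ^ (m + n) * c i) =
        ∑ i, ∑ j, (l i ^ (m + n) * c i) * c j := by rw [mul_comm]; exact Finset.sum_mul_sum _ _ _ _
    have e2 : (∑ i, l i ^ m * c i) * (∑ i, l i ^ n * c i) =
        ∑ i, ∑ j, (l i ^ m * c i) * (l j ^ n * c j) := Finset.sum_mul_sum _ _ _ _
    have e2' : (∑ i, l i ^ m * c i) * (∑ i, l i ^ n * c i) =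
        ∑ i, ∑ j, (l i ^ n * c i) * (l j ^ m * c j) := by
      rw [mul_comm]; exact Finset.sum_mul_sum _ _ _ _
    rw [two_mul, two_mul]
    nth_rewrite 1 [e1]
    rw [e1']
    nth_rewrite 1 [e2]
    rw [e2']
    simp only [← Finset.sum_add_distrib, ← Finset.sum_sub_distrib]
    refine Finset.sum_congr rfl fun i _ => Finset.sum_congr rfl fun j _ => ?_
    ring
  linarith

/-! ### Moments of a rank-one perturbation -/

section RankOne

variable {S : Matrix (Fin d) (Fin d) ℝ} (x : Fin d → ℝ)

/-- The last factor `S + xxᵀ` of the power is split; its rank-one part separates the quadratic form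
into a product. -/
theorem dotProduct_rankOne_succ (n j : ℕ) :
    x ⬝ᵥ ((S + Matrix.vecMulVec x x) ^ (n + 1) * S ^ j) *ᵥ x =
      x ⬝ᵥ ((S + Matrix.vecMulVec x x) ^ n * S ^ (j + 1)) *ᵥ x +
        (x ⬝ᵥ (S + Matrix.vecMulVec x x) ^ n *ᵥ x) * (x ⬝ᵥ S ^ j *ᵥ x) := by
  have : (S + Matrix.vecMulVec x x) ^ (n + 1) * S ^ j =
      (S + Matrix.vecMulVec x x) ^ n * S ^ (j + 1) +
        (S + Matrix.vecMulVec x x) ^ n * (Matrix.vecMulVec x x * S ^ j) := by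
    rw [pow_succ, mul_assoc, add_mul, mul_add, pow_succ' S j]
  rw [this, Matrix.add_mulVec, dotProduct_add]
  congr 1
  rw [← Matrix.mulVec_mulVec, ← Matrix.mulVec_mulVec, Matrix.vecMulVec_mulVec]
  rw [op_smul_eq_smul, Matrix.mulVec_smul, dotProduct_smul, smul_eq_mul, mul_comm]

theorem rankOne_nonneg (hS : S.PosSemidef) (n j : ℕ) :
    0 ≤ x ⬝ᵥ ((S + Matrix.vecMulVec x x) ^ n * S ^ j) *ᵥ x := by
  induction n generalizing j with
  | zero => simpa using moment_nonneg hS j x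
  | succ n ih =>
    rw [dotProduct_rankOne_succ]
    exact add_nonneg (ih _) (mul_nonneg (by simpa using ih 0) (moment_nonneg hS j x))

/-- An extension of Chebyshev's inequality to mixed moments, where `S` and `S + xxᵀ` do not commute.
By the recursion, mixed moments are nonnegative combinations of products of moments of `S`, and the
inequality passes through them. The case `i = 0` replaces a product in the recursion by `‖x‖²` times
one mixed moment. -/
theorem rankOne_mul_moment_le (hS : S.PosSemidef) (n i j : ℕ) :
    (x ⬝ᵥ ((S + Matrix.vecMulVec x x) ^ n * S ^ i) *ᵥ x) * (x ⬝ᵥ S ^ j *ᵥ x) ≤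
      (x ⬝ᵥ x) * (x ⬝ᵥ ((S + Matrix.vecMulVec x x) ^ n * S ^ (i + j)) *ᵥ x) := by
  induction n generalizing i with
  | zero => simpa using moment_mul_moment_le hS i j x
  | succ n ih =>
    rw [dotProduct_rankOne_succ, dotProduct_rankOne_succ, add_mul, mul_add]
    have h1 := ih (i + 1)
    rw [show i + 1 + j = i + j + 1 by ring] at h1
    have h2 := moment_mul_moment_le hS i j x
    have h3 : 0 ≤ x ⬝ᵥ (S + Matrix.vecMulVec x x) ^ n *ᵥ x := by
      simpa using rankOne_nonneg x hS n 0
    refine add_le_add h1 ?_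
    calc _ = (x ⬝ᵥ (S + Matrix.vecMulVec x x) ^ n *ᵥ x) *
          ((x ⬝ᵥ S ^ i *ᵥ x) * (x ⬝ᵥ S ^ j *ᵥ x)) := by ring
      _ ≤ (x ⬝ᵥ (S + Matrix.vecMulVec x x) ^ n *ᵥ x) *
          ((x ⬝ᵥ x) * (x ⬝ᵥ S ^ (i + j) *ᵥ x)) := mul_le_mul_of_nonneg_left h2 h3
      _ = _ := by ring

/-- A Golden–Thompson type inequality for powers of rank-one perturbations. -/
theorem rankOne_moment_le (hS : S.PosSemidef) {R : ℝ} (hR : x ⬝ᵥ x ≤ R) (n j : ℕ) :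
    x ⬝ᵥ ((S + Matrix.vecMulVec x x) ^ n * S ^ j) *ᵥ x ≤
      ∑ m ∈ Finset.range (n + 1), (n.choose m : ℝ) * R ^ m * (x ⬝ᵥ S ^ (n - m + j) *ᵥ x) := by
  have hR0 : 0 ≤ R := le_trans (by simpa using moment_nonneg hS 0 x) hR
  induction n generalizing j with
  | zero => simp
  | succ n ih =>
    have h1 := rankOne_mul_moment_le x hS n 0 j
    have h2 : x ⬝ᵥ ((S + Matrix.vecMulVec x x) ^ (n + 1) * S ^ j) *ᵥ x ≤
        x ⬝ᵥ ((S + Matrix.vecMulVec x x) ^ n * S ^ (j + 1)) *ᵥ x +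
          R * (x ⬝ᵥ ((S + Matrix.vecMulVec x x) ^ n * S ^ j) *ᵥ x) := by
      rw [dotProduct_rankOne_succ]
      have h1' : (x ⬝ᵥ (S + Matrix.vecMulVec x x) ^ n *ᵥ x) * (x ⬝ᵥ S ^ j *ᵥ x) ≤
          (x ⬝ᵥ x) * (x ⬝ᵥ ((S + Matrix.vecMulVec x x) ^ n * S ^ j) *ᵥ x) := by simpa using h1
      exact add_le_add_right
        (h1'.trans (mul_le_mul_of_nonneg_right hR (rankOne_nonneg x hS n j))) _
    -- The mixed moments satisfy `a (n+1) j ≤ a n (j+1) + R * a n j`; the rest is Pascal's rule.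
    refine h2.trans ((add_le_add (ih (j + 1)) (mul_le_mul_of_nonneg_left (ih j) hR0)).trans ?_)
    rw [Finset.sum_range_succ' _ (n + 1)]
    rw [Finset.mul_sum]
    have e : ∀ m ∈ Finset.range (n + 1), ((n + 1).choose (m + 1) : ℝ) * R ^ (m + 1) *
        (x ⬝ᵥ S ^ (n + 1 - (m + 1) + j) *ᵥ x) =
        R * ((n.choose m : ℝ) * R ^ m * (x ⬝ᵥ S ^ (n - m + j) *ᵥ x)) +
          (n.choose (m + 1) : ℝ) * R ^ (m + 1) * (x ⬝ᵥ S ^ (n - m + j) *ᵥ x) := by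
      intro m _
      rw [Nat.choose_succ_succ, Nat.add_sub_add_right]
      push_cast
      ring
    rw [Finset.sum_congr rfl e, Finset.sum_add_distrib]
    have e2 : ∑ m ∈ Finset.range (n + 1), (n.choose m : ℝ) * R ^ m *
          (x ⬝ᵥ S ^ (n - m + (j + 1)) *ᵥ x) =
        ∑ m ∈ Finset.range (n + 1),
          (n.choose (m + 1) : ℝ) * R ^ (m + 1) * (x ⬝ᵥ S ^ (n - m + j) *ᵥ x) +
          (((n + 1).choose 0 : ℕ) : ℝ) * R ^ 0 * (x ⬝ᵥ S ^ (n + 1 - 0 + j) *ᵥ x) := by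
      rw [Finset.sum_range_succ' _ n, Finset.sum_range_succ (fun m => (n.choose (m + 1) : ℝ) *
        R ^ (m + 1) * (x ⬝ᵥ S ^ (n - m + j) *ᵥ x)) n]
      simp only [Nat.choose_succ_self, Nat.cast_zero, zero_mul, add_zero, Nat.choose_zero_right,
        Nat.cast_one, pow_zero, one_mul, Nat.sub_zero]
      congr 1
      · refine Finset.sum_congr rfl fun m hm => ?_
        have := Finset.mem_range.1 hm
        rw [show n - (m + 1) + (j + 1) = n - m + j by omega]
      · rw [show n + (j + 1) = n + 1 + j by omega]
    rw [e2]
    linarith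

end RankOne

/-! ### Extremal eigenvalues -/

theorem topEigenvalue_pow_le_trace (hd : 0 < d) {S : Matrix (Fin d) (Fin d) ℝ}
    (hS : S.PosSemidef) (n : ℕ) : topEigenvalue S ^ n ≤ (S ^ n).trace := by
  obtain ⟨w, l, hl, -, -, ht, hs, -⟩ := exists_spectral_moments hS
  have hne : (Set.range l).Nonempty := ⟨l ⟨0, hd⟩, Set.mem_range_self _⟩
  obtain ⟨i, hi⟩ := (hne.csSup_mem (Set.finite_range l))
  rw [topEigenvalue, hs, ← hi, ht]
  exact Finset.single_le_sum (fun j _ => pow_nonneg (hl j) n) (Finset.mem_univ i)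

theorem dotProduct_mulVec_le_topEigenvalue {S : Matrix (Fin d) (Fin d) ℝ} (hS : S.PosSemidef)
    {v : Fin d → ℝ} (hv : v ⬝ᵥ v = 1) : v ⬝ᵥ S *ᵥ v ≤ topEigenvalue S := by
  obtain ⟨w, l, hl, -, hm, ht, hs, -⟩ := exists_spectral_moments hS
  have h0 : ∑ i, (w i ⬝ᵥ v) ^ 2 = 1 := by rw [← hv]; simpa using (hm 0 v).symm
  have h1 : v ⬝ᵥ S *ᵥ v = ∑ i, l i * (w i ⬝ᵥ v) ^ 2 := by simpa using hm 1 v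
  have hle : ∀ i, l i ≤ topEigenvalue S := fun i => by
    rw [topEigenvalue, hs]
    exact le_csSup (Set.finite_range l).bddAbove (Set.mem_range_self i)
  calc v ⬝ᵥ S *ᵥ v = ∑ i, l i * (w i ⬝ᵥ v) ^ 2 := h1
    _ ≤ ∑ i, topEigenvalue S * (w i ⬝ᵥ v) ^ 2 :=
        Finset.sum_le_sum fun i _ => mul_le_mul_of_nonneg_right (hle i) (sq_nonneg _)
    _ = topEigenvalue S := by rw [← Finset.mul_sum, h0, mul_one]

theorem norm_toLp_sq (v : Fin d → ℝ) : ‖WithLp.toLp 2 v‖ ^ 2 = v ⬝ᵥ v := by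
  rw [EuclideanSpace.norm_sq_eq]
  simp [dotProduct, sq]

theorem dotProduct_mulVec_le_spectralNorm (M : Matrix (Fin d) (Fin d) ℝ)
    {v : Fin d → ℝ} (hv : v ⬝ᵥ v = 1) : v ⬝ᵥ M *ᵥ v ≤ spectralNorm M := by
  have hn : ‖WithLp.toLp 2 v‖ = 1 := by
    have := norm_toLp_sq v
    rw [hv] at this
    exact (pow_eq_one_iff_of_nonneg (norm_nonneg _) two_ne_zero).1 this
  have h1 := Matrix.inner_toEuclideanCLM M (WithLp.toLp 2 v) (WithLp.toLp 2 v)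
  simp only at h1
  rw [← h1]
  refine (real_inner_le_norm _ _).trans ?_
  rw [hn, one_mul]
  refine (ContinuousLinearMap.le_opNorm _ _).trans ?_
  rw [hn, mul_one]
  rfl

theorem exists_dotProduct_mulVec_eq_spectralNorm (hd : 0 < d) {M : Matrix (Fin d) (Fin d) ℝ}
    (hM : M.PosSemidef) : ∃ v : Fin d → ℝ, v ⬝ᵥ v = 1 ∧ v ⬝ᵥ M *ᵥ v = spectralNorm M := by
  obtain ⟨w, l, hl, hw, hm, ht, hs, hev⟩ := exists_spectral_moments hM
  have : Nonempty (Fin d) := ⟨⟨0, hd⟩⟩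
  obtain ⟨i, hi⟩ := Finite.exists_max l
  refine ⟨w i, hw i, le_antisymm (dotProduct_mulVec_le_spectralNorm M (hw i)) ?_⟩
  have hval : w i ⬝ᵥ M *ᵥ w i = l i := by rw [hev, dotProduct_smul, hw, smul_eq_mul, mul_one]
  rw [hval, spectralNorm]
  refine ContinuousLinearMap.opNorm_le_bound _ (hl i) fun x => ?_
  refine le_of_sq_le_sq ?_ (mul_nonneg (hl i) (norm_nonneg _))
  have h2 : ‖Matrix.toEuclideanCLM (n := Fin d) (𝕜 := ℝ) M x‖ ^ 2 =
      x.ofLp ⬝ᵥ (M ^ 2 *ᵥ x.ofLp) := by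
    rw [← WithLp.toLp_ofLp 2 (Matrix.toEuclideanCLM (n := Fin d) (𝕜 := ℝ) M x), norm_toLp_sq,
      Matrix.ofLp_toEuclideanCLM, sq, ← Matrix.mulVec_mulVec, Matrix.dotProduct_mulVec x.ofLp M,
      ← Matrix.mulVec_transpose, ← Matrix.conjTranspose_eq_transpose_of_trivial,
      hM.isHermitian.eq]
  have h0 : ‖x‖ ^ 2 = ∑ j, (w j ⬝ᵥ x.ofLp) ^ 2 := by
    rw [← WithLp.toLp_ofLp 2 x, norm_toLp_sq]; simpa using hm 0 x.ofLp
  rw [h2, hm, mul_pow, h0, Finset.mul_sum]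
  exact Finset.sum_le_sum fun j _ => mul_le_mul_of_nonneg_right
    (pow_le_pow_left₀ (hl j) (hi j) 2) (sq_nonneg _)

end

section

/-! ### Concentration of sums of independent rank-one matrices -/

variable {d n : ℕ}

/-- The matrix `∑ xᵢ xᵢᵀ`. -/
def gram (X : Fin n → Fin d → ℝ) : Matrix (Fin d) (Fin d) ℝ :=
  ∑ i, Matrix.vecMulVec (X i) (X i)

theorem posSemidef_gram (X : Fin n → Fin d → ℝ) : (gram X).PosSemidef :=
  Matrix.posSemidef_sum _ fun i _ => by
    simpa using Matrix.posSemidef_vecMulVec_self_star (X i)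

theorem continuous_gram : Continuous (gram (d := d) (n := n)) :=
  continuous_finsetSum _ fun i _ => (continuous_apply i).matrix_vecMulVec (continuous_apply i)

theorem gram_insertNth (i : Fin (n + 1)) (x : Fin d → ℝ) (Y : Fin n → Fin d → ℝ) :
    gram (Fin.insertNth (α := fun _ => Fin d → ℝ) i x Y) = gram Y + Matrix.vecMulVec x x := by
  rw [gram, Fin.sum_univ_succAbove _ i, add_comm]
  simp [gram]

theorem dotProduct_gram_mulVec (X : Fin n → Fin d → ℝ) (v : Fin d → ℝ) :
    v ⬝ᵥ gram X *ᵥ v = ∑ i, (v ⬝ᵥ X i) ^ 2 := by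
  simp only [gram, Matrix.sum_mulVec, dotProduct_sum, Matrix.vecMulVec_mulVec, op_smul_eq_smul,
    dotProduct_smul, smul_eq_mul]
  exact Finset.sum_congr rfl fun i _ => by rw [dotProduct_comm v (X i)]; ring

theorem trace_gram_pow_succ (X : Fin n → Fin d → ℝ) (q : ℕ) :
    (gram X ^ (q + 1)).trace = ∑ i, X i ⬝ᵥ gram X ^ q *ᵥ X i := by
  rw [pow_succ]
  nth_rewrite 2 [gram]
  rw [Finset.mul_sum, Matrix.trace_sum]
  refine Finset.sum_congr rfl fun i _ => ?_
  rw [Matrix.mul_vecMulVec, Matrix.trace_vecMulVec, dotProduct_comm]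

variable {ν : Measure (Fin d → ℝ)} {L R : ℝ}

theorem measurable_moment (q : ℕ) :
    Measurable fun p : (Fin d → ℝ) × (Fin n → Fin d → ℝ) => p.1 ⬝ᵥ gram p.2 ^ q *ᵥ p.1 := by
  refine Continuous.measurable ?_
  have h := continuous_gram (d := d) (n := n)
  exact continuous_fst.dotProduct (((h.comp continuous_snd).pow q).matrix_mulVec continuous_fst)

/-- In an eigenbasis of `S` the form is a sum of `(w i ⬝ᵥ x)²` with weights `l i ^ q`; each square
has mean at most `L`, and the weights add up to the trace. -/
theorem lintegral_moment_le {S : Matrix (Fin d) (Fin d) ℝ} (hS : S.PosSemidef) (hL : 0 ≤ L)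
    (hcov : ∀ w : Fin d → ℝ, w ⬝ᵥ w = 1 →
      ∫⁻ x, ENNReal.ofReal ((w ⬝ᵥ x) ^ 2) ∂ν ≤ ENNReal.ofReal L) (q : ℕ) :
    ∫⁻ x, ENNReal.ofReal (x ⬝ᵥ S ^ q *ᵥ x) ∂ν ≤ ENNReal.ofReal (L * (S ^ q).trace) := by
  obtain ⟨w, l, hl, hw, hm, ht, -⟩ := exists_spectral_moments hS
  have hmeas : ∀ i, Measurable fun x : Fin d → ℝ => ENNReal.ofReal ((w i ⬝ᵥ x) ^ 2) := fun i =>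
    ((continuous_const.dotProduct continuous_id).pow 2).measurable.ennreal_ofReal
  calc ∫⁻ x, ENNReal.ofReal (x ⬝ᵥ S ^ q *ᵥ x) ∂ν
      = ∫⁻ x, ∑ i, ENNReal.ofReal (l i ^ q) * ENNReal.ofReal ((w i ⬝ᵥ x) ^ 2) ∂ν := by
        refine lintegral_congr fun x => ?_
        rw [hm, ENNReal.ofReal_sum_of_nonneg
          fun i _ => mul_nonneg (pow_nonneg (hl i) _) (sq_nonneg _)]
        exact Finset.sum_congr rfl fun i _ => ENNReal.ofReal_mul (pow_nonneg (hl i) _)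
    _ = ∑ i, ENNReal.ofReal (l i ^ q) * ∫⁻ x, ENNReal.ofReal ((w i ⬝ᵥ x) ^ 2) ∂ν := by
        rw [lintegral_finsetSum _ fun i _ => (hmeas i).const_mul _]
        exact Finset.sum_congr rfl fun i _ => lintegral_const_mul _ (hmeas i)
    _ ≤ ∑ i, ENNReal.ofReal (l i ^ q) * ENNReal.ofReal L :=
        Finset.sum_le_sum fun i _ => by gcongr; exact hcov _ (hw i)
    _ = ENNReal.ofReal (L * (S ^ q).trace) := by
        rw [ht, Finset.mul_sum,
          ENNReal.ofReal_sum_of_nonneg fun i _ => mul_nonneg hL (pow_nonneg (hl i) _)]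
        exact Finset.sum_congr rfl fun i _ => by rw [mul_comm, ENNReal.ofReal_mul hL]

variable [IsProbabilityMeasure ν]

/-- Moments of the sum of `n` independent rank-one matrices `x xᵀ` with `‖x‖² ≤ R` and
`E (w ⬝ x)² ≤ L` for all unit vectors `w`. -/
theorem lintegral_trace_gram_pow_le (hL : 0 ≤ L) (hR : 0 ≤ R) (hb : ∀ᵐ x ∂ν, x ⬝ᵥ x ≤ R)
    (hcov : ∀ w : Fin d → ℝ, w ⬝ᵥ w = 1 →
      ∫⁻ x, ENNReal.ofReal ((w ⬝ᵥ x) ^ 2) ∂ν ≤ ENNReal.ofReal L) (q n : ℕ) :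
    ∫⁻ X, ENNReal.ofReal ((gram X ^ q).trace) ∂(Measure.pi fun _ : Fin n => ν) ≤
      ENNReal.ofReal (d * (n * L + q * R) ^ q) := by
  induction q using Nat.strong_induction_on generalizing n with
  | _ q ih =>
  rcases q with _ | q
  · simp
  rcases n with _ | n
  · simp [gram]
  -- Leave one out: `gram X` is the Gram matrix of the other `n` samples plus a rank-one term in `X
  -- i`, which is independent of them. Expanding in that term leaves powers `q - m ≤ q` of the
  -- smaller Gram matrix, whence strong induction for all `n`.
  have hterm : ∀ i : Fin (n + 1), ∫⁻ X : Fin (n + 1) → Fin d → ℝ,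
      ENNReal.ofReal (X i ⬝ᵥ gram X ^ q *ᵥ X i) ∂(Measure.pi fun _ => ν) ≤
        ENNReal.ofReal (L * (d * (n * L + (q + 1) * R) ^ q)) := by
    intro i
    have hmp := (measurePreserving_piFinSuccAbove (fun _ : Fin (n + 1) => ν) i).symm
    rw [← hmp.lintegral_comp_emb (MeasurableEquiv.measurableEmbedding _)]
    have hpt : ∀ᵐ p ∂(ν.prod (Measure.pi fun _ : Fin n => ν)),
        ENNReal.ofReal (((MeasurableEquiv.piFinSuccAbove (fun _ => Fin d → ℝ) i).symm p) i ⬝ᵥ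
          gram ((MeasurableEquiv.piFinSuccAbove (fun _ => Fin d → ℝ) i).symm p) ^ q *ᵥ
            ((MeasurableEquiv.piFinSuccAbove (fun _ => Fin d → ℝ) i).symm p) i) ≤
        ∑ m ∈ Finset.range (q + 1), ENNReal.ofReal ((q.choose m : ℝ) * R ^ m) *
          ENNReal.ofReal (p.1 ⬝ᵥ gram p.2 ^ (q - m) *ᵥ p.1) := by
      have hb' : ∀ᵐ p ∂(ν.prod (Measure.pi fun _ : Fin n => ν)), p.1 ⬝ᵥ p.1 ≤ R :=
        Measure.quasiMeasurePreserving_fst.ae hb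
      filter_upwards [hb'] with p hp
      have h := rankOne_moment_le p.1 (posSemidef_gram p.2) hp q 0
      simp only [pow_zero, mul_one, add_zero] at h
      rw [MeasurableEquiv.piFinSuccAbove_symm_apply]
      simp only [Fin.insertNthEquiv, Equiv.coe_fn_mk, Fin.insertNth_apply_same]
      rw [gram_insertNth]
      refine (ENNReal.ofReal_le_ofReal h).trans ?_
      rw [ENNReal.ofReal_sum_of_nonneg fun m _ => mul_nonneg (by positivity)
        (moment_nonneg (posSemidef_gram p.2) _ _)]
      exact Finset.sum_le_sum fun m _ => (ENNReal.ofReal_mul (by positivity)).le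
    have hmeas : ∀ m, Measurable fun p : (Fin d → ℝ) × (Fin n → Fin d → ℝ) =>
        ENNReal.ofReal (p.1 ⬝ᵥ gram p.2 ^ (q - m) *ᵥ p.1) :=
      fun m => (measurable_moment (q - m)).ennreal_ofReal
    refine (lintegral_mono_ae hpt).trans ?_
    rw [lintegral_finsetSum _ fun m _ => (hmeas m).const_mul _]
    have hm : ∀ m ∈ Finset.range (q + 1),
        ∫⁻ p, ENNReal.ofReal ((q.choose m : ℝ) * R ^ m) *
          ENNReal.ofReal (p.1 ⬝ᵥ gram p.2 ^ (q - m) *ᵥ p.1)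
            ∂(ν.prod (Measure.pi fun _ : Fin n => ν)) ≤
        ENNReal.ofReal (L * d * (R ^ m * (n * L + q * R) ^ (q - m) * (q.choose m : ℝ))) := by
      intro m hmq
      have hle : q - m < q + 1 := by omega
      rw [lintegral_const_mul _ (hmeas m), lintegral_prod_symm _ (hmeas m).aemeasurable]
      calc ENNReal.ofReal ((q.choose m : ℝ) * R ^ m) *
            ∫⁻ Y, ∫⁻ x, ENNReal.ofReal (x ⬝ᵥ gram Y ^ (q - m) *ᵥ x) ∂ν
              ∂(Measure.pi fun _ : Fin n => ν)
          ≤ ENNReal.ofReal ((q.choose m : ℝ) * R ^ m) *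
            ∫⁻ Y, ENNReal.ofReal L * ENNReal.ofReal ((gram Y ^ (q - m)).trace)
              ∂(Measure.pi fun _ : Fin n => ν) := by
            gcongr with Y
            rw [← ENNReal.ofReal_mul hL]
            exact lintegral_moment_le (posSemidef_gram Y) hL hcov _
        _ ≤ ENNReal.ofReal ((q.choose m : ℝ) * R ^ m) * (ENNReal.ofReal L *
              ENNReal.ofReal (d * (n * L + (q - m : ℕ) * R) ^ (q - m))) := by
            rw [lintegral_const_mul' _ _ ENNReal.ofReal_ne_top]
            gcongr
            exact ih (q - m) hle n
        _ = ENNReal.ofReal ((q.choose m : ℝ) * R ^ m *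
              (L * (d * (n * L + (q - m : ℕ) * R) ^ (q - m)))) := by
            rw [← ENNReal.ofReal_mul hL, ← ENNReal.ofReal_mul (by positivity)]
        _ ≤ _ := by
            refine ENNReal.ofReal_le_ofReal ?_
            -- Enlarging `q - m` to `q` in the base makes the summands those of the binomial
            -- expansion of `(R + (nL + qR))^q`.
            have : ((q - m : ℕ) : ℝ) ≤ q := by exact_mod_cast Nat.sub_le q m
            calc (q.choose m : ℝ) * R ^ m * (L * (d * (n * L + (q - m : ℕ) * R) ^ (q - m)))
                ≤ (q.choose m : ℝ) * R ^ m * (L * (d * (n * L + q * R) ^ (q - m))) := by gcongr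
              _ = _ := by ring
    refine (Finset.sum_le_sum hm).trans ?_
    rw [← ENNReal.ofReal_sum_of_nonneg fun m _ => by positivity, ← Finset.mul_sum, ← add_pow]
    refine (congrArg ENNReal.ofReal ?_).le
    ring
  calc ∫⁻ X, ENNReal.ofReal ((gram X ^ (q + 1)).trace) ∂(Measure.pi fun _ : Fin (n + 1) => ν)
      = ∑ i, ∫⁻ X : Fin (n + 1) → Fin d → ℝ,
          ENNReal.ofReal (X i ⬝ᵥ gram X ^ q *ᵥ X i) ∂(Measure.pi fun _ => ν) := by
        rw [← lintegral_finsetSum]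
        · refine lintegral_congr fun X => ?_
          rw [trace_gram_pow_succ, ENNReal.ofReal_sum_of_nonneg
            fun i _ => moment_nonneg (posSemidef_gram X) _ _]
        · intro i _
          exact ((measurable_moment q).comp ((measurable_pi_apply i).prodMk measurable_id :
            Measurable fun X : Fin (n + 1) → Fin d → ℝ => (X i, X))).ennreal_ofReal
    _ ≤ ∑ _i : Fin (n + 1), ENNReal.ofReal (L * (d * (n * L + (q + 1) * R) ^ q)) :=
        Finset.sum_le_sum fun i _ => hterm i
    _ = ENNReal.ofReal ((n + 1 : ℝ) * (L * (d * (n * L + (q + 1) * R) ^ q))) := by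
        rw [Finset.sum_const, Finset.card_univ, Fintype.card_fin, nsmul_eq_mul,
          ENNReal.ofReal_mul (p := (n + 1 : ℝ)) (by positivity),
          show (n + 1 : ℝ) = ((n + 1 : ℕ) : ℝ) by push_cast; rfl, ENNReal.ofReal_natCast]
    _ ≤ _ := by
        refine ENNReal.ofReal_le_ofReal ?_
        push_cast
        calc (n + 1 : ℝ) * (L * (d * (n * L + (q + 1) * R) ^ q))
            = d * ((n * L + (q + 1) * R) ^ q * ((n + 1) * L)) := by ring
          _ ≤ d * (((n + 1) * L + (q + 1) * R) ^ q * ((n + 1) * L + (q + 1) * R)) := by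
              gcongr
              · linarith
              · have : 0 ≤ (q + 1 : ℝ) * R := by positivity
                linarith
          _ = _ := by ring

theorem measure_topEigenvalue_gram_ge_le (hd : 0 < d) (hL : 0 < L) (hR : 0 < R)
    (hb : ∀ᵐ x ∂ν, x ⬝ᵥ x ≤ R)
    (hcov : ∀ w : Fin d → ℝ, w ⬝ᵥ w = 1 →
      ∫⁻ x, ENNReal.ofReal ((w ⬝ᵥ x) ^ 2) ∂ν ≤ ENNReal.ofReal L) (hn : 0 < n) :
    (Measure.pi fun _ : Fin n => ν) {X | 9 / 8 * (n * L) ≤ topEigenvalue (gram X)} ≤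
      ENNReal.ofReal (d * (2 * Real.exp (-(n * L / (300 * R))))) := by
  -- With `qR ≤ nL/16` the ratio of the moment bound to the level is at most `(17/16) / (9/8) =
  -- 17/18 ≤ exp (-1/18)`. Since `16 * 18 = 288 < 300`, its `q`-th power has the claimed decay;
  -- rounding `q` down costs `exp (1/18) ≤ 2`.
  set q := ⌊n * L / (16 * R)⌋₊ with hq
  have hnL : 0 < n * L := by positivity
  have ht : 0 < (9 / 8 * (n * L)) ^ q := by positivity
  have hsub : {X : Fin n → Fin d → ℝ | 9 / 8 * (n * L) ≤ topEigenvalue (gram X)} ⊆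
      {X | ENNReal.ofReal ((9 / 8 * (n * L)) ^ q) ≤ ENNReal.ofReal ((gram X ^ q).trace)} :=
    fun X hX => ENNReal.ofReal_le_ofReal ((pow_le_pow_left₀ (by positivity) hX q).trans
      (topEigenvalue_pow_le_trace hd (posSemidef_gram X) q))
  have hmeas : Measurable fun X : Fin n → Fin d → ℝ => ENNReal.ofReal ((gram X ^ q).trace) :=
    (Continuous.matrix_trace (continuous_gram.pow q)).measurable.ennreal_ofReal
  refine (measure_mono hsub).trans ?_
  refine (meas_ge_le_lintegral_div hmeas.aemeasurable (by simpa using ht)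
    ENNReal.ofReal_ne_top).trans ?_
  refine (ENNReal.div_le_div_right
    (lintegral_trace_gram_pow_le hL.le hR.le hb hcov q n) _).trans ?_
  rw [← ENNReal.ofReal_div_of_pos ht]
  refine ENNReal.ofReal_le_ofReal ?_
  rw [mul_div_assoc, ← div_pow]
  have h1 : (q : ℝ) * R ≤ n * L / 16 := by
    have := Nat.floor_le (a := n * L / (16 * R)) (by positivity)
    rw [← hq, le_div_iff₀ (by positivity)] at this
    linarith
  have h2 : (n * L + q * R) / (9 / 8 * (n * L)) ≤ 17 / 18 := by
    rw [div_le_iff₀ (by positivity)]; linarith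
  have h3 : (17 / 18 : ℝ) ≤ Real.exp (-(1 / 18)) := by
    have := Real.add_one_le_exp (-(1 / 18) : ℝ); linarith
  have h4 : n * L / (16 * R) - 1 ≤ q := by
    have := Nat.lt_floor_add_one (n * L / (16 * R)); rw [← hq] at this; linarith
  have h5 : Real.exp (1 / 18) ≤ 2 := by
    have := Real.exp_bound_div_one_sub_of_interval (x := 1 / 18) (by norm_num) (by norm_num)
    linarith
  gcongr
  calc ((n * L + q * R) / (9 / 8 * (n * L))) ^ q ≤ (Real.exp (-(1 / 18))) ^ q := by
        gcongr; exact h2.trans h3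
    _ = Real.exp (q * (-(1 / 18))) := (Real.exp_nat_mul _ _).symm
    _ ≤ Real.exp (1 / 18 + -(n * L / (300 * R))) := by
        refine Real.exp_le_exp.2 ?_
        have h6 : n * L / (300 * R) ≤ n * L / (16 * R) / 18 := by
          rw [div_div]; exact div_le_div_of_nonneg_left hnL.le (by positivity) (by linarith)
        linarith
    _ = Real.exp (1 / 18) * Real.exp (-(n * L / (300 * R))) := Real.exp_add _ _
    _ ≤ 2 * Real.exp (-(n * L / (300 * R))) := by gcongr

/-- The lower tail of a sum of independent copies of `f` with `0 ≤ f ≤ R`. -/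
theorem measure_sum_le_le (hL : 0 < L) (hR : 0 < R) {f : (Fin d → ℝ) → ℝ} (hf : Measurable f)
    (hf0 : ∀ x, 0 ≤ f x) (hfR : ∀ x, f x ≤ R) (hmean : 15 / 16 * L ≤ ∫ x, f x ∂ν) (n : ℕ) :
    (Measure.pi fun _ : Fin n => ν) {X | ∑ i, f (X i) ≤ 7 / 8 * (n * L)} ≤
      ENNReal.ofReal (Real.exp (-(n * L / (1024 * R)))) := by
  -- Chernoff parameter: `t f ≤ 1/32` gives `exp (-t f) ≤ 1 - (31/32) t f`. The final exponent is
  -- right because `31/32 * 15/16 - 7/8 = 17/512 ≥ 1/32`.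
  set t := 1 / (32 * R) with ht
  have ht0 : 0 < t := by positivity
  have hint : Integrable f ν :=
    Integrable.of_bound hf.aestronglyMeasurable R (Filter.Eventually.of_forall fun x => by
      rw [Real.norm_of_nonneg (hf0 x)]; exact hfR x)
  have hexpm : Measurable fun x => Real.exp (-(t * f x)) := by fun_prop
  have hexpint : Integrable (fun x => Real.exp (-(t * f x))) ν :=
    Integrable.of_bound hexpm.aestronglyMeasurable 1 (Filter.Eventually.of_forall fun x => by
      rw [Real.norm_of_nonneg (Real.exp_pos _).le, Real.exp_le_one_iff]
      have := mul_nonneg ht0.le (hf0 x); linarith)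
  have hpt : ∀ x, Real.exp (-(t * f x)) ≤ 1 - 31 / 32 * t * f x := by
    intro x
    have h0 := mul_nonneg ht0.le (hf0 x)
    have h1 : t * f x ≤ 1 / 32 := by
      calc t * f x ≤ t * R := by gcongr; exact hfR x
        _ = 1 / 32 := by rw [ht]; field_simp
    have := Real.abs_exp_sub_one_sub_id_le (x := -(t * f x))
      (by rw [abs_neg, abs_of_nonneg h0]; linarith)
    have := (abs_le.1 this).2
    nlinarith
  have hE : ∫ x, Real.exp (-(t * f x)) ∂ν ≤ Real.exp (-(31 / 32 * t * (15 / 16 * L))) := by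
    calc ∫ x, Real.exp (-(t * f x)) ∂ν ≤ ∫ x, (1 - 31 / 32 * t * f x) ∂ν :=
          integral_mono hexpint ((integrable_const _).sub (hint.const_mul _)) hpt
      _ = 1 - 31 / 32 * t * ∫ x, f x ∂ν := by
          rw [integral_sub (integrable_const _) (hint.const_mul _), integral_const_mul]
          simp
      _ ≤ 1 - 31 / 32 * t * (15 / 16 * L) := by gcongr
      _ ≤ _ := by
          have := Real.add_one_le_exp (-(31 / 32 * t * (15 / 16 * L))); linarith
  have hprod : ∫ X : Fin n → Fin d → ℝ, ∏ i, Real.exp (-(t * f (X i)))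
      ∂(Measure.pi fun _ => ν) = (∫ x, Real.exp (-(t * f x)) ∂ν) ^ n := by
    have := integral_fintype_prod_eq_pow (ι := Fin n) (μ := ν) fun x => Real.exp (-(t * f x))
    simpa using this
  have hpint : Integrable (fun X : Fin n → Fin d → ℝ => ∏ i, Real.exp (-(t * f (X i))))
      (Measure.pi fun _ => ν) :=
    Integrable.fintype_prod (f := fun _ x => Real.exp (-(t * f x))) fun _ => hexpint
  set a := Real.exp (-(t * (7 / 8 * (n * L)))) with ha
  have hmarkov := mul_meas_ge_le_integral_of_nonneg (μ := Measure.pi fun _ : Fin n => ν)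
    (Filter.Eventually.of_forall fun X => Finset.prod_nonneg fun i _ => (Real.exp_pos _).le)
    hpint a
  have hsub : {X : Fin n → Fin d → ℝ | ∑ i, f (X i) ≤ 7 / 8 * (n * L)} ⊆
      {X | a ≤ ∏ i, Real.exp (-(t * f (X i)))} := by
    intro X hX
    have hX' : ∑ i, f (X i) ≤ 7 / 8 * (n * L) := hX
    change a ≤ ∏ i, Real.exp (-(t * f (X i)))
    rw [← Real.exp_sum, ha, Finset.sum_neg_distrib, ← Finset.mul_sum]
    gcongr
  refine (measure_mono hsub).trans ?_
  rw [← ofReal_measureReal]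
  refine ENNReal.ofReal_le_ofReal ?_
  rw [hprod] at hmarkov
  have h1 : a * (Measure.pi fun _ : Fin n => ν).real {X | a ≤ ∏ i, Real.exp (-(t * f (X i)))} ≤
      Real.exp (-(31 / 32 * t * (15 / 16 * L))) ^ n :=
    hmarkov.trans (pow_le_pow_left₀ (integral_nonneg fun x => (Real.exp_pos _).le) hE n)
  rw [← Real.exp_nat_mul] at h1
  have h2 : (Measure.pi fun _ : Fin n => ν).real {X | a ≤ ∏ i, Real.exp (-(t * f (X i)))} ≤
      Real.exp (n * (-(31 / 32 * t * (15 / 16 * L)))) / a := by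
    rw [le_div_iff₀ (Real.exp_pos _), mul_comm]; exact h1
  refine h2.trans ?_
  rw [ha, ← Real.exp_sub]
  refine Real.exp_le_exp.2 ?_
  have h3 : n * L / (1024 * R) = t * (n * L) / 32 := by rw [ht]; field_simp; norm_num
  rw [h3]
  have : 0 ≤ t * (n * L) := by positivity
  nlinarith

end

section

/-! ### Vectors with stretched-exponential tails -/

/-- For `t = z^(1/(2a))` one has `z² = t^(4a)`, and `t/(4a) ≤ exp (t/(4a))` is raised to the power
`4a`. This turns the stretched-exponential tail into a fourth-moment bound for `v ⬝ᵥ x`. -/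
theorem sq_le_mul_exp_rpow {a z : ℝ} (ha : 0 < a) (hz : 0 ≤ z) :
    z ^ 2 ≤ (4 * a) ^ (4 * a) * Real.exp (z ^ (1 / (2 * a))) := by
  set t := z ^ (1 / (2 * a)) with ht
  have ht0 : 0 ≤ t := Real.rpow_nonneg hz _
  have h1 : z ^ 2 = t ^ (4 * a) := by
    rw [ht, ← Real.rpow_mul hz, ← Real.rpow_natCast]
    congr 1; field_simp; norm_num
  have h2 : t / (4 * a) ≤ Real.exp (t / (4 * a)) := by
    have := Real.add_one_le_exp (t / (4 * a)); linarith
  calc z ^ 2 = (4 * a) ^ (4 * a) * (t / (4 * a)) ^ (4 * a) := by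
        rw [h1, ← Real.mul_rpow (by positivity) (by positivity)]
        congr 1; field_simp
    _ ≤ (4 * a) ^ (4 * a) * (Real.exp (t / (4 * a))) ^ (4 * a) := by gcongr
    _ = (4 * a) ^ (4 * a) * Real.exp t := by
        rw [← Real.exp_mul]; congr 2; field_simp

variable {d n : ℕ} {ν : Measure (Fin d → ℝ)} {L κ a s : ℝ}

theorem continuous_dotProduct_right (v : Fin d → ℝ) : Continuous fun x : Fin d → ℝ => v ⬝ᵥ x :=
  continuous_const.dotProduct continuous_id

theorem measurable_dotProduct_self : Measurable fun x : Fin d → ℝ => x ⬝ᵥ x :=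
  (continuous_id.dotProduct continuous_id).measurable

theorem measure_dotProduct_sq_gt_le (hL : 0 < L) (hκ : 0 < κ) (ha : 0 < a) (hs : 0 ≤ s)
    (v : Fin d → ℝ)
    (htail : ∫⁻ x, ENNReal.ofReal (Real.exp (((v ⬝ᵥ x) ^ 2 / (κ * L)) ^ (1 / (2 * a)))) ∂ν ≤ 4) :
    ν {x | κ * L * s ^ (2 * a) < (v ⬝ᵥ x) ^ 2} ≤ ENNReal.ofReal (4 * Real.exp (-s)) := by
  have hsub : {x : Fin d → ℝ | κ * L * s ^ (2 * a) < (v ⬝ᵥ x) ^ 2} ⊆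
      {x | ENNReal.ofReal (Real.exp s) ≤
        ENNReal.ofReal (Real.exp (((v ⬝ᵥ x) ^ 2 / (κ * L)) ^ (1 / (2 * a))))} := by
    intro x hx
    have hx' : κ * L * s ^ (2 * a) < (v ⬝ᵥ x) ^ 2 := hx
    refine ENNReal.ofReal_le_ofReal (Real.exp_le_exp.2 ?_)
    have h1 : s ^ (2 * a) ≤ (v ⬝ᵥ x) ^ 2 / (κ * L) := by
      rw [le_div_iff₀ (by positivity)]; linarith
    calc s = (s ^ (2 * a)) ^ (1 / (2 * a)) := by
          rw [← Real.rpow_mul hs, mul_one_div_cancel (by positivity), Real.rpow_one]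
      _ ≤ _ := by gcongr
  have hm : Measurable fun x : Fin d → ℝ =>
      ENNReal.ofReal (Real.exp (((v ⬝ᵥ x) ^ 2 / (κ * L)) ^ (1 / (2 * a)))) := by
    have := (continuous_dotProduct_right v).measurable
    fun_prop
  refine (measure_mono hsub).trans ((meas_ge_le_lintegral_div hm.aemeasurable
    (by simpa using Real.exp_pos s) ENNReal.ofReal_ne_top).trans ?_)
  refine (ENNReal.div_le_div_right htail _).trans (le_of_eq ?_)
  rw [show (4 : ENNReal) = ENNReal.ofReal 4 by simp, ← ENNReal.ofReal_div_of_pos (Real.exp_pos s),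
    Real.exp_neg]
  rfl

/-- A squared norm above `d τ` forces some squared coordinate above `τ`; Markov's inequality bounds
each coordinate. -/
theorem measure_dotProduct_self_gt_le (hL : 0 < L) (hκ : 0 < κ) (ha : 0 < a) (hs : 0 ≤ s)
    (htail : ∀ v : Fin d → ℝ, v ⬝ᵥ v = 1 →
      ∫⁻ x, ENNReal.ofReal (Real.exp (((v ⬝ᵥ x) ^ 2 / (κ * L)) ^ (1 / (2 * a)))) ∂ν ≤ 4) :
    ν {x | d * (κ * L * s ^ (2 * a)) < x ⬝ᵥ x} ≤ ENNReal.ofReal (d * (4 * Real.exp (-s))) := by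
  have hsub : {x : Fin d → ℝ | d * (κ * L * s ^ (2 * a)) < x ⬝ᵥ x} ⊆
      ⋃ l : Fin d, {x | κ * L * s ^ (2 * a) < ((Pi.single l 1 : Fin d → ℝ) ⬝ᵥ x) ^ 2} := by
    intro x hx
    have hx' : d * (κ * L * s ^ (2 * a)) < x ⬝ᵥ x := hx
    simp only [Set.mem_iUnion]
    by_contra hcon
    push Not at hcon
    have h : ∀ l, x l ^ 2 ≤ κ * L * s ^ (2 * a) := fun l => by
      have := hcon l
      simpa using this
    have : x ⬝ᵥ x ≤ d * (κ * L * s ^ (2 * a)) := by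
      calc x ⬝ᵥ x = ∑ l, x l ^ 2 := by simp [dotProduct, sq]
        _ ≤ ∑ _l : Fin d, κ * L * s ^ (2 * a) := Finset.sum_le_sum fun l _ => h l
        _ = _ := by simp
    linarith
  refine (measure_mono hsub).trans ((measure_iUnion_fintype_le _ _).trans ?_)
  calc ∑ l : Fin d, ν {x | κ * L * s ^ (2 * a) < ((Pi.single l 1 : Fin d → ℝ) ⬝ᵥ x) ^ 2}
      ≤ ∑ _l : Fin d, ENNReal.ofReal (4 * Real.exp (-s)) :=
        Finset.sum_le_sum fun l _ =>
          measure_dotProduct_sq_gt_le hL hκ ha hs _ (htail _ (by simp))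
    _ = _ := by
        rw [Finset.sum_const, Finset.card_univ, Fintype.card_fin, nsmul_eq_mul,
          ENNReal.ofReal_mul (p := (d : ℝ)) (by positivity), ENNReal.ofReal_natCast]

theorem lintegral_dotProduct_pow_four_le (hL : 0 < L) (hκ : 0 < κ) (ha : 0 < a)
    (v : Fin d → ℝ)
    (htail : ∫⁻ x, ENNReal.ofReal (Real.exp (((v ⬝ᵥ x) ^ 2 / (κ * L)) ^ (1 / (2 * a)))) ∂ν ≤ 4) :
    ∫⁻ x, ENNReal.ofReal (((v ⬝ᵥ x) ^ 2) ^ 2) ∂ν ≤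
      ENNReal.ofReal (4 * (4 * a) ^ (4 * a) * (κ * L) ^ 2) := by
  have hpt : ∀ x : Fin d → ℝ, ENNReal.ofReal (((v ⬝ᵥ x) ^ 2) ^ 2) ≤
      ENNReal.ofReal ((κ * L) ^ 2 * (4 * a) ^ (4 * a)) *
        ENNReal.ofReal (Real.exp (((v ⬝ᵥ x) ^ 2 / (κ * L)) ^ (1 / (2 * a)))) := by
    intro x
    rw [← ENNReal.ofReal_mul (by positivity)]
    refine ENNReal.ofReal_le_ofReal ?_
    have h := sq_le_mul_exp_rpow ha (z := (v ⬝ᵥ x) ^ 2 / (κ * L)) (by positivity)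
    rw [div_pow, div_le_iff₀ (by positivity)] at h
    linarith
  refine (lintegral_mono hpt).trans ?_
  rw [lintegral_const_mul' _ _ ENNReal.ofReal_ne_top]
  refine (mul_le_mul_right htail _).trans (le_of_eq ?_)
  rw [show (4 : ENNReal) = ENNReal.ofReal 4 by simp, ← ENNReal.ofReal_mul (by positivity)]
  congr 1; ring

/-- The truncation of a vector at squared norm `R`. -/
def truncate (R : ℝ) (x : Fin d → ℝ) : Fin d → ℝ :=
  if x ⬝ᵥ x ≤ R then x else 0

theorem measurable_truncate (R : ℝ) : Measurable (truncate (d := d) R) :=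
  Measurable.ite (measurableSet_le measurable_dotProduct_self measurable_const) measurable_id
    measurable_const

theorem dotProduct_truncate_sq_le (R : ℝ) (w x : Fin d → ℝ) :
    (w ⬝ᵥ truncate R x) ^ 2 ≤ (w ⬝ᵥ x) ^ 2 := by
  unfold truncate
  split_ifs
  · exact le_rfl
  · simpa using sq_nonneg (w ⬝ᵥ x)

theorem dotProduct_sq_le (v x : Fin d → ℝ) (hv : v ⬝ᵥ v = 1) : (v ⬝ᵥ x) ^ 2 ≤ x ⬝ᵥ x := by
  have h := Finset.sum_mul_sq_le_sq_mul_sq Finset.univ v x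
  have hv' : ∑ i, v i ^ 2 = 1 := by rw [← hv]; simp [dotProduct, sq]
  have hx' : ∑ i, x i ^ 2 = x ⬝ᵥ x := by simp [dotProduct, sq]
  rw [hv', hx', one_mul] at h
  exact h

theorem truncate_self_le {R : ℝ} (hR : 0 ≤ R) (x : Fin d → ℝ) :
    truncate R x ⬝ᵥ truncate R x ≤ R := by
  unfold truncate
  split_ifs with h
  · exact h
  · simpa using hR

variable [IsProbabilityMeasure ν]

/-- The second moment lost by truncation is controlled by the fourth moment and the probability of a
long vector, through `y ≤ α y² + 1/(4α)`. -/
theorem integral_truncate_ge (hL : 0 < L) (hκ : 0 < κ) (ha : 0 < a) (hs : 0 ≤ s)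
    (htail : ∀ v : Fin d → ℝ, v ⬝ᵥ v = 1 →
      ∫⁻ x, ENNReal.ofReal (Real.exp (((v ⬝ᵥ x) ^ 2 / (κ * L)) ^ (1 / (2 * a)))) ∂ν ≤ 4)
    (v : Fin d → ℝ) (hv : v ⬝ᵥ v = 1)
    (hvL : ∫⁻ x, ENNReal.ofReal ((v ⬝ᵥ x) ^ 2) ∂ν = ENNReal.ofReal L)
    (hsmall : 4096 * (4 * a) ^ (4 * a) * κ ^ 2 * d * Real.exp (-s) ≤ 1) :
    15 / 16 * L ≤ ∫ x, (v ⬝ᵥ truncate (d * (κ * L * s ^ (2 * a))) x) ^ 2 ∂ν := by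
  set R := d * (κ * L * s ^ (2 * a)) with hR
  have hR0 : 0 ≤ R := by positivity
  have hM : 0 < (4 * a) ^ (4 * a) := by positivity
  set M := (4 * a) ^ (4 * a) with hMdef
  -- Chosen so that the fourth-moment term equals `L/32`; the smallness of `exp (-s)` bounds the
  -- other term by `L/32` as well.
  set α := 1 / (128 * M * κ ^ 2 * L) with hα
  have hα0 : 0 < α := by positivity
  have hbad : MeasurableSet {x : Fin d → ℝ | R < x ⬝ᵥ x} :=
    measurableSet_lt measurable_const measurable_dotProduct_self
  have hmv := (continuous_dotProduct_right v).measurable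
  have hmf : Measurable fun x : Fin d → ℝ => (v ⬝ᵥ truncate R x) ^ 2 :=
    (hmv.comp (measurable_truncate R)).pow_const 2
  have hpt : ∀ x : Fin d → ℝ, ENNReal.ofReal ((v ⬝ᵥ x) ^ 2) ≤
      ENNReal.ofReal ((v ⬝ᵥ truncate R x) ^ 2) +
        (ENNReal.ofReal α * ENNReal.ofReal (((v ⬝ᵥ x) ^ 2) ^ 2) +
          {x : Fin d → ℝ | R < x ⬝ᵥ x}.indicator (fun _ => ENNReal.ofReal (1 / (4 * α))) x) := by
    intro x
    by_cases h : x ⬝ᵥ x ≤ R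
    · rw [truncate, if_pos h]
      exact le_self_add
    · rw [Set.indicator_of_mem (show x ∈ {x : Fin d → ℝ | R < x ⬝ᵥ x} from not_le.1 h),
        ← ENNReal.ofReal_mul hα0.le, ← ENNReal.ofReal_add (by positivity) (by positivity)]
      refine le_trans (ENNReal.ofReal_le_ofReal ?_) le_add_self
      set y := (v ⬝ᵥ x) ^ 2
      have : α * y ^ 2 + 1 / (4 * α) - y = (2 * α * y - 1) ^ 2 / (4 * α) := by
        field_simp; ring
      have h2 : 0 ≤ (2 * α * y - 1) ^ 2 / (4 * α) := by positivity
      linarith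
  have hint : ENNReal.ofReal L ≤ ∫⁻ x, ENNReal.ofReal ((v ⬝ᵥ truncate R x) ^ 2) ∂ν +
      (ENNReal.ofReal (L / 32) + ENNReal.ofReal (L / 32)) := by
    rw [← hvL]
    refine (lintegral_mono hpt).trans ?_
    rw [lintegral_add_left hmf.ennreal_ofReal, lintegral_add_left (by fun_prop),
      lintegral_const_mul' _ _ ENNReal.ofReal_ne_top, lintegral_indicator_const hbad]
    gcongr
    · calc ENNReal.ofReal α * ∫⁻ x, ENNReal.ofReal (((v ⬝ᵥ x) ^ 2) ^ 2) ∂ν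
          ≤ ENNReal.ofReal α * ENNReal.ofReal (4 * M * (κ * L) ^ 2) := by
            gcongr; exact lintegral_dotProduct_pow_four_le hL hκ ha v (htail v hv)
        _ = ENNReal.ofReal (L / 32) := by
            rw [← ENNReal.ofReal_mul hα0.le, hα]
            congr 1; field_simp; norm_num
    · calc ENNReal.ofReal (1 / (4 * α)) * ν {x | R < x ⬝ᵥ x}
          ≤ ENNReal.ofReal (1 / (4 * α)) * ENNReal.ofReal (d * (4 * Real.exp (-s))) := by
            gcongr; exact measure_dotProduct_self_gt_le hL hκ ha hs htail
        _ ≤ ENNReal.ofReal (L / 32) := by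
            rw [← ENNReal.ofReal_mul (by positivity)]
            refine ENNReal.ofReal_le_ofReal ?_
            have : 1 / (4 * α) * (d * (4 * Real.exp (-s))) =
                (4096 * M * κ ^ 2 * d * Real.exp (-s)) * (L / 32) := by
              rw [hα]; field_simp; ring
            rw [this]
            calc _ ≤ 1 * (L / 32) := by gcongr
              _ = _ := one_mul _
  have hfi : ∫⁻ x, ENNReal.ofReal ((v ⬝ᵥ truncate R x) ^ 2) ∂ν =
      ENNReal.ofReal (∫ x, (v ⬝ᵥ truncate R x) ^ 2 ∂ν) := by
    refine (ofReal_integral_eq_lintegral_ofReal ?_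
      (Filter.Eventually.of_forall fun x => sq_nonneg _)).symm
    refine Integrable.of_bound hmf.aestronglyMeasurable R (Filter.Eventually.of_forall fun x => ?_)
    rw [Real.norm_of_nonneg (sq_nonneg _)]
    exact (dotProduct_sq_le v _ hv).trans (truncate_self_le hR0 x)
  have h0 : 0 ≤ ∫ x, (v ⬝ᵥ truncate R x) ^ 2 ∂ν := integral_nonneg fun x => sq_nonneg _
  rw [hfi, ← ENNReal.ofReal_add (by positivity) (by positivity),
    ← ENNReal.ofReal_add h0 (by positivity), ENNReal.ofReal_le_ofReal_iff (by positivity)] at hint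
  linarith

/-- Concentration of the largest eigenvalue of an empirical covariance matrix. -/
theorem measure_topEigenvalue_gram_bad_le (hd : 0 < d) (hn : 0 < n) (hL : 0 < L) (hκ : 0 < κ)
    (ha : 0 < a) (hs : 0 < s)
    (hcov : ∀ w : Fin d → ℝ, w ⬝ᵥ w = 1 →
      ∫⁻ x, ENNReal.ofReal ((w ⬝ᵥ x) ^ 2) ∂ν ≤ ENNReal.ofReal L)
    (htail : ∀ v : Fin d → ℝ, v ⬝ᵥ v = 1 →
      ∫⁻ x, ENNReal.ofReal (Real.exp (((v ⬝ᵥ x) ^ 2 / (κ * L)) ^ (1 / (2 * a)))) ∂ν ≤ 4)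
    (v : Fin d → ℝ) (hv : v ⬝ᵥ v = 1)
    (hvL : ∫⁻ x, ENNReal.ofReal ((v ⬝ᵥ x) ^ 2) ∂ν = ENNReal.ofReal L)
    (hsmall : 4096 * (4 * a) ^ (4 * a) * κ ^ 2 * d * Real.exp (-s) ≤ 1)
    (hlarge : 1024 * (d * κ * s ^ (2 * a)) * s ≤ n) :
    (Measure.pi fun _ : Fin n => ν) {X | topEigenvalue (gram X) ≤ 7 / 8 * (n * L) ∨
      9 / 8 * (n * L) ≤ topEigenvalue (gram X)} ≤ ENNReal.ofReal (7 * n * d * Real.exp (-s)) := by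
  set R := d * (κ * L * s ^ (2 * a)) with hR
  have hd' : (1 : ℝ) ≤ d := by exact_mod_cast hd
  have hn' : (1 : ℝ) ≤ n := by exact_mod_cast hn
  have hR0 : 0 < R := by positivity
  have hsR : s ≤ n * L / (1024 * R) := by
    rw [le_div_iff₀ (by positivity), hR]
    calc s * (1024 * (d * (κ * L * s ^ (2 * a)))) = 1024 * (d * κ * s ^ (2 * a)) * s * L := by ring
      _ ≤ n * L := by gcongr
  have hsR' : s ≤ n * L / (300 * R) := hsR.trans (by gcongr; norm_num)
  set μ := Measure.pi fun _ : Fin n => ν with hμ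
  have hmt := measurable_truncate (d := d) R
  have hmv := (continuous_dotProduct_right v).measurable
  set ν' := ν.map (truncate R) with hν'
  have : IsProbabilityMeasure ν' := Measure.isProbabilityMeasure_map hmt.aemeasurable
  have hmt' : Measurable fun X : Fin n → Fin d → ℝ => fun i => truncate R (X i) :=
    measurable_pi_iff.2 fun i => hmt.comp (measurable_pi_apply i)
  have hmap : μ.map (fun X i => truncate R (X i)) = Measure.pi fun _ : Fin n => ν' :=
    Measure.pi_map_pi fun _ => hmt.aemeasurable
  -- Truncation only decreases `(v ⬝ᵥ x)²`, so the lower tail passes to truncated vectors for free.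
  -- The upper tail does so only when no vector is truncated, which adds the last event.
  have hsub : {X : Fin n → Fin d → ℝ | topEigenvalue (gram X) ≤ 7 / 8 * (n * L) ∨
      9 / 8 * (n * L) ≤ topEigenvalue (gram X)} ⊆
      ({X | ∑ i, (v ⬝ᵥ truncate R (X i)) ^ 2 ≤ 7 / 8 * (n * L)} ∪
        (fun X i => truncate R (X i)) ⁻¹' {X | 9 / 8 * (n * L) ≤ topEigenvalue (gram X)}) ∪
        ⋃ i, {X | R < X i ⬝ᵥ X i} := by
    rintro X (h | h)
    · refine Or.inl (Or.inl ?_)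
      change ∑ i, (v ⬝ᵥ truncate R (X i)) ^ 2 ≤ 7 / 8 * (n * L)
      calc ∑ i, (v ⬝ᵥ truncate R (X i)) ^ 2 ≤ ∑ i, (v ⬝ᵥ X i) ^ 2 :=
            Finset.sum_le_sum fun i _ => dotProduct_truncate_sq_le R v (X i)
        _ = v ⬝ᵥ gram X *ᵥ v := (dotProduct_gram_mulVec X v).symm
        _ ≤ topEigenvalue (gram X) := dotProduct_mulVec_le_topEigenvalue (posSemidef_gram X) hv
        _ ≤ _ := h
    · by_cases hX : ∃ i, R < X i ⬝ᵥ X i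
      · exact Or.inr (Set.mem_iUnion.2 hX)
      · push Not at hX
        refine Or.inl (Or.inr ?_)
        have : (fun i => truncate R (X i)) = X := by
          ext1 i
          rw [truncate, if_pos (hX i)]
        change 9 / 8 * (n * L) ≤ topEigenvalue (gram fun i => truncate R (X i))
        rwa [this]
  have h1 : μ {X | ∑ i, (v ⬝ᵥ truncate R (X i)) ^ 2 ≤ 7 / 8 * (n * L)} ≤
      ENNReal.ofReal (Real.exp (-s)) := by
    refine (measure_sum_le_le hL hR0 ((hmv.comp hmt).pow_const 2) (fun x => sq_nonneg _)
      (fun x => (dotProduct_sq_le v _ hv).trans (truncate_self_le hR0.le x))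
      (integral_truncate_ge hL hκ ha hs.le htail v hv hvL hsmall) n).trans ?_
    exact ENNReal.ofReal_le_ofReal (Real.exp_le_exp.2 (neg_le_neg hsR))
  have h2 : μ ((fun X i => truncate R (X i)) ⁻¹' {X | 9 / 8 * (n * L) ≤ topEigenvalue (gram X)}) ≤
      ENNReal.ofReal (d * (2 * Real.exp (-s))) := by
    refine (Measure.le_map_apply hmt'.aemeasurable _).trans ?_
    rw [hmap]
    refine (measure_topEigenvalue_gram_ge_le hd hL hR0 ?_ ?_ hn).trans ?_
    · rw [hν', ae_map_iff hmt.aemeasurable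
        (measurableSet_le measurable_dotProduct_self measurable_const)]
      exact Filter.Eventually.of_forall fun x => truncate_self_le hR0.le x
    · intro w hw
      have hmw := (continuous_dotProduct_right w).measurable
      rw [hν', lintegral_map (by fun_prop) hmt]
      exact (lintegral_mono fun x =>
        ENNReal.ofReal_le_ofReal (dotProduct_truncate_sq_le R w x)).trans (hcov w hw)
    · refine ENNReal.ofReal_le_ofReal ?_
      gcongr
  have h3 : μ (⋃ i, {X | R < X i ⬝ᵥ X i}) ≤ ENNReal.ofReal (n * (d * (4 * Real.exp (-s)))) := by
    refine (measure_iUnion_fintype_le _ _).trans ?_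
    calc ∑ i : Fin n, μ {X | R < X i ⬝ᵥ X i}
        ≤ ∑ _i : Fin n, ENNReal.ofReal (d * (4 * Real.exp (-s))) := by
          refine Finset.sum_le_sum fun i _ => ?_
          have hbad : MeasurableSet {x : Fin d → ℝ | R < x ⬝ᵥ x} :=
            measurableSet_lt measurable_const measurable_dotProduct_self
          exact ((measurePreserving_eval (fun _ : Fin n => ν) i).measure_preimage
            hbad.nullMeasurableSet).trans_le (measure_dotProduct_self_gt_le hL hκ ha hs.le htail)
      _ = _ := by
          rw [Finset.sum_const, Finset.card_univ, Fintype.card_fin, nsmul_eq_mul,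
            ENNReal.ofReal_mul (p := (n : ℝ)) (by positivity), ENNReal.ofReal_natCast]
  refine (measure_mono hsub).trans ((measure_union_le _ _).trans
    ((add_le_add ((measure_union_le _ _).trans (add_le_add h1 h2)) h3).trans ?_))
  rw [← ENNReal.ofReal_add (by positivity) (by positivity),
    ← ENNReal.ofReal_add (by positivity) (by positivity)]
  refine ENNReal.ofReal_le_ofReal ?_
  have hE := Real.exp_pos (-s)
  have hnd : (d : ℝ) ≤ n * d := by nlinarith
  nlinarith

end

section

/-! ### The law of the differences of consecutive samples -/

variable {d : ℕ} {D : Measure (Matrix (Fin d) (Fin d) ℝ)} {S : Matrix (Fin d) (Fin d) ℝ}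
  {u : Fin d → ℝ} {K a : ℝ}

/-- The law of `A u - A' u` for independent `A, A' ∼ D`. -/
def diffLaw (D : Measure (Matrix (Fin d) (Fin d) ℝ)) (u : Fin d → ℝ) : Measure (Fin d → ℝ) :=
  (D.prod D).map fun p => p.1 *ᵥ u - p.2 *ᵥ u

theorem measurable_entry (i j : Fin d) : Measurable fun M : Matrix (Fin d) (Fin d) ℝ => M i j :=
  (measurable_pi_apply j).comp (measurable_pi_apply (X := fun _ : Fin d => Fin d → ℝ) i)

theorem measurable_mulVec (u : Fin d → ℝ) :
    Measurable fun M : Matrix (Fin d) (Fin d) ℝ => M *ᵥ u := by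
  refine measurable_pi_iff.2 fun i => ?_
  simp only [Matrix.mulVec, dotProduct]
  exact Finset.measurable_sum _ fun j _ => (measurable_entry i j).mul_const _

theorem measurable_diff (u : Fin d → ℝ) :
    Measurable fun p : Matrix (Fin d) (Fin d) ℝ × Matrix (Fin d) (Fin d) ℝ =>
      p.1 *ᵥ u - p.2 *ᵥ u :=
  ((measurable_mulVec u).comp measurable_fst).sub ((measurable_mulVec u).comp measurable_snd)

instance [IsProbabilityMeasure D] : IsProbabilityMeasure (diffLaw D u) :=
  Measure.isProbabilityMeasure_map (measurable_diff u).aemeasurable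

theorem measurable_dotProduct_centered (v : Fin d → ℝ) :
    Measurable fun M : Matrix (Fin d) (Fin d) ℝ => v ⬝ᵥ ((M - S) *ᵥ u) := by
  simp only [Matrix.sub_mulVec]
  exact (continuous_dotProduct_right v).measurable.comp ((measurable_mulVec u).sub_const _)

/-- The covariance matrix of `A u`. -/
def covMatrix (D : Measure (Matrix (Fin d) (Fin d) ℝ)) (S : Matrix (Fin d) (Fin d) ℝ)
    (u : Fin d → ℝ) : Matrix (Fin d) (Fin d) ℝ :=
  Matrix.of fun i j => ∫ M, ((M - S) *ᵥ u) i * ((M - S) *ᵥ u) j ∂D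

theorem gradientCov_eq (D : Measure (Matrix (Fin d) (Fin d) ℝ)) (S : Matrix (Fin d) (Fin d) ℝ)
    (u : Fin d → ℝ) : gradientCov D S u = (1 / topEigenvalue S ^ 2) • covMatrix D S u := by
  ext i j
  simp only [gradientCov, covMatrix, Matrix.of_apply, Matrix.smul_apply, smul_eq_mul]
  congr 1
  refine integral_congr_ae (Filter.Eventually.of_forall fun M => ?_)
  simp only [Matrix.mul_vecMulVec, Matrix.vecMulVec_mul, Matrix.vecMul_transpose,
    Matrix.vecMulVec_apply]

theorem spectralNorm_smul (c : ℝ) (M : Matrix (Fin d) (Fin d) ℝ) :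
    spectralNorm (c • M) = |c| * spectralNorm M := by
  rw [spectralNorm, map_smul, norm_smul, Real.norm_eq_abs, spectralNorm]

/-- The factor `λ₁` is a mere normalisation: the tail condition and the target both depend only on
the covariance matrix of `A u`. -/
theorem topEigenvalue_sq_mul_spectralNorm (h : 0 < topEigenvalue S) :
    topEigenvalue S ^ 2 * spectralNorm (gradientCov D S u) = spectralNorm (covMatrix D S u) := by
  rw [gradientCov_eq, spectralNorm_smul, abs_of_nonneg (by positivity)]
  field_simp

theorem dotProduct_diff (v : Fin d → ℝ) (M M' : Matrix (Fin d) (Fin d) ℝ) :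
    v ⬝ᵥ (M *ᵥ u - M' *ᵥ u) = v ⬝ᵥ ((M - S) *ᵥ u) - v ⬝ᵥ ((M' - S) *ᵥ u) := by
  rw [← dotProduct_sub, Matrix.sub_mulVec, Matrix.sub_mulVec, sub_sub_sub_cancel_right]

/-- Symmetry of the mean turns the transposed form of the tail condition into one about `(A - Σ) u`.
-/
theorem dotProduct_transpose_sub (hS : S.PosSemidef) (v : Fin d → ℝ)
    (M : Matrix (Fin d) (Fin d) ℝ) : u ⬝ᵥ ((Mᵀ - S) *ᵥ v) = v ⬝ᵥ ((M - S) *ᵥ u) := by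
  have hST : Sᵀ = S := by
    rw [← Matrix.conjTranspose_eq_transpose_of_trivial]; exact hS.isHermitian.eq
  nth_rewrite 1 [← hST]
  rw [← Matrix.transpose_sub, Matrix.mulVec_transpose, dotProduct_comm,
    Matrix.dotProduct_mulVec]

/-- The tail condition for `A u` with an arbitrary vector `u`. -/
theorem lintegral_centered_tail (h : HasPSDMean D S) (ht : HasTail D S K a) (hu : u ≠ 0)
    (v : Fin d → ℝ) (hv : v ⬝ᵥ v = 1) :
    ∫⁻ M, ENNReal.ofReal (Real.exp (((v ⬝ᵥ ((M - S) *ᵥ u)) ^ 2 /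
      (K ^ 2 * spectralNorm (covMatrix D S u))) ^ (1 / (2 * a)))) ∂D ≤ 2 := by
  have huu : 0 < u ⬝ᵥ u := by
    have h0 : u ⬝ᵥ u = ∑ i, u i ^ 2 := by simp [dotProduct, sq]
    have : 0 ≤ u ⬝ᵥ u := by rw [h0]; positivity
    exact lt_of_le_of_ne this fun h => hu (dotProduct_self_eq_zero.1 h.symm)
  set c := √(u ⬝ᵥ u) with hc
  have hc0 : 0 < c := Real.sqrt_pos.2 huu
  have hcc : c ^ 2 = u ⬝ᵥ u := Real.sq_sqrt huu.le
  set e := c⁻¹ • u with he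
  have hue : u = c • e := by rw [he, smul_smul, mul_inv_cancel₀ hc0.ne', one_smul]
  have hee : e ⬝ᵥ e = 1 := by
    rw [he, smul_dotProduct, dotProduct_smul, smul_eq_mul, smul_eq_mul, ← hcc]; field_simp
  -- The tail condition concerns unit vectors only. Numerator and denominator of its quotient both
  -- scale with `c²`, so it extends to every `u ≠ 0`.
  have hcov : covMatrix D S u = c ^ 2 • covMatrix D S e := by
    ext i j
    simp only [covMatrix, Matrix.of_apply, Matrix.smul_apply, smul_eq_mul]
    rw [← integral_const_mul]
    refine integral_congr_ae (Filter.Eventually.of_forall fun M => ?_)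
    simp only
    rw [hue]
    simp only [Matrix.mulVec_smul, Pi.smul_apply, smul_eq_mul]
    ring
  have hmain := ht e v hee hv
  refine le_trans (lintegral_mono fun M => ENNReal.ofReal_le_ofReal (Real.exp_le_exp.2
    (le_of_eq ?_))) hmain
  congr 1
  rw [dotProduct_transpose_sub h.posSemidef, sq_abs, mul_assoc (K ^ 2),
    topEigenvalue_sq_mul_spectralNorm h.top_pos, hcov, spectralNorm_smul,
    abs_of_nonneg (by positivity : 0 ≤ c ^ 2)]
  have : v ⬝ᵥ ((M - S) *ᵥ u) = c * (v ⬝ᵥ ((M - S) *ᵥ e)) := by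
    rw [hue, Matrix.mulVec_smul, dotProduct_smul, smul_eq_mul]
  rw [this, mul_pow, show K ^ 2 * (c ^ 2 * spectralNorm (covMatrix D S e)) =
    c ^ 2 * (K ^ 2 * spectralNorm (covMatrix D S e)) by ring,
    mul_div_mul_left _ _ (by positivity)]

variable [IsProbabilityMeasure D]

theorem memLp_centered (h : HasPSDMean D S) (u : Fin d → ℝ) (i : Fin d) :
    MemLp (fun M => ((M - S) *ᵥ u) i) 2 D := by
  simp only [Matrix.mulVec, dotProduct, Matrix.sub_apply]
  exact memLp_finsetSum _ fun j _ => ((h.memLp i j).sub (memLp_const (S i j))).mul_const (u j)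

theorem memLp_dotProduct_centered (h : HasPSDMean D S) (u v : Fin d → ℝ) :
    MemLp (fun M => v ⬝ᵥ ((M - S) *ᵥ u)) 2 D := by
  simp only [dotProduct]
  exact memLp_finsetSum _ fun i _ => (memLp_centered h u i).const_mul (v i)

theorem integral_centered (h : HasPSDMean D S) (u : Fin d → ℝ) (i : Fin d) :
    ∫ M, ((M - S) *ᵥ u) i ∂D = 0 := by
  have hi : ∀ j, Integrable (fun M : Matrix (Fin d) (Fin d) ℝ => M i j) D := fun j =>
    (h.memLp i j).integrable one_le_two
  have hi' : ∀ j ∈ Finset.univ, Integrable (fun M : Matrix (Fin d) (Fin d) ℝ =>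
      (M i j - S i j) * u j) D := fun j _ => ((hi j).sub (integrable_const _)).mul_const _
  have e : ∀ M : Matrix (Fin d) (Fin d) ℝ, ((M - S) *ᵥ u) i = ∑ j, (M i j - S i j) * u j :=
    fun M => rfl
  simp only [e]
  rw [integral_finsetSum _ hi']
  refine Finset.sum_eq_zero fun j _ => ?_
  rw [integral_mul_const, integral_sub (hi j) (integrable_const _), h.mean]
  simp

theorem integral_dotProduct_centered (h : HasPSDMean D S) (u v : Fin d → ℝ) :
    ∫ M, v ⬝ᵥ ((M - S) *ᵥ u) ∂D = 0 := by
  simp only [dotProduct]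
  rw [integral_finsetSum _ fun i _ =>
    ((memLp_centered h u i).integrable one_le_two).const_mul (v i)]
  exact Finset.sum_eq_zero fun i _ => by rw [integral_const_mul, integral_centered h, mul_zero]

theorem integral_dotProduct_centered_sq (h : HasPSDMean D S) (u v : Fin d → ℝ) :
    ∫ M, (v ⬝ᵥ ((M - S) *ᵥ u)) ^ 2 ∂D = v ⬝ᵥ covMatrix D S u *ᵥ v := by
  have hij : ∀ i j, Integrable (fun M => ((M - S) *ᵥ u) i * ((M - S) *ᵥ u) j) D := fun i j =>
    (memLp_centered h u i).integrable_mul (memLp_centered h u j)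
  have e : ∀ M : Matrix (Fin d) (Fin d) ℝ, (v ⬝ᵥ ((M - S) *ᵥ u)) ^ 2 =
      ∑ i, ∑ j, v i * v j * (((M - S) *ᵥ u) i * ((M - S) *ᵥ u) j) := by
    intro M
    rw [sq, dotProduct, Finset.sum_mul_sum]
    exact Finset.sum_congr rfl fun i _ => Finset.sum_congr rfl fun j _ => by ring
  have e' : v ⬝ᵥ covMatrix D S u *ᵥ v = ∑ i, ∑ j, v i * v j * covMatrix D S u i j := by
    simp only [dotProduct, Matrix.mulVec, Finset.mul_sum]
    exact Finset.sum_congr rfl fun i _ => Finset.sum_congr rfl fun j _ => by ring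
  simp only [e, e']
  rw [integral_finsetSum _ fun i _ => integrable_finsetSum _ fun j _ => (hij i j).const_mul _]
  refine Finset.sum_congr rfl fun i _ => ?_
  rw [integral_finsetSum _ fun j _ => (hij i j).const_mul _]
  exact Finset.sum_congr rfl fun j _ => integral_const_mul _ _

theorem posSemidef_covMatrix (h : HasPSDMean D S) (u : Fin d → ℝ) :
    (covMatrix D S u).PosSemidef := by
  refine Matrix.PosSemidef.of_dotProduct_mulVec_nonneg ?_ fun v => ?_
  · ext i j
    simp only [covMatrix, Matrix.conjTranspose_apply, Matrix.of_apply, star_trivial]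
    exact integral_congr_ae (Filter.Eventually.of_forall fun M => mul_comm _ _)
  · rw [star_trivial, ← integral_dotProduct_centered_sq h]
    exact integral_nonneg fun M => sq_nonneg _

/-- The mean cancels in the difference, and the cross term vanishes by independence. The factor `2`
is what the normalisation `1/(2b)` compensates. -/
theorem lintegral_diffLaw_sq (h : HasPSDMean D S) (u v : Fin d → ℝ) :
    ∫⁻ x, ENNReal.ofReal ((v ⬝ᵥ x) ^ 2) ∂(diffLaw D u) =
      ENNReal.ofReal (2 * (v ⬝ᵥ covMatrix D S u *ᵥ v)) := by
  have hmv := (continuous_dotProduct_right v).measurable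
  rw [diffLaw, lintegral_map (by fun_prop) (measurable_diff u)]
  simp only [dotProduct_diff (S := S)]
  set f : Matrix (Fin d) (Fin d) ℝ → ℝ := fun M => v ⬝ᵥ ((M - S) *ᵥ u) with hf
  have hf2 : MemLp f 2 D := memLp_dotProduct_centered h u v
  have h1 : MemLp (fun p : Matrix (Fin d) (Fin d) ℝ × Matrix (Fin d) (Fin d) ℝ => f p.1) 2
      (D.prod D) := hf2.comp_measurePreserving measurePreserving_fst
  have h2 : MemLp (fun p : Matrix (Fin d) (Fin d) ℝ × Matrix (Fin d) (Fin d) ℝ => f p.2) 2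
      (D.prod D) := hf2.comp_measurePreserving measurePreserving_snd
  have hsq : Integrable (fun p : Matrix (Fin d) (Fin d) ℝ × Matrix (Fin d) (Fin d) ℝ =>
      (f p.1 - f p.2) ^ 2) (D.prod D) := (h1.sub h2).integrable_sq
  refine (ofReal_integral_eq_lintegral_ofReal hsq
    (Filter.Eventually.of_forall fun p => sq_nonneg _)).symm.trans ?_
  congr 1
  have e : ∀ p : Matrix (Fin d) (Fin d) ℝ × Matrix (Fin d) (Fin d) ℝ,
      (f p.1 - f p.2) ^ 2 = f p.1 ^ 2 + f p.2 ^ 2 - 2 * (f p.1 * f p.2) := fun p => by ring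
  calc ∫ p, (f p.1 - f p.2) ^ 2 ∂(D.prod D)
      = ∫ p, (f p.1 ^ 2 + f p.2 ^ 2 - 2 * (f p.1 * f p.2)) ∂(D.prod D) := by simp only [e]
    _ = (∫ p, f p.1 ^ 2 ∂(D.prod D)) + (∫ p, f p.2 ^ 2 ∂(D.prod D)) -
          2 * ∫ p, f p.1 * f p.2 ∂(D.prod D) := by
        have i1 : Integrable (fun p => f p.1 ^ 2) (D.prod D) := h1.integrable_sq
        have i2 : Integrable (fun p => f p.2 ^ 2) (D.prod D) := h2.integrable_sq
        have i3 : Integrable (fun p => f p.1 * f p.2) (D.prod D) := h1.integrable_mul h2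
        have i4 : Integrable (fun p => f p.1 ^ 2 + f p.2 ^ 2) (D.prod D) := i1.add i2
        rw [integral_sub i4 (i3.const_mul 2), integral_add i1 i2, integral_const_mul]
    _ = _ := by
        rw [integral_prod_mul, integral_dotProduct_centered h, zero_mul, mul_zero, sub_zero,
          integral_fun_fst (fun M => f M ^ 2), integral_fun_snd (fun M => f M ^ 2),
          integral_dotProduct_centered_sq h]
        simp
        ring

/-- Since `(x - y)² ≤ 4 max (x², y²)`, the exponential for the difference is at most the sum of
those for the two terms. Thus the parameters become `L = 2Λ` and `κ = 2K²`, and the bound `2`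
becomes `4`. -/
theorem lintegral_diffLaw_tail (h : HasPSDMean D S) (ht : HasTail D S K a) (ha : 0 < a)
    (hK : 0 < K) (hu : u ≠ 0) (hpos : 0 < spectralNorm (covMatrix D S u))
    (v : Fin d → ℝ) (hv : v ⬝ᵥ v = 1) :
    ∫⁻ x, ENNReal.ofReal (Real.exp (((v ⬝ᵥ x) ^ 2 /
      (2 * K ^ 2 * (2 * spectralNorm (covMatrix D S u)))) ^ (1 / (2 * a)))) ∂(diffLaw D u) ≤ 4 := by
  have hmv := (continuous_dotProduct_right v).measurable
  rw [diffLaw, lintegral_map (by fun_prop) (measurable_diff u)]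
  simp only [dotProduct_diff (S := S)]
  set f : Matrix (Fin d) (Fin d) ℝ → ℝ := fun M => v ⬝ᵥ ((M - S) *ᵥ u) with hf
  set G := K ^ 2 * spectralNorm (covMatrix D S u) with hG
  have hG0 : 0 < G := by positivity
  set φ : Matrix (Fin d) (Fin d) ℝ → ENNReal := fun M =>
    ENNReal.ofReal (Real.exp ((f M ^ 2 / G) ^ (1 / (2 * a)))) with hφ
  have hfm : Measurable f := measurable_dotProduct_centered v
  have hφm : Measurable φ := by fun_prop
  have hone : ∫⁻ M, φ M ∂D ≤ 2 := lintegral_centered_tail h ht hu v hv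
  have hmono : ∀ x y : ℝ, x ^ 2 / (2 * K ^ 2 * (2 * spectralNorm (covMatrix D S u))) ≤ y ^ 2 / G →
      ENNReal.ofReal (Real.exp ((x ^ 2 /
        (2 * K ^ 2 * (2 * spectralNorm (covMatrix D S u)))) ^ (1 / (2 * a)))) ≤
      ENNReal.ofReal (Real.exp ((y ^ 2 / G) ^ (1 / (2 * a)))) := fun x y hxy => by gcongr
  have h4 : 2 * K ^ 2 * (2 * spectralNorm (covMatrix D S u)) = 4 * G := by rw [hG]; ring
  rw [h4] at hmono ⊢
  have hpt : ∀ p : Matrix (Fin d) (Fin d) ℝ × Matrix (Fin d) (Fin d) ℝ,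
      ENNReal.ofReal (Real.exp (((f p.1 - f p.2) ^ 2 / (4 * G)) ^ (1 / (2 * a)))) ≤
        φ p.1 + φ p.2 := by
    intro p
    rcases le_total (f p.1 ^ 2) (f p.2 ^ 2) with hle | hle
    · refine le_trans (hmono (f p.1 - f p.2) (f p.2) ?_) le_add_self
      rw [div_le_div_iff₀ (by positivity) hG0]
      nlinarith [sq_nonneg (f p.1 + f p.2)]
    · refine le_trans (hmono (f p.1 - f p.2) (f p.1) ?_) le_self_add
      rw [div_le_div_iff₀ (by positivity) hG0]
      nlinarith [sq_nonneg (f p.1 + f p.2)]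
  refine (lintegral_mono hpt).trans ?_
  have hφ1 : Measurable fun p : Matrix (Fin d) (Fin d) ℝ × Matrix (Fin d) (Fin d) ℝ => φ p.1 :=
    hφm.comp measurable_fst
  rw [lintegral_add_left hφ1, measurePreserving_fst.lintegral_comp hφm, measurePreserving_snd.lintegral_comp hφm]
  calc (∫⁻ M, φ M ∂D) + ∫⁻ M, φ M ∂D ≤ 2 + 2 := add_le_add hone hone
    _ = 4 := by norm_num

theorem ae_mulVec_eq_of_spectralNorm_eq_zero (h : HasPSDMean D S)
    (h0 : spectralNorm (covMatrix D S u) = 0) : ∀ᵐ M ∂D, M *ᵥ u = S *ᵥ u := by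
  have hz : covMatrix D S u = 0 := by
    have := norm_eq_zero.1 h0
    simpa using this
  have hi : ∀ i, ∀ᵐ M ∂D, ((M - S) *ᵥ u) i = 0 := by
    intro i
    have hint : ∫ M, ((M - S) *ᵥ u) i * ((M - S) *ᵥ u) i ∂D = 0 := congrFun (congrFun hz i) i
    have := (integral_eq_zero_iff_of_nonneg (fun M => mul_self_nonneg (((M - S) *ᵥ u) i))
      ((memLp_centered h u i).integrable_mul (memLp_centered h u i))).1 hint
    filter_upwards [this] with M hM
    exact mul_self_eq_zero.1 hM
  filter_upwards [ae_all_iff.2 hi] with M hM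
  rw [← sub_eq_zero, ← Matrix.sub_mulVec]
  exact funext hM

end

section

/-! ### Independence of the blocks -/

/-- Distinct samples enter through an injective indexing by block, place and parity, so selecting
coordinates yields a product law. Currying groups it first into pairs, to which `f` is applied, then
into blocks. -/
theorem map_infinitePi_eval_pairs {X Y : Type*} [MeasurableSpace X] [MeasurableSpace Y]
    (P : Measure X) [IsProbabilityMeasure P] {f : X × X → Y} (hf : Measurable f) {k b N : ℕ}
    (e : Fin k → Fin b → Fin 2 → Fin N)
    (he : Function.Injective fun p : (_ : (_ : Fin k) × Fin b) × Fin 2 => e p.1.1 p.1.2 p.2) :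
    (Measure.pi fun _ : Fin N => P).map
        (fun ω j i => f (ω (e j i 1), ω (e j i 0))) =
      Measure.pi fun _ : Fin k => Measure.pi fun _ : Fin b => (P.prod P).map f := by
  have : IsProbabilityMeasure ((P.prod P).map f) :=
    Measure.isProbabilityMeasure_map hf.aemeasurable
  set Q := (P.prod P).map f with hQ
  simp only [← Measure.infinitePi_eq_pi]
  set g : (Fin 2 → X) → Y := fun c => f (c 1, c 0) with hg
  have hgm : Measurable g :=
    hf.comp ((measurable_pi_apply 1).prodMk (measurable_pi_apply 0))
  have hgmap : (Measure.infinitePi fun _ : Fin 2 => P).map g = Q := by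
    rw [hQ, ← Measure.infinitePi_map_eval_prod (P := fun _ : Fin 2 => P)
      (show (1 : Fin 2) ≠ 0 by decide), Measure.map_map hf (by fun_prop)]
    rfl
  have h1 := Measure.map_infinitePi_infinitePi_of_inj (P := fun _ : Fin N => P) he
  have h2 := Measure.infinitePi_map_piCurry
    (fun (_ : (_ : Fin k) × Fin b) (_ : Fin 2) => P)
  have h3 := Measure.infinitePi_map_pi
    (fun _ : (_ : Fin k) × Fin b => Measure.infinitePi fun _ : Fin 2 => P)
    (f := fun _ => g) (fun _ => hgm)
  have h4 := Measure.infinitePi_map_piCurry (fun (_ : Fin k) (_ : Fin b) => Q)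
  rw [hgmap] at h3
  rw [← h4, ← h3, ← h2, ← h1]
  have hm1 : Measurable fun (ω : Fin N → X) (p : (_ : (_ : Fin k) × Fin b) × Fin 2) =>
      ω (e p.1.1 p.1.2 p.2) := by fun_prop
  have hm3 : Measurable fun (z : ((_ : Fin k) × Fin b) → Fin 2 → X) p => g (z p) := by fun_prop
  rw [Measure.map_map (MeasurableEquiv.measurable _) hm1, Measure.map_map hm3 (by fun_prop),
    Measure.map_map (MeasurableEquiv.measurable _) (by fun_prop)]
  rfl

/-- Union bound over the sets of `m` indices. -/
theorem measure_card_ge_le {Y : Type*} [MeasurableSpace Y] (ρ : Measure Y)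
    [IsProbabilityMeasure ρ] (T : Set Y) (k m : ℕ) :
    (Measure.pi fun _ : Fin k => ρ) {y | m ≤ Nat.card {j // y j ∈ T}} ≤ (k * ρ T) ^ m := by
  classical
  have hsub : {y : Fin k → Y | m ≤ Nat.card {j // y j ∈ T}} ⊆
      ⋃ J ∈ Finset.powersetCard m (Finset.univ : Finset (Fin k)),
        Set.pi Set.univ fun j => if j ∈ J then T else Set.univ := by
    intro y hy
    have hy' : m ≤ Nat.card {j // y j ∈ T} := hy
    rw [Nat.card_eq_fintype_card, Fintype.card_subtype] at hy'
    obtain ⟨J, hJ, hJm⟩ := Finset.exists_subset_card_eq hy'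
    simp only [Set.mem_iUnion]
    refine ⟨J, by simp [Finset.mem_powersetCard, hJm], fun j _ => ?_⟩
    by_cases hj : j ∈ J
    · simpa [hj] using hJ hj
    · simp [hj]
  refine (measure_mono hsub).trans ((measure_biUnion_finset_le _ _).trans ?_)
  calc ∑ J ∈ Finset.powersetCard m (Finset.univ : Finset (Fin k)),
        (Measure.pi fun _ : Fin k => ρ) (Set.pi Set.univ fun j => if j ∈ J then T else Set.univ)
      = ∑ _J ∈ Finset.powersetCard m (Finset.univ : Finset (Fin k)), ρ T ^ m := by
        refine Finset.sum_congr rfl fun J hJ => ?_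
        rw [Measure.pi_pi]
        have : ∀ j, ρ (if j ∈ J then T else Set.univ) = if j ∈ J then ρ T else 1 := fun j => by
          split_ifs <;> simp
        simp only [this]
        rw [Finset.prod_ite_mem, Finset.univ_inter, Finset.prod_const,
          (Finset.mem_powersetCard.1 hJ).2]
    _ = (k.choose m : ENNReal) * ρ T ^ m := by
        rw [Finset.sum_const, Finset.card_powersetCard, Finset.card_univ, Fintype.card_fin,
          nsmul_eq_mul]
    _ ≤ (k : ENNReal) ^ m * ρ T ^ m := by
        gcongr
        exact_mod_cast Nat.choose_le_pow k m
    _ = _ := (mul_pow _ _ _).symm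

/-- A lower bound for the measure of a set in a product, which need not be measurable. -/
theorem le_prod_of_forall_section {X Y : Type*} [MeasurableSpace X] [MeasurableSpace Y]
    (μ : Measure X) (P : Measure Y) [IsProbabilityMeasure μ] [IsProbabilityMeasure P]
    (s : Set (X × Y)) (G : Set X) {z : ℝ} (hz0 : 0 ≤ z) (hz1 : z ≤ 1)
    (hG : μ Gᶜ ≤ ENNReal.ofReal (z / 2))
    (hs : ∀ x ∈ G, P {y | (x, y) ∉ s} ≤ ENNReal.ofReal (z / 2)) :
    ENNReal.ofReal (1 - z) ≤ (μ.prod P) s := by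
  -- Measurable hulls allow Fubini's theorem: the hull of `s` has the outer measure of `s` and
  -- larger sections, and off `U` those are nearly full.
  set U := toMeasurable μ Gᶜ with hU
  set T := toMeasurable (μ.prod P) s with hT
  have hTm : MeasurableSet T := measurableSet_toMeasurable _ _
  have hUm : MeasurableSet U := measurableSet_toMeasurable _ _
  have hsec : ∀ x ∈ Uᶜ, ENNReal.ofReal (1 - z / 2) ≤ P (Prod.mk x ⁻¹' T) := by
    intro x hx
    have hxG : x ∈ G := by
      by_contra h
      exact hx (subset_toMeasurable μ Gᶜ h)
    have h1 : P {y | (x, y) ∉ T} ≤ ENNReal.ofReal (z / 2) :=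
      (measure_mono fun y (hy : (x, y) ∉ T) (h : (x, y) ∈ s) =>
        hy (subset_toMeasurable (μ.prod P) s h)).trans (hs x hxG)
    have hm : MeasurableSet (Prod.mk x ⁻¹' T) := measurable_prodMk_left hTm
    have h2 := prob_compl_eq_one_sub (μ := P) hm.compl
    rw [compl_compl] at h2
    rw [h2, ENNReal.ofReal_sub _ (by positivity), ENNReal.ofReal_one]
    exact tsub_le_tsub_left h1 _
  have hUc : ENNReal.ofReal (1 - z / 2) ≤ μ Uᶜ := by
    rw [prob_compl_eq_one_sub hUm, ENNReal.ofReal_sub _ (by positivity), ENNReal.ofReal_one, hU,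
      measure_toMeasurable]
    exact tsub_le_tsub_left hG _
  rw [← measure_toMeasurable s, Measure.prod_apply hTm]
  calc ENNReal.ofReal (1 - z) ≤ ENNReal.ofReal (1 - z / 2) * ENNReal.ofReal (1 - z / 2) := by
        rw [← ENNReal.ofReal_mul (by linarith)]
        exact ENNReal.ofReal_le_ofReal (by nlinarith)
    _ ≤ ENNReal.ofReal (1 - z / 2) * μ Uᶜ := by gcongr
    _ = ∫⁻ _ in Uᶜ, ENNReal.ofReal (1 - z / 2) ∂μ := by rw [setLIntegral_const]
    _ ≤ ∫⁻ x in Uᶜ, P (Prod.mk x ⁻¹' T) ∂μ := setLIntegral_mono' hUm.compl hsec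
    _ ≤ ∫⁻ x, P (Prod.mk x ⁻¹' T) ∂μ := setLIntegral_le_lintegral _ _

/-! ### The block eigenvalues as functions of Gram matrices -/

variable {d B k : ℕ}

/-- The differences of consecutive samples in the block `j`. -/
def blockDiff (k : ℕ) (u : Fin d → ℝ) (ω : Fin B → Matrix (Fin d) (Fin d) ℝ) (j : Fin k)
    (i : Fin (blockSize B k)) : Fin d → ℝ :=
  ω ⟨2 * (j.val * blockSize B k + i.val) + 1, pair_index_lt j i⟩ *ᵥ u -
    ω ⟨2 * (j.val * blockSize B k + i.val), (Nat.lt_succ_self _).trans (pair_index_lt j i)⟩ *ᵥ u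

theorem map_blockDiff (D : Measure (Matrix (Fin d) (Fin d) ℝ)) [IsProbabilityMeasure D]
    (u : Fin d → ℝ) :
    (Measure.pi fun _ : Fin B => D).map (blockDiff k u) =
      Measure.pi fun _ : Fin k => Measure.pi fun _ : Fin (blockSize B k) => diffLaw D u := by
  have hlt : ∀ (j : Fin k) (i : Fin (blockSize B k)) (c : Fin 2),
      2 * (j.val * blockSize B k + i.val) + c.val < B := fun j i c => by
    have := pair_index_lt j i
    omega
  refine map_infinitePi_eval_pairs D (measurable_diff u) (fun j i c => ⟨_, hlt j i c⟩) ?_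
  rintro ⟨⟨j, i⟩, c⟩ ⟨⟨j', i'⟩, c'⟩ h
  simp only [Fin.mk.injEq] at h
  have hc : c.val = c'.val := by omega
  have hji : j.val * blockSize B k + i.val = j'.val * blockSize B k + i'.val := by omega
  have hb : 0 < blockSize B k := i.pos
  have hj : j.val = j'.val := by
    have h1 := congrArg (· / blockSize B k) hji
    simp only [Nat.mul_comm _ (blockSize B k), Nat.mul_add_div hb, Nat.div_eq_of_lt i.isLt,
      Nat.div_eq_of_lt i'.isLt, add_zero] at h1
    exact h1
  have hi : i.val = i'.val := by rw [hj] at hji; omega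
  obtain rfl := Fin.ext hc
  obtain rfl := Fin.ext hj
  obtain rfl := Fin.ext hi
  rfl

theorem measurable_blockDiff (u : Fin d → ℝ) :
    Measurable (blockDiff (B := B) k u) := by
  refine measurable_pi_iff.2 fun j => measurable_pi_iff.2 fun i => ?_
  exact ((measurable_mulVec u).comp (measurable_pi_apply _)).sub
    ((measurable_mulVec u).comp (measurable_pi_apply _))

open scoped Pointwise in
theorem topEigenvalue_smul {c : ℝ} (hc : 0 < c) (M : Matrix (Fin d) (Fin d) ℝ) :
    topEigenvalue (c • M) = c * topEigenvalue M := by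
  have h := spectrum.unit_smul_eq_smul M (Units.mk0 c hc.ne')
  have h' : spectrum ℝ (c • M) = c • spectrum ℝ M := h
  rw [topEigenvalue, h', Real.sSup_smul_of_nonneg hc.le, smul_eq_mul, topEigenvalue]

theorem blockMatrix_mul_transpose (u : Fin d → ℝ) (ω : Fin B → Matrix (Fin d) (Fin d) ℝ)
    (j : Fin k) :
    blockMatrix k (fun i => ω i *ᵥ u) j * (blockMatrix k (fun i => ω i *ᵥ u) j)ᵀ =
      gram (blockDiff k u ω j) := by
  ext l m
  simp only [Matrix.mul_apply, Matrix.transpose_apply, gram, Matrix.sum_apply,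
    Matrix.vecMulVec_apply]
  rfl

theorem blockEigenvalue_eq (u : Fin d → ℝ) (ω : Fin B → Matrix (Fin d) (Fin d) ℝ) (j : Fin k)
    (hb : 0 < blockSize B k) :
    blockEigenvalue k (fun i => ω i *ᵥ u) j =
      1 / (2 * (blockSize B k : ℝ)) * topEigenvalue (gram (blockDiff k u ω j)) := by
  rw [blockEigenvalue, blockMatrix_mul_transpose, topEigenvalue_smul (by positivity)]

theorem topEigenvalue_zero (hd : 0 < d) : topEigenvalue (0 : Matrix (Fin d) (Fin d) ℝ) = 0 := by
  have : Nonempty (Fin d) := ⟨⟨0, hd⟩⟩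
  rw [topEigenvalue, spectrum.zero_eq, csSup_singleton]

end

section

/-! ### Utility of the stability-based histogram -/

section Utility

variable {k : ℕ} {ε δ : ℝ}

/-- At least `19/20` of the points lie in at most three bins, so one bin has frequency at least
`19/60`. Noise of size `1/20` leaves it above the threshold with value at least `4/15`. A bin
outside `W` has frequency at most `1/20`, hence value at most `1/10`, and cannot win. -/
theorem topBinEndpoint_stabilityHistogram (hk : 0 < k) {x : Fin k → ℝ} {W : Finset (Option ℤ)}
    (hW : W.card ≤ 3)
    (hbad : (Nat.card {j : Fin k // ∀ β ∈ W, x j ∉ geomBin β} : ℝ) ≤ k / 20)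
    (hthr : 2 * Real.log (2 / δ) / (ε * k) + 1 / k ≤ 1 / 10) {η : Option ℤ → ℝ}
    (hη : ∀ β, frequency x (geomBin β) ≠ 0 → |2 / (ε * k) * η β| ≤ 1 / 20) :
    ∃ β ∈ W, topBinEndpoint (stabilityHistogram geomBin ε δ x η) = some (leftEnd β) := by
  classical
  have hk' : (0 : ℝ) < k := by exact_mod_cast hk
  set h := stabilityHistogram geomBin ε δ x η with hh
  have hcount : (k : ℝ) ≤ ∑ β ∈ W, (Nat.card {j : Fin k // x j ∈ geomBin β} : ℝ) +
      (Nat.card {j : Fin k // ∀ β ∈ W, x j ∉ geomBin β} : ℝ) := by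
    simp only [Nat.card_eq_fintype_card, Fintype.card_subtype]
    have hcover : (Finset.univ : Finset (Fin k)) ⊆
        (W.biUnion fun β => Finset.univ.filter fun j => x j ∈ geomBin β) ∪
          Finset.univ.filter fun j => ∀ β ∈ W, x j ∉ geomBin β := by
      intro j _
      simp only [Finset.mem_union, Finset.mem_biUnion, Finset.mem_filter, Finset.mem_univ,
        true_and]
      by_cases hj : ∃ β ∈ W, x j ∈ geomBin β
      · exact Or.inl hj
      · push Not at hj; exact Or.inr hj
    have h1 := (Finset.card_le_card hcover).trans ((Finset.card_union_le _ _).trans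
      (Nat.add_le_add_right Finset.card_biUnion_le _))
    rw [Finset.card_univ, Fintype.card_fin] at h1
    exact_mod_cast h1
  obtain ⟨β₀, hβ₀, hfreq⟩ : ∃ β ∈ W, 19 / 60 ≤ frequency x (geomBin β) := by
    by_contra hcon
    push Not at hcon
    have h1 : ∑ β ∈ W, (Nat.card {j : Fin k // x j ∈ geomBin β} : ℝ) < 19 / 20 * k := by
      rcases W.eq_empty_or_nonempty with rfl | hne
      · simpa using hk
      · calc ∑ β ∈ W, (Nat.card {j : Fin k // x j ∈ geomBin β} : ℝ)
            < ∑ _β ∈ W, 19 / 60 * (k : ℝ) := by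
              refine Finset.sum_lt_sum_of_nonempty hne fun β hβ => ?_
              have := hcon β hβ
              rwa [frequency, div_lt_iff₀ hk'] at this
          _ = W.card * (19 / 60 * (k : ℝ)) := by rw [Finset.sum_const, nsmul_eq_mul]
          _ ≤ 3 * (19 / 60 * (k : ℝ)) := by
              gcongr
              exact_mod_cast hW
          _ = 19 / 20 * k := by ring
    linarith
  have hgood : 4 / 15 ≤ h β₀ := by
    have hne : frequency x (geomBin β₀) ≠ 0 := by linarith
    have h1 := (abs_le.1 (hη β₀ hne)).1
    have h2 : h β₀ = frequency x (geomBin β₀) + 2 / (ε * k) * η β₀ := by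
      rw [hh]
      simp only [stabilityHistogram]
      rw [if_neg hne, if_neg]
      push Not
      linarith
    rw [h2]; linarith
  have hout : ∀ β, β ∉ W → h β ≤ 1 / 10 := by
    intro β hβ
    rw [hh]
    simp only [stabilityHistogram]
    split_ifs with h1 h2
    · norm_num
    · norm_num
    · have h3 := (abs_le.1 (hη β h1)).2
      have h4 : frequency x (geomBin β) ≤ 1 / 20 := by
        rw [frequency, div_le_iff₀ hk']
        have : Nat.card {j : Fin k // x j ∈ geomBin β} ≤
            Nat.card {j : Fin k // ∀ β ∈ W, x j ∉ geomBin β} := by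
          refine Nat.card_le_card_of_injective
            (fun j => ⟨j.1, fun β' hβ' hj => hβ (by rwa [geomBin_unique j.2 hj])⟩) ?_
          intro j j' hjj
          exact Subtype.ext (congrArg (fun z => z.1) hjj)
        have : (Nat.card {j : Fin k // x j ∈ geomBin β} : ℝ) ≤
            Nat.card {j : Fin k // ∀ β ∈ W, x j ∉ geomBin β} := by exact_mod_cast this
        linarith
      linarith
  obtain ⟨β₁, hβ₁, hmax⟩ := W.exists_max_image h ⟨β₀, hβ₀⟩
  have hex : ∃ β, IsTopBin h β := by
    refine ⟨β₁, by linarith [hmax β₀ hβ₀], fun β => ?_⟩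
    by_cases hβ : β ∈ W
    · exact hmax β hβ
    · linarith [hmax β₀ hβ₀, hout β hβ]
  refine ⟨hex.choose, ?_, ?_⟩
  · by_contra hcon
    linarith [hout _ hcon, hex.choose_spec.2 β₀]
  · rw [topBinEndpoint, dif_pos hex]

/-- There are infinitely many bins, so a union bound over all is impossible. It suffices to bound
the noise on `W` and on the bins of the points missing `W`, which include every occupied bin. -/
theorem noiseLaw_occupied_le (hk : 0 < k) (hε : 0 < ε) {x : Fin k → ℝ} (hx : ∀ j, 0 ≤ x j)
    {W : Finset (Option ℤ)} (hW : W.card ≤ 3) {b : ℝ}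
    (hbad : (Nat.card {j : Fin k // ∀ β ∈ W, x j ∉ geomBin β} : ℝ) ≤ b) :
    noiseLaw {η | ¬ ∀ β, frequency x (geomBin β) ≠ 0 → |2 / (ε * k) * η β| ≤ 1 / 20} ≤
      ENNReal.ofReal ((b + 3) * Real.exp (-(ε * k / 40))) := by
  classical
  have hk' : (0 : ℝ) < k := by exact_mod_cast hk
  choose bin hbin using fun j => exists_mem_geomBin (hx j)
  set O : Finset (Option ℤ) :=
    W ∪ (Finset.univ.filter fun j => ∀ β ∈ W, x j ∉ geomBin β).image bin with hO
  have hcard : (O.card : ℝ) ≤ b + 3 := by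
    have h1 : O.card ≤ W.card + (Finset.univ.filter fun j => ∀ β ∈ W, x j ∉ geomBin β).card :=
      (Finset.card_union_le _ _).trans (Nat.add_le_add_left Finset.card_image_le _)
    rw [Nat.card_eq_fintype_card, Fintype.card_subtype] at hbad
    have h2 : (O.card : ℝ) ≤ W.card +
        (Finset.univ.filter fun j => ∀ β ∈ W, x j ∉ geomBin β).card := by exact_mod_cast h1
    have h3 : (W.card : ℝ) ≤ 3 := by exact_mod_cast hW
    linarith
  have hsub : {η : Option ℤ → ℝ |
      ¬ ∀ β, frequency x (geomBin β) ≠ 0 → |2 / (ε * k) * η β| ≤ 1 / 20} ⊆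
      ⋃ β ∈ O, {η | ε * k / 40 ≤ |η β|} := by
    intro η hη
    have hη' : ¬ ∀ β, frequency x (geomBin β) ≠ 0 → |2 / (ε * k) * η β| ≤ 1 / 20 := hη
    push Not at hη'
    obtain ⟨β, hβ, hlt⟩ := hη'
    simp only [Set.mem_iUnion]
    refine ⟨β, ?_, ?_⟩
    · have hne : Nat.card {j : Fin k // x j ∈ geomBin β} ≠ 0 := fun h0 => hβ (by
        rw [frequency, h0]; simp)
      obtain ⟨⟨j, hj⟩⟩ := (Nat.card_ne_zero.1 hne).1
      by_cases hβW : β ∈ W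
      · exact Finset.mem_union_left _ hβW
      · refine Finset.mem_union_right _ (Finset.mem_image.2 ⟨j, ?_, geomBin_unique (hbin j) hj⟩)
        simp only [Finset.mem_filter, Finset.mem_univ, true_and]
        exact fun β' hβ' hj' => hβW (by rwa [geomBin_unique hj hj'])
    · change ε * k / 40 ≤ |η β|
      rw [abs_mul, abs_of_pos (by positivity : 0 < 2 / (ε * k)), div_mul_eq_mul_div,
        lt_div_iff₀ (by positivity)] at hlt
      linarith
  refine (measure_mono hsub).trans ((measure_biUnion_finset_le _ _).trans ?_)
  calc ∑ β ∈ O, noiseLaw {η | ε * k / 40 ≤ |η β|}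
      ≤ ∑ _β ∈ O, ENNReal.ofReal (Real.exp (-(ε * k / 40))) :=
        Finset.sum_le_sum fun β _ => noiseLaw_le_abs β _ (by positivity)
    _ = ENNReal.ofReal (O.card * Real.exp (-(ε * k / 40))) := by
        rw [Finset.sum_const, nsmul_eq_mul, ENNReal.ofReal_mul (by positivity),
          ENNReal.ofReal_natCast]
    _ ≤ _ := ENNReal.ofReal_le_ofReal (by gcongr)

/-- The bins that contain the points close to `Λ`. -/
def nearBins (Λ : ℝ) : Finset (Option ℤ) :=
  {some (⌊4 * Real.logb 2 Λ⌋ - 1), some ⌊4 * Real.logb 2 Λ⌋, some (⌊4 * Real.logb 2 Λ⌋ + 1)}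

theorem card_nearBins_le (Λ : ℝ) : (nearBins Λ).card ≤ 3 := Finset.card_le_three

/-- Since `(9/8)⁴ ≤ 2` and `(7/8)⁴ ≥ 1/2`, the numbers `4 log₂ y` and `4 log₂ Λ` differ by less than
`1`, and their floors by at most `1`. -/
theorem exists_mem_nearBins {Λ y : ℝ} (hΛ : 0 < Λ) (h1 : 7 / 8 * Λ < y) (h2 : y < 9 / 8 * Λ) :
    ∃ β ∈ nearBins Λ, y ∈ geomBin β := by
  have hy : 0 < y := lt_trans (by positivity) h1
  set t := 4 * Real.logb 2 Λ with ht
  have hlog : ∀ c : ℝ, 0 < c → 4 * Real.logb 2 (c * Λ) = Real.logb 2 (c ^ 4) + t := by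
    intro c hc
    rw [Real.logb_mul hc.ne' hΛ.ne', Real.logb_pow]; push_cast; ring
  have hlo : t - 1 < 4 * Real.logb 2 y := by
    have h3 : Real.logb 2 (7 / 8 * Λ) < Real.logb 2 y :=
      Real.logb_lt_logb one_lt_two (by positivity) h1
    have h4 := hlog (7 / 8) (by norm_num)
    have h5 : (-1 : ℝ) ≤ Real.logb 2 ((7 / 8) ^ 4) := by
      rw [Real.le_logb_iff_rpow_le one_lt_two (by norm_num), Real.rpow_neg_one]; norm_num
    linarith
  have hhi : 4 * Real.logb 2 y < t + 1 := by
    have h3 : Real.logb 2 y < Real.logb 2 (9 / 8 * Λ) := Real.logb_lt_logb one_lt_two hy h2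
    have h4 := hlog (9 / 8) (by norm_num)
    have h5 : Real.logb 2 ((9 / 8) ^ 4) ≤ 1 := by
      rw [Real.logb_le_iff_le_rpow one_lt_two (by norm_num), Real.rpow_one]; norm_num
    linarith
  refine ⟨some ⌊4 * Real.logb 2 y⌋, ?_, (geomBin_some_iff _ _).2
    ⟨hy, Int.floor_le _, Int.lt_floor_add_one _⟩⟩
  have h3 : ⌊t⌋ - 1 ≤ ⌊4 * Real.logb 2 y⌋ := by
    rw [Int.le_floor]; push_cast; linarith [Int.floor_le t]
  have h4 : ⌊4 * Real.logb 2 y⌋ < ⌊t⌋ + 2 := by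
    rw [Int.floor_lt]; push_cast; linarith [Int.lt_floor_add_one t]
  simp only [nearBins, ← ht, Finset.mem_insert, Finset.mem_singleton, Option.some.injEq]
  omega

/-- The exponent `m` of such a bin satisfies `t - 2 ≤ m ≤ t + 1` with `t = 4 log₂ Λ`, and `2^(2/4) =
√2`. -/
theorem leftEnd_mem_of_mem_nearBins {Λ : ℝ} (hΛ : 0 < Λ) {β : Option ℤ} (hβ : β ∈ nearBins Λ) :
    leftEnd β ∈ Set.Icc (1 / √2 * Λ) (√2 * Λ) := by
  set t := 4 * Real.logb 2 Λ with ht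
  obtain ⟨m, rfl, hm1, hm2⟩ : ∃ m : ℤ, β = some m ∧ ⌊t⌋ - 1 ≤ m ∧ m ≤ ⌊t⌋ + 1 := by
    simp only [nearBins, ← ht, Finset.mem_insert, Finset.mem_singleton] at hβ
    rcases hβ with h | h | h
    · exact ⟨_, h, le_rfl, by omega⟩
    · exact ⟨_, h, by omega, by omega⟩
    · exact ⟨_, h, by omega, le_rfl⟩
  have hm1' : (⌊t⌋ : ℝ) - 1 ≤ m := by exact_mod_cast hm1
  have hm2' : (m : ℝ) ≤ ⌊t⌋ + 1 := by exact_mod_cast hm2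
  have hf1 := Int.floor_le t
  have hf2 := Int.lt_floor_add_one t
  have hΛ2 : Λ = (2 : ℝ) ^ Real.logb 2 Λ := (Real.rpow_logb two_pos (by norm_num) hΛ).symm
  have hs : √2 = (2 : ℝ) ^ (1 / 2 : ℝ) := Real.sqrt_eq_rpow 2
  simp only [leftEnd]
  constructor
  · rw [hs, one_div, ← Real.rpow_neg two_pos.le]
    nth_rewrite 1 [hΛ2]
    rw [← Real.rpow_add two_pos]
    exact Real.rpow_le_rpow_of_exponent_le one_le_two (by linarith)
  · rw [hs]
    nth_rewrite 1 [hΛ2]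
    rw [← Real.rpow_add two_pos]
    exact Real.rpow_le_rpow_of_exponent_le one_le_two (by linarith)

end Utility

end

section

/-! ### The sample size -/

/-- The constant of the sample-size condition. -/
def sampleConst (C₁ a : ℝ) : ℝ :=
  12 * C₁ * (4 * √((4 * a) ^ (4 * a))) / (1 / 4) ^ (1 + 2 * a) +
    12 * 2048 * 21 ^ (1 + 2 * a) * C₁ +
    300 * (1 + (4 * a) ^ (4 * a)) / (1 / 4) ^ (1 + 2 * a)

theorem sampleConst_pos {C₁ a : ℝ} (hC₁ : 0 < C₁) (ha : 0 < a) : 0 < sampleConst C₁ a := by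
  unfold sampleConst; positivity

-- Translates the sample-size condition into what the block analysis needs: nonempty blocks, a
-- deviation level `s` for which truncation and concentration work, and a failure probability per
-- block of at most `exp (-2) / k`.
set_option maxHeartbeats 2000000 in
theorem sample_size_bounds {C₁ a K ε Lg : ℝ} {d B k : ℕ} (hC₁ : 1 ≤ C₁) (ha : 0 < a)
    (hε : 0 < ε) (hε1 : ε ≤ 1) (hLg : 2 / 3 ≤ Lg) (hd : 0 < d)
    (hB : 2 ≤ B)
    (hk : k = ⌈C₁ * Lg / ε⌉₊) (hK : 1 ≤ 4 * (4 * a) ^ (4 * a) * (2 * K ^ 2) ^ 2)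
    (hsize : sampleConst C₁ a * (K ^ 2 * d * Real.log (B * d * Lg / ε) ^ (1 + 2 * a) * Lg / ε)
      ≤ B) :
    ∃ s : ℝ, 0 < s ∧ 0 < blockSize B k ∧
      4096 * (4 * a) ^ (4 * a) * (2 * K ^ 2) ^ 2 * d * Real.exp (-s) ≤ 1 ∧
      1024 * (d * (2 * K ^ 2) * s ^ (2 * a)) * s ≤ blockSize B k ∧
      k * (7 * blockSize B k * d * Real.exp (-s)) ≤ Real.exp (-2) := by
  set M := (4 * a) ^ (4 * a) with hM
  have hM0 : 0 < M := by positivity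
  set p₀ : ℝ := (1 / 4) ^ (1 + 2 * a) with hp₀
  have hp₀0 : 0 < p₀ := by positivity
  set C := sampleConst C₁ a with hC
  -- The three summands of the constant serve separate ends: nonempty blocks, `b` large compared
  -- with `d κ s^(1 + 2a)`, and `K` bounded polynomially in `Q`. The number `p₀` bounds `(log Q)^(1
  -- + 2a)` from below, since `Q ≥ 4/3`.
  have hCe : C = 12 * C₁ * (4 * √M) / p₀ + 12 * 2048 * 21 ^ (1 + 2 * a) * C₁ +
    300 * (1 + M) / p₀ := rfl
  have hCa : 12 * C₁ * (4 * √M) / p₀ ≤ C := by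
    have h1 : 0 ≤ 12 * 2048 * (21 : ℝ) ^ (1 + 2 * a) * C₁ := by positivity
    have h2 : 0 ≤ 300 * (1 + M) / p₀ := by positivity
    linarith
  have hCb : 12 * 2048 * 21 ^ (1 + 2 * a) * C₁ ≤ C := by
    have h1 : 0 ≤ 12 * C₁ * (4 * √M) / p₀ := by positivity
    have h2 : 0 ≤ 300 * (1 + M) / p₀ := by positivity
    linarith
  have hCc : 300 * (1 + M) / p₀ ≤ C := by
    have h1 : 0 ≤ 12 * 2048 * (21 : ℝ) ^ (1 + 2 * a) * C₁ := by positivity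
    have h2 : 0 ≤ 12 * C₁ * (4 * √M) / p₀ := by positivity
    linarith
  have hC0 : 0 < C := sampleConst_pos (by linarith) ha
  have hd' : (1 : ℝ) ≤ d := by exact_mod_cast hd
  have hB' : (2 : ℝ) ≤ B := by exact_mod_cast hB
  have hLg0 : 0 < Lg := by linarith
  have hLε : 2 / 3 ≤ Lg / ε := by
    rw [le_div_iff₀ hε]; nlinarith
  set r := Lg / ε with hr
  set Q := B * d * Lg / ε with hQ
  have hQr : Q = B * d * r := by rw [hQ, hr, mul_div_assoc]
  have hBQ : B ≤ 3 / 2 * Q := by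
    have h1 : 1 * (2 / 3) ≤ d * r := mul_le_mul hd' hLε (by norm_num) (by linarith)
    have h2 : B * (1 * (2 / 3)) ≤ B * (d * r) := mul_le_mul_of_nonneg_left h1 (by linarith)
    rw [hQr, mul_assoc (B : ℝ)]; linarith
  have hBd0 : (0 : ℝ) < B * d := by positivity
  have hBdQ : B * d ≤ 3 / 2 * Q := by
    have h1 := mul_le_mul_of_nonneg_left hLε hBd0.le
    rw [hQr]; linarith
  have hBr : 4 / 3 ≤ B * r := by
    have h1 : 2 * (2 / 3) ≤ B * r := mul_le_mul hB' hLε (by norm_num) (by linarith)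
    linarith
  have hdQ' : (d : ℝ) * (4 / 3) ≤ Q := by
    rw [hQr, show (B : ℝ) * d * r = d * (B * r) by ring]
    exact mul_le_mul_of_nonneg_left hBr (by linarith)
  have hdQ : d ≤ Q := by linarith
  have hQ1 : 4 / 3 ≤ Q := by linarith
  have hQ0 : 0 < Q := by linarith
  set l := Real.log Q with hl
  have hl4 : 1 / 4 ≤ l := by
    have h1 := Real.one_sub_inv_le_log_of_pos hQ0
    have h2 : Q⁻¹ ≤ (4 / 3)⁻¹ := by gcongr
    norm_num at h2
    linarith
  have hl0 : 0 < l := by linarith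
  set P := l ^ (1 + 2 * a) with hP
  have hPp : p₀ ≤ P := by rw [hp₀, hP]; gcongr
  have hP0 : 0 < P := hp₀0.trans_le hPp
  -- The sample-size condition is useful only because `K` cannot be small; otherwise it would not
  -- force `B` to be large.
  have hK2 : 1 ≤ 4 * √M * K ^ 2 := by
    have h1 : 1 ≤ (4 * √M * K ^ 2) ^ 2 := by
      rw [mul_pow, mul_pow, Real.sq_sqrt hM0.le]; linarith only [hK]
    exact (one_le_sq_iff₀ (by positivity)).1 h1
  have hKpos : 0 < K ^ 2 := by
    by_contra h
    have : K ^ 2 = 0 := le_antisymm (not_lt.1 h) (sq_nonneg K)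
    rw [this] at hK2; norm_num at hK2
  have hsize' : C * (K ^ 2 * d * P) * r ≤ B := by
    have : C * (K ^ 2 * d * P) * r = C * (K ^ 2 * d * P * Lg / ε) := by rw [hr]; ring
    rw [this]; exact hsize
  have hr0 : 0 < r := by linarith
  have hk1 : 1 ≤ k := by
    rw [hk]; exact Nat.ceil_pos.2 (by positivity)
  have hk0 : (0 : ℝ) < k := by exact_mod_cast hk1
  have hkle : (k : ℝ) ≤ 3 * C₁ * r := by
    have h1 := Nat.ceil_lt_add_one (a := C₁ * Lg / ε) (by positivity)
    rw [← hk, mul_div_assoc, ← hr] at h1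
    have h2 : 1 * (2 / 3) ≤ C₁ * r := mul_le_mul hC₁ hLε (by norm_num) (by linarith)
    linarith
  have hCpK : C * p₀ * K ^ 2 ≤ 3 / 2 * B := by
    have h1 : C * (K ^ 2 * 1 * p₀) * (2 / 3) ≤ C * (K ^ 2 * d * P) * r := by gcongr
    linarith
  -- A lower bound for `B/(2k)`, as `k ≤ 3 C₁ r`. Once `y ≥ 2`, rounding down to the block size
  -- loses at most half of it.
  set y := C * (K ^ 2 * d * P) / (6 * C₁) with hy
  have hy2 : 2 ≤ y := by
    rw [hy, le_div_iff₀ (by positivity)]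
    have h1 : 12 * C₁ * (4 * √M) ≤ C * p₀ := (div_le_iff₀ hp₀0).1 hCa
    calc 2 * (6 * C₁) = 12 * C₁ * 1 := by ring
      _ ≤ 12 * C₁ * (4 * √M * K ^ 2) := by gcongr
      _ = 12 * C₁ * (4 * √M) * (K ^ 2 * 1) := by ring
      _ ≤ C * p₀ * (K ^ 2 * d) := by gcongr
      _ ≤ C * P * (K ^ 2 * d) := by gcongr
      _ = _ := by ring
  have hyB : y ≤ B / (2 * k) := by
    rw [hy, div_le_div_iff₀ (by positivity) (by positivity)]
    calc C * (K ^ 2 * d * P) * (2 * k) ≤ C * (K ^ 2 * d * P) * (2 * (3 * C₁ * r)) := by gcongr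
      _ = C * (K ^ 2 * d * P) * r * (6 * C₁) := by ring
      _ ≤ B * (6 * C₁) := by gcongr
  have hbfloor : (B : ℝ) / (2 * k) - 1 ≤ blockSize B k := by
    have h1 : B < 2 * k * (blockSize B k + 1) := Nat.lt_mul_div_succ B (by omega)
    have h2 : (B : ℝ) < 2 * k * (blockSize B k + 1) := by exact_mod_cast h1
    have h3 : (B : ℝ) / (2 * k) < blockSize B k + 1 := by
      rw [div_lt_iff₀ (by positivity)]; linarith
    linarith
  have hby : y / 2 ≤ blockSize B k := by linarith
  have hb0 : 0 < blockSize B k := by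
    have : (0 : ℝ) < blockSize B k := by linarith
    exact_mod_cast this
  have hbB : (k : ℝ) * blockSize B k ≤ B / 2 := by
    have h1 : blockSize B k * (2 * k) ≤ B := Nat.div_mul_le_self _ _
    have h2 : (blockSize B k : ℝ) * (2 * k) ≤ B := by exact_mod_cast h1
    linarith
  have hexp : Real.exp (-(21 * l)) = (Q ^ 21)⁻¹ := by
    rw [Real.exp_neg, hl, mul_comm, Real.exp_mul, Real.exp_log hQ0]
    congr 1
    exact_mod_cast Real.rpow_natCast Q 21
  -- Here `exp (-s) = Q^(-21)`. The exponent is large because only `Q ≥ 4/3` is known and a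
  -- numerical constant must be beaten by `Q^(-20)`.
  refine ⟨21 * l, by positivity, hb0, ?_, ?_, ?_⟩
  · rw [hexp, ← div_eq_mul_inv, div_le_one (by positivity)]
    have hE : 300 * (1 + M) ≤ C * p₀ := (div_le_iff₀ hp₀0).1 hCc
    have h1 : C * p₀ * (2 * K ^ 2) ≤ 9 / 2 * Q := by linarith
    have h2 : (300 * (1 + M)) ^ 2 * (2 * K ^ 2) ^ 2 ≤ (9 / 2 * Q) ^ 2 := by
      rw [← mul_pow]
      exact pow_le_pow_left₀ (by positivity)
        ((mul_le_mul_of_nonneg_right hE (by positivity)).trans h1) 2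
    have h3 : 4096 * M * (2 * K ^ 2) ^ 2 ≤ Q ^ 2 := by
      have h4 : 4096 * M * (81 / 4) ≤ (300 * (1 + M)) ^ 2 := by
        nlinarith only [sq_nonneg (M - 1), hM0]
      have h5 : 4096 * M * (81 / 4) * (2 * K ^ 2) ^ 2 ≤ (9 / 2 * Q) ^ 2 :=
        (mul_le_mul_of_nonneg_right h4 (by positivity)).trans h2
      linarith
    calc 4096 * M * (2 * K ^ 2) ^ 2 * d ≤ Q ^ 2 * Q := by gcongr
      _ = Q ^ 3 := by ring
      _ ≤ Q ^ 21 := pow_le_pow_right₀ (by linarith) (by norm_num)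
  · refine le_trans ?_ hby
    have h1 : (21 * l) ^ (2 * a) * (21 * l) = 21 ^ (1 + 2 * a) * P := by
      rw [hP, ← Real.mul_rpow (by norm_num) hl0.le, add_comm 1, Real.rpow_add (by positivity),
        Real.rpow_one]
    calc 1024 * (d * (2 * K ^ 2) * (21 * l) ^ (2 * a)) * (21 * l)
        = 2048 * d * K ^ 2 * ((21 * l) ^ (2 * a) * (21 * l)) := by ring
      _ = (12 * 2048 * 21 ^ (1 + 2 * a) * C₁) * (K ^ 2 * d * P) / (12 * C₁) := by
          rw [h1]; field_simp
      _ ≤ C * (K ^ 2 * d * P) / (12 * C₁) := by gcongr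
      _ = y / 2 := by rw [hy]; field_simp; ring
  · rw [hexp]
    have h1 : (k : ℝ) * (7 * blockSize B k * d * (Q ^ 21)⁻¹) ≤ 21 / 4 * (Q ^ 20)⁻¹ := by
      calc (k : ℝ) * (7 * blockSize B k * d * (Q ^ 21)⁻¹)
          = 7 * (k * blockSize B k) * d * (Q ^ 21)⁻¹ := by ring
        _ ≤ 7 * (B / 2) * d * (Q ^ 21)⁻¹ := by gcongr
        _ = 7 / 2 * (B * d) * (Q ^ 21)⁻¹ := by ring
        _ ≤ 7 / 2 * (3 / 2 * Q) * (Q ^ 21)⁻¹ := by gcongr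
        _ = 21 / 4 * (Q ^ 20)⁻¹ := by field_simp; norm_num
    have h2 : (Q ^ 20)⁻¹ ≤ ((4 / 3) ^ 20)⁻¹ := by gcongr
    have h3 : (1 / 9 : ℝ) ≤ Real.exp (-2) := by
      have h4 : Real.exp 2 ≤ 9 := by
        have h5 : Real.exp 2 = Real.exp 1 * Real.exp 1 := by rw [← Real.exp_add]; norm_num
        have h6 := Real.exp_one_lt_d9
        have h7 := Real.exp_pos 1
        nlinarith
      rw [Real.exp_neg, one_div]
      gcongr
    norm_num at h2
    linarith

/-! ### Utility -/

variable {d B : ℕ} {C₁ ε δ ζ : ℝ}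

theorem two_thirds_le_log (hδ : 0 < δ) (hζ : 0 < ζ) (hδζ : δ * ζ ≤ 1 / 2) :
    2 / 3 ≤ Real.log (1 / (δ * ζ)) := by
  have h1 : Real.log 2 ≤ Real.log (1 / (δ * ζ)) := by
    refine Real.log_le_log two_pos ?_
    rw [le_div_iff₀ (by positivity)]; linarith
  linarith [Real.log_two_gt_d9]

/-- Utility of the algorithm, given that few block eigenvalues miss the bins in `W`. -/
theorem utility_of_few_bad_blocks {D : Measure (Matrix (Fin d) (Fin d) ℝ)}
    [IsProbabilityMeasure D] (u : Fin d → ℝ) (hC₁ : 4000 ≤ C₁) (hε : 0 < ε) (hε1 : ε ≤ 1)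
    (hδ : δ ∈ Set.Ioo (0 : ℝ) 1) (hζ : ζ ∈ Set.Ioo (0 : ℝ) 1) (hδζ : δ * ζ ≤ 1 / 2)
    {W : Finset (Option ℤ)} (hW : W.card ≤ 3) {I : Set ℝ} (hWI : ∀ β ∈ W, leftEnd β ∈ I)
    (hdata : (Measure.pi fun _ : Fin B => D) {ω | ⌈Real.log (1 / (δ * ζ))⌉₊ ≤
      Nat.card {j : Fin (numBlocks C₁ ε δ ζ) // ∀ β ∈ W,
        blockEigenvalue (numBlocks C₁ ε δ ζ) (fun i => ω i *ᵥ u) j ∉ geomBin β}} ≤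
      ENNReal.ofReal (ζ / 2)) :
    ENNReal.ofReal (1 - ζ) ≤ ((Measure.pi fun _ : Fin B => D).prod noiseLaw)
      {ω | ∃ L : ℝ, privateTopEigenvalue C₁ ε δ ζ (fun i => (ω.1 i).mulVec u) ω.2 = some L ∧
        L ∈ I} := by
  obtain ⟨hδ0, hδ1⟩ := hδ
  obtain ⟨hζ0, hζ1⟩ := hζ
  set k := numBlocks C₁ ε δ ζ with hk
  have hkpos : 0 < k := numBlocks_pos (by linarith) hε ⟨hδ0, hδ1⟩ ⟨hζ0, hζ1⟩
  have hk' : (0 : ℝ) < k := by exact_mod_cast hkpos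
  have hLg := two_thirds_le_log hδ0 hζ0 hδζ
  set Lg := Real.log (1 / (δ * ζ)) with hLgdef
  -- The only use of the size of `C₁`: it makes threshold, number of bad blocks and noise small
  -- compared with constant frequencies.
  have hεk : 4000 * Lg ≤ ε * k := by
    have h1 : C₁ * Lg / ε ≤ k := Nat.le_ceil _
    rw [div_le_iff₀ hε] at h1
    nlinarith
  have hkL : 4000 * Lg ≤ k := hεk.trans (by nlinarith)
  have hthr : 2 * Real.log (2 / δ) / (ε * k) + 1 / k ≤ 1 / 10 := by
    have h1 : Real.log (2 / δ) ≤ 2 * Lg := by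
      have h2 : 2 / δ ≤ (1 / (δ * ζ)) * (1 / (δ * ζ)) := by
        have h3 : 2 ≤ 1 / (δ * ζ) := by rw [le_div_iff₀ (by positivity)]; linarith
        have h4 : 1 / δ ≤ 1 / (δ * ζ) :=
          one_div_le_one_div_of_le (by positivity) (by nlinarith)
        calc 2 / δ = 2 * (1 / δ) := by ring
          _ ≤ _ := by gcongr
      calc Real.log (2 / δ) ≤ Real.log ((1 / (δ * ζ)) * (1 / (δ * ζ))) :=
            Real.log_le_log (by positivity) h2
        _ = 2 * Lg := by rw [Real.log_mul (by positivity) (by positivity)]; ring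
    have h2 : 2 * Real.log (2 / δ) / (ε * k) ≤ 1 / 20 := by
      rw [div_le_iff₀ (by positivity)]; linarith
    have h3 : 1 / (k : ℝ) ≤ 1 / 20 := one_div_le_one_div_of_le (by norm_num) (by linarith)
    linarith
  refine le_prod_of_forall_section _ _ _
    {ω | ⌈Lg⌉₊ ≤ Nat.card {j : Fin k // ∀ β ∈ W,
        blockEigenvalue k (fun i => ω i *ᵥ u) j ∉ geomBin β}}ᶜ hζ0.le hζ1.le
    (by rwa [compl_compl]) fun ω hω => ?_
  have hbad : (Nat.card {j : Fin k // ∀ β ∈ W,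
      blockEigenvalue k (fun i => ω i *ᵥ u) j ∉ geomBin β} : ℝ) ≤ Lg :=
    (Nat.lt_ceil.1 (not_le.1 hω)).le
  refine le_trans (measure_mono fun η hη => ?_)
    ((noiseLaw_occupied_le hkpos hε (fun j => topEigenvalue_nonneg
      (posSemidef_blockMatrix k (fun i => ω i *ᵥ u) j)) hW hbad).trans
        (ENNReal.ofReal_le_ofReal ?_))
  · intro hgood
    refine hη ?_
    obtain ⟨β, hβ, hout⟩ :=
      topBinEndpoint_stabilityHistogram hkpos hW (hbad.trans (by linarith)) hthr hgood
    exact ⟨leftEnd β, hout, hWI β hβ⟩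
  -- The exponent is at least `100 Lg`; five multiples of `Lg` suffice to beat the number of
  -- occupied bins and leave `ζ/2`.
  · have h1 : Lg + 3 ≤ 3 * Real.exp Lg := by have := Real.add_one_le_exp Lg; linarith
    have h2 : Real.exp (-(ε * k / 40)) ≤ Real.exp (-(4 * Lg)) * Real.exp (-Lg) := by
      rw [← Real.exp_add]; exact Real.exp_le_exp.2 (by linarith)
    have h3 : Real.exp (-Lg) = δ * ζ := by
      rw [Real.exp_neg, hLgdef, Real.exp_log (by positivity), one_div, inv_inv]
    have h4 : Real.exp (-(4 * Lg)) = (δ * ζ) ^ 4 := by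
      rw [← h3, ← Real.exp_nat_mul]; congr 1; push_cast; ring
    have h5 : Real.exp Lg = (δ * ζ)⁻¹ := by rw [← h3, ← Real.exp_neg, neg_neg]
    have hx : 0 < δ * ζ := by positivity
    calc (Lg + 3) * Real.exp (-(ε * k / 40))
        ≤ 3 * Real.exp Lg * (Real.exp (-(4 * Lg)) * Real.exp (-Lg)) := by gcongr
      _ = 3 * (δ * ζ) ^ 3 * (δ * ζ) := by rw [h3, h4, h5]; field_simp
      _ ≤ 3 * (1 / 2) ^ 3 * (1 * ζ) := by gcongr
      _ ≤ ζ / 2 := by linarith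

/-- The second moment is `L` and the fourth is at most `4 (4a)^(4a) κ² L²`, so the Cauchy–Schwarz
inequality bounds `κ` from below. -/
theorem one_le_of_tail {ν : Measure (Fin d → ℝ)} [IsProbabilityMeasure ν] {L κ a : ℝ}
    (hL : 0 < L) (hκ : 0 < κ) (ha : 0 < a) (v : Fin d → ℝ)
    (htail : ∫⁻ x, ENNReal.ofReal (Real.exp (((v ⬝ᵥ x) ^ 2 / (κ * L)) ^ (1 / (2 * a)))) ∂ν ≤ 4)
    (hvL : ∫⁻ x, ENNReal.ofReal ((v ⬝ᵥ x) ^ 2) ∂ν = ENNReal.ofReal L) :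
    1 ≤ 4 * (4 * a) ^ (4 * a) * κ ^ 2 := by
  have hmv := (continuous_dotProduct_right v).measurable
  have hpt : ∀ x : Fin d → ℝ, ENNReal.ofReal ((v ⬝ᵥ x) ^ 2) ≤
      ENNReal.ofReal (1 / (2 * L)) * ENNReal.ofReal (((v ⬝ᵥ x) ^ 2) ^ 2) +
        ENNReal.ofReal (L / 2) := by
    intro x
    rw [← ENNReal.ofReal_mul (by positivity), ← ENNReal.ofReal_add (by positivity) (by positivity)]
    refine ENNReal.ofReal_le_ofReal ?_
    set y := (v ⬝ᵥ x) ^ 2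
    have : 1 / (2 * L) * y ^ 2 + L / 2 - y = (y - L) ^ 2 / (2 * L) := by field_simp; ring
    have h2 : 0 ≤ (y - L) ^ 2 / (2 * L) := by positivity
    linarith
  have h := lintegral_mono (μ := ν) hpt
  rw [lintegral_add_right _ measurable_const, lintegral_const_mul' _ _ ENNReal.ofReal_ne_top,
    lintegral_const, measure_univ, mul_one, hvL] at h
  have h' := h.trans (add_le_add_left (mul_le_mul_right
    (lintegral_dotProduct_pow_four_le hL hκ ha v htail) _) _)
  rw [← ENNReal.ofReal_mul (by positivity), ← ENNReal.ofReal_add (by positivity) (by positivity),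
    ENNReal.ofReal_le_ofReal_iff (by positivity)] at h'
  have h3 : 1 / (2 * L) * (4 * (4 * a) ^ (4 * a) * (κ * L) ^ 2) + L / 2 =
      L * ((4 * (4 * a) ^ (4 * a) * κ ^ 2) / 2 + 1 / 2) := by field_simp
  rw [h3] at h'
  have h4 := le_of_mul_le_mul_left ((mul_one L).trans_le h') hL
  linarith

/-- Each block fails with probability at most `exp (-2) / k`, independently. A union bound over sets
of `m = ⌈log (1/(δζ))⌉` blocks gives `exp (-2m) ≤ (δζ)² ≤ ζ/2`. -/
theorem utility_of_pos {D : Measure (Matrix (Fin d) (Fin d) ℝ)} [IsProbabilityMeasure D]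
    {S : Matrix (Fin d) (Fin d) ℝ} {u : Fin d → ℝ} {K a : ℝ} (hd : 0 < d)
    (h : HasPSDMean D S) (ht : HasTail D S K a) (hK : 0 < K) (ha : 0 < a)
    (hpos : 0 < spectralNorm (covMatrix D S u))
    (hC₁ : 4000 ≤ C₁) (hε : 0 < ε) (hε1 : ε ≤ 1)
    (hδ : δ ∈ Set.Ioo (0 : ℝ) 1) (hζ : ζ ∈ Set.Ioo (0 : ℝ) 1) (hδζ : δ * ζ ≤ 1 / 2) (hB : 2 ≤ B)
    (hsize : sampleConst C₁ a * (K ^ 2 * d *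
      Real.log (B * d * Real.log (1 / (δ * ζ)) / ε) ^ (1 + 2 * a) *
        Real.log (1 / (δ * ζ)) / ε) ≤ B) :
    (Measure.pi fun _ : Fin B => D) {ω | ⌈Real.log (1 / (δ * ζ))⌉₊ ≤
      Nat.card {j : Fin (numBlocks C₁ ε δ ζ) // ∀ β ∈ nearBins (spectralNorm (covMatrix D S u)),
        blockEigenvalue (numBlocks C₁ ε δ ζ) (fun i => ω i *ᵥ u) j ∉ geomBin β}} ≤
      ENNReal.ofReal (ζ / 2) := by
  have hu : u ≠ 0 := by
    rintro rfl
    have : covMatrix D S 0 = 0 := by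
      ext i j; simp [covMatrix]
    rw [this] at hpos
    simp [spectralNorm] at hpos
  set Λ := spectralNorm (covMatrix D S u) with hΛ
  set k := numBlocks C₁ ε δ ζ with hk
  have hLg := two_thirds_le_log hδ.1 hζ.1 hδζ
  set Lg := Real.log (1 / (δ * ζ)) with hLgdef
  obtain ⟨v, hv, hvΛ⟩ := exists_dotProduct_mulVec_eq_spectralNorm hd (posSemidef_covMatrix h u)
  have hcov : ∀ w : Fin d → ℝ, w ⬝ᵥ w = 1 →
      ∫⁻ x, ENNReal.ofReal ((w ⬝ᵥ x) ^ 2) ∂(diffLaw D u) ≤ ENNReal.ofReal (2 * Λ) := by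
    intro w hw
    rw [lintegral_diffLaw_sq h]
    have := dotProduct_mulVec_le_spectralNorm (covMatrix D S u) hw
    exact ENNReal.ofReal_le_ofReal (by linarith)
  have hvL : ∫⁻ x, ENNReal.ofReal ((v ⬝ᵥ x) ^ 2) ∂(diffLaw D u) = ENNReal.ofReal (2 * Λ) := by
    rw [lintegral_diffLaw_sq h, hvΛ]
  have htail := lintegral_diffLaw_tail h ht ha hK hu hpos
  have hK1 := one_le_of_tail (by positivity) (by positivity) ha v (htail v hv) hvL
  obtain ⟨s, hs, hb, hsmall, hlarge, hkp⟩ := sample_size_bounds (k := k) (by linarith) ha hε hε1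
    hLg hd hB rfl hK1 hsize
  set T : Set (Fin (blockSize B k) → Fin d → ℝ) :=
    {X | topEigenvalue (gram X) ≤ 7 / 8 * (blockSize B k * (2 * Λ)) ∨
      9 / 8 * (blockSize B k * (2 * Λ)) ≤ topEigenvalue (gram X)} with hT
  have hTle : (Measure.pi fun _ : Fin (blockSize B k) => diffLaw D u) T ≤
      ENNReal.ofReal (7 * blockSize B k * d * Real.exp (-s)) :=
    measure_topEigenvalue_gram_bad_le hd hb (by positivity) (by positivity) ha hs hcov htail v hv
      hvL hsmall hlarge
  have hb' : (0 : ℝ) < blockSize B k := by exact_mod_cast hb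
  have hmem : ∀ (ω : Fin B → Matrix (Fin d) (Fin d) ℝ) (j : Fin k),
      (∀ β ∈ nearBins Λ, blockEigenvalue k (fun i => ω i *ᵥ u) j ∉ geomBin β) →
      blockDiff k u ω j ∈ T := by
    intro ω j hj
    by_contra hcon
    have hcon' : ¬ (topEigenvalue (gram (blockDiff k u ω j)) ≤
        7 / 8 * (blockSize B k * (2 * Λ)) ∨
      9 / 8 * (blockSize B k * (2 * Λ)) ≤ topEigenvalue (gram (blockDiff k u ω j))) := hcon
    push Not at hcon'
    obtain ⟨β, hβ, hmemβ⟩ := exists_mem_nearBins hpos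
      (y := blockEigenvalue k (fun i => ω i *ᵥ u) j)
      (by rw [blockEigenvalue_eq u ω j hb, one_div_mul_eq_div, lt_div_iff₀ (by positivity)]
          linarith [hcon'.1])
      (by rw [blockEigenvalue_eq u ω j hb, one_div_mul_eq_div, div_lt_iff₀ (by positivity)]
          linarith [hcon'.2])
    exact hj β hβ hmemβ
  set m := ⌈Lg⌉₊ with hm
  have hsub : {ω : Fin B → Matrix (Fin d) (Fin d) ℝ | m ≤ Nat.card {j : Fin k //
      ∀ β ∈ nearBins Λ, blockEigenvalue k (fun i => ω i *ᵥ u) j ∉ geomBin β}} ⊆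
      blockDiff k u ⁻¹' {y | m ≤ Nat.card {j // y j ∈ T}} := by
    intro ω hω
    refine le_trans (show m ≤ _ from hω) ?_
    refine Nat.card_le_card_of_injective (fun j => ⟨j.1, hmem ω j.1 j.2⟩) ?_
    intro j j' hjj
    exact Subtype.ext (congrArg (fun z => z.1) hjj)
  -- Only an upper bound is needed, and the outer measure of a preimage never exceeds that under the
  -- image law; no measurability of `T` is required.
  refine (measure_mono hsub).trans
    ((Measure.le_map_apply (measurable_blockDiff u).aemeasurable _).trans ?_)
  rw [map_blockDiff]
  refine (measure_card_ge_le _ T k m).trans ?_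
  calc (k * (Measure.pi fun _ : Fin (blockSize B k) => diffLaw D u) T) ^ m
      ≤ (k * ENNReal.ofReal (7 * blockSize B k * d * Real.exp (-s))) ^ m := by gcongr
    _ = ENNReal.ofReal ((k * (7 * blockSize B k * d * Real.exp (-s))) ^ m) := by
        rw [ENNReal.ofReal_pow (by positivity), ENNReal.ofReal_mul (p := (k : ℝ)) (by positivity),
          ENNReal.ofReal_natCast]
    _ ≤ ENNReal.ofReal (ζ / 2) := by
        refine ENNReal.ofReal_le_ofReal ?_
        calc ((k : ℝ) * (7 * blockSize B k * d * Real.exp (-s))) ^ m ≤ Real.exp (-2) ^ m := by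
              gcongr
          _ = Real.exp (m * (-2)) := (Real.exp_nat_mul _ _).symm
          _ ≤ Real.exp (-Lg + -Lg) := by
              refine Real.exp_le_exp.2 ?_
              have := Nat.le_ceil Lg
              rw [← hm] at this
              linarith
          _ = (δ * ζ) * (δ * ζ) := by
              have h3 : Real.exp (-Lg) = δ * ζ := by
                rw [Real.exp_neg, hLgdef, Real.exp_log (one_div_pos.2 (mul_pos hδ.1 hζ.1)),
                  one_div, inv_inv]
              rw [Real.exp_add, h3]
          _ ≤ 1 / 2 * (1 * ζ) := by
              have := hδ.1
              have := hζ.1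
              have := hδ.2.le
              gcongr
          _ = ζ / 2 := by ring

/-- Almost surely all samples `A u` coincide, so every difference vanishes and every point falls
into the bin `{0}`. -/
theorem utility_of_eq_zero {D : Measure (Matrix (Fin d) (Fin d) ℝ)} [IsProbabilityMeasure D]
    {S : Matrix (Fin d) (Fin d) ℝ} {u : Fin d → ℝ} (hd : 0 < d)
    (h : HasPSDMean D S) (h0 : spectralNorm (covMatrix D S u) = 0) {m : ℕ} (hm : 0 < m) (k : ℕ) :
    (Measure.pi fun _ : Fin B => D) {ω | m ≤
      Nat.card {j : Fin k // ∀ β ∈ ({none} : Finset (Option ℤ)),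
        blockEigenvalue k (fun i => ω i *ᵥ u) j ∉ geomBin β}} = 0 := by
  have hae : ∀ᵐ ω ∂(Measure.pi fun _ : Fin B => D), ∀ i, ω i *ᵥ u = S *ᵥ u :=
    ae_all_iff.2 fun i => (measurePreserving_eval (fun _ : Fin B => D) i).quasiMeasurePreserving.ae
      (ae_mulVec_eq_of_spectralNorm_eq_zero h h0)
  refine measure_mono_null (fun ω hω => ?_) (ae_iff.1 hae)
  intro hall
  have hz : ∀ j : Fin k, blockEigenvalue k (fun i => ω i *ᵥ u) j = 0 := by
    intro j
    have hdz : blockDiff k u ω j = 0 := by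
      ext1 i
      rw [blockDiff, hall, hall, sub_self]; rfl
    rw [blockEigenvalue, blockMatrix_mul_transpose, hdz]
    simp [gram, topEigenvalue_zero hd]
  have hempty : IsEmpty {j : Fin k // ∀ β ∈ ({none} : Finset (Option ℤ)),
      blockEigenvalue k (fun i => ω i *ᵥ u) j ∉ geomBin β} := by
    refine ⟨fun j => j.2 none (Finset.mem_singleton_self _) ?_⟩
    rw [hz]; rfl
  have hω' : m ≤ Nat.card {j : Fin k // ∀ β ∈ ({none} : Finset (Option ℤ)),
      blockEigenvalue k (fun i => ω i *ᵥ u) j ∉ geomBin β} := hω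
  rw [Nat.card_of_isEmpty] at hω'
  omega

end

end PrivateTopEigenvalue

end

/-! ### The privacy and utility theorem -/

theorem theorem6p1 :
    -- privacy, for all parameters
    (∀ (B d : ℕ) (C₁ ε δ ζ : ℝ), 0 < C₁ → 0 < ε → δ ∈ Set.Ioo (0 : ℝ) 1 → ζ ∈ Set.Ioo (0 : ℝ) 1 →
      PrivateTopEigenvalue.IsDP PrivateTopEigenvalue.noiseLaw
        (PrivateTopEigenvalue.privateTopEigenvalue (B := B) (d := d) C₁ ε δ ζ) ε δ) ∧
    -- utility; `C₀` is universal and `C` depends on `C₁` and `a` only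
    (∃ C₀ : ℝ, 0 < C₀ ∧ ∀ C₁ : ℝ, C₀ ≤ C₁ → ∀ a : ℝ, 0 < a → ∃ C : ℝ, 0 < C ∧
      ∀ (d B : ℕ) (K ε δ ζ : ℝ)
        (D : MeasureTheory.Measure (Matrix (Fin d) (Fin d) ℝ))
        (S : Matrix (Fin d) (Fin d) ℝ) (u : Fin d → ℝ),
        MeasureTheory.IsProbabilityMeasure D →
        PrivateTopEigenvalue.HasPSDMean D S →
        0 < K → PrivateTopEigenvalue.HasTail D S K a →
        0 < ε → ε ≤ 1 → δ ∈ Set.Ioo (0 : ℝ) 1 → ζ ∈ Set.Ioo (0 : ℝ) 1 → δ * ζ ≤ 1 / 2 →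
        2 ≤ B →
        C * (K ^ 2 * d * Real.log (B * d * Real.log (1 / (δ * ζ)) / ε) ^ (1 + 2 * a) *
          Real.log (1 / (ζ * δ)) / ε) ≤ B →
        ENNReal.ofReal (1 - ζ) ≤
          ((MeasureTheory.Measure.pi fun _ : Fin B => D).prod PrivateTopEigenvalue.noiseLaw)
            {ω | ∃ L : ℝ,
              PrivateTopEigenvalue.privateTopEigenvalue C₁ ε δ ζ
                (fun i => (ω.1 i).mulVec u) ω.2 = some L ∧
              L ∈ Set.Icc
                (1 / √2 * (PrivateTopEigenvalue.topEigenvalue S ^ 2 *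
                  PrivateTopEigenvalue.spectralNorm (PrivateTopEigenvalue.gradientCov D S u)))
                (√2 * (PrivateTopEigenvalue.topEigenvalue S ^ 2 *
                  PrivateTopEigenvalue.spectralNorm
                    (PrivateTopEigenvalue.gradientCov D S u)))}) := by
  refine ⟨fun B d C₁ ε δ ζ hC hε hδ hζ =>
    PrivateTopEigenvalue.isDP_privateTopEigenvalue B d C₁ ε δ ζ hC hε hδ hζ,
    4000, by norm_num, fun C₁ hC₁ a ha =>
    ⟨PrivateTopEigenvalue.sampleConst C₁ a,
      PrivateTopEigenvalue.sampleConst_pos (by linarith) ha, ?_⟩⟩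
  intro d B K ε δ ζ D S u hD h hK ht hε hε1 hδ hζ hδζ hB hsize
  -- In dimension zero the spectrum is empty and its supremum is `0` by convention, against `λ₁ >
  -- 0`.
  have hd : 0 < d := by
    rcases Nat.eq_zero_or_pos d with rfl | hd
    · have h1 := h.top_pos
      rw [PrivateTopEigenvalue.topEigenvalue, spectrum.of_subsingleton, Real.sSup_empty] at h1
      exact absurd h1 (lt_irrefl _)
    · exact hd
  rw [mul_comm ζ δ] at hsize
  rw [PrivateTopEigenvalue.topEigenvalue_sq_mul_spectralNorm h.top_pos]
  have hnonneg : 0 ≤ PrivateTopEigenvalue.spectralNorm (PrivateTopEigenvalue.covMatrix D S u) :=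
    norm_nonneg _
  -- For zero covariance the geometric bins are useless; the bin `{0}`, with left endpoint `0`, hits
  -- the degenerate target interval exactly.
  rcases hnonneg.eq_or_lt with h0 | hpos
  · refine PrivateTopEigenvalue.utility_of_few_bad_blocks u hC₁ hε hε1 hδ hζ hδζ
      (W := {none}) (by simp) ?_ ?_
    · intro β hβ
      rw [Finset.mem_singleton.1 hβ, ← h0]
      simp [PrivateTopEigenvalue.leftEnd]
    · have hLg := PrivateTopEigenvalue.two_thirds_le_log hδ.1 hζ.1 hδζ
      rw [PrivateTopEigenvalue.utility_of_eq_zero hd h h0.symm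
        (Nat.ceil_pos.2 (by linarith)) _]
      exact zero_le
  · exact PrivateTopEigenvalue.utility_of_few_bad_blocks u hC₁ hε hε1 hδ hζ hδζ
      (PrivateTopEigenvalue.card_nearBins_le _)
      (fun β hβ => PrivateTopEigenvalue.leftEnd_mem_of_mem_nearBins hpos hβ)
      (PrivateTopEigenvalue.utility_of_pos hd h ht hK ha hpos hC₁ hε hε1 hδ hζ hδζ hB hsize)
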